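/- Let $d\ge 2$, let $\Omega\subset\mathbb{R}^d$ be open and bounded with $C^2$ boundary, and let $f\in L^2(\Omega)$. Write $|\cdot|$ for Lebesgue measure and $B(x,R)$ for the open ball. Let $m\in\mathbb{N}$, let $F_1,\dots,F_m\subset\mathbb{R}^d$ be pairwise disjoint sets with $|\partial F_k|=0$, and let $N_1,\dots,N_m\in\mathbb{N}$. Let $A\subset\mathbb{R}^d$ be Lebesgue measurable and bounded and $\Lambda\subset\mathbb{R}^d$ countable such that $\mathbb{R}^d$ is the disjoint union of the sets $A+i$, $i\in\Lambda$. Put $A_i^\varepsilon=\varepsilon(A+i)$ and $\Lambda_\varepsilon^-(F_k)=\{i\in\Lambda : A_i^\varepsilon\subset F_k\}$ for $\varepsilon>0$. Let $C>0$ satisfy $N_k|B(0,C)|<|A|$ for all $k$. For $\varepsilon>0$, $k\le m$, $i\in\Lambda_\varepsilon^-(F_k)$ and $1\le j\le N_k$ let points $x_{i,j}^\varepsilon\in\mathbb{R}^d$ be given such that, for all sufficiently small $\varepsilon$ and all such $k$ and $i$, the balls $B(x_{i,j}^\varepsilon,C\varepsilon)$, $1\le j\le N_k$, are pairwise disjoint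 and contained in $A_i^\varepsilon$. Let radii $a_{\varepsilon,k}>0$ be given (with $a_{\varepsilon,k}<1$ for small $\varepsilon$ if $d=2$) such that, as $\varepsilon\to0^+$, for each $k$, \[ \varepsilon^{-d}\,(-\log a_{\varepsilon,k})^{-1}\to\tilde\mu_k \ \ (d=2),\qquad \varepsilon^{-d}\,a_{\varepsilon,k}^{\,d-2}\to\tilde\mu_k\ \ (d\ge3),\qquad \tilde\mu_k\in[0,\infty). \] Put \[ T_\varepsilon=\bigcup_{k=1}^m\ \bigcup_{i\in\Lambda_\varepsilon^-(F_k)}\ \bigcup_{j=1}^{N_k}\overline{B(x_{i,j}^\varepsilon,a_{\varepsilon,k})},\qquad \Omega_\varepsilon=\Omega\setminus T_\varepsilon, \] \[ V=\mu_d\sum_{k=1}^m\tilde\mu_kN_k1_{F_k},\qquad \mu_d=\frac{S_d}{|A|}\ \ (d=2),\qquad \mu_d=\frac{(d-2)S_d}{|A|}\ \ (d\ge3), \] where $S_d$ is the surface area of the unit sphere $\partial B(0,1)$. Then for all sufficiently small $\varepsilon>0$ the problem $u^\varepsilon\in H_0^1(\Omega_\varepsilon)$, $-\Delta u^\varepsilon=f$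 in $\Omega_\varepsilon$, has a unique weak solution; the problem $u\in H_0^1(\Omega)$, $(-\Delta+V)u=f$ in $\Omega$, has a unique weak solution; and the functions $u^\varepsilon$, extended by zero to $\Omega$, converge to $u$ weakly in $H_0^1(\Omega)$ as $\varepsilon\to0^+$. -/

import Mathlib

open MeasureTheory Filter Topology Set
open scoped ContDiff Gradient

noncomputable section

/-- Euclidean space `ℝ^d`. -/
abbrev Eucl (d : ℕ) : Type := EuclideanSpace ℝ (Fin d)

/-- The boundary of `Ω` is of class `C²`: near each boundary point, `Ω` is the set where a `C²`
function with non-vanishing differential at that point is negative. -/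
def HasC2Boundary {d : ℕ} (Ω : Set (Eucl d)) : Prop :=
  ∀ x ∈ frontier Ω, ∃ (U : Set (Eucl d)) (ρ : Eucl d → ℝ),
    IsOpen U ∧ x ∈ U ∧ ContDiffOn ℝ 2 ρ U ∧ ρ x = 0 ∧ fderiv ℝ ρ x ≠ 0 ∧
      Ω ∩ U = {y ∈ U | ρ y < 0}

/-- `φ ∈ C_c^∞(U)`, as a function on the whole space. -/
structure IsTestFun {d : ℕ} (U : Set (Eucl d)) (φ : Eucl d → ℝ) : Prop where
  smooth : ContDiff ℝ ∞ φ
  compact : HasCompactSupport φ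
  support : tsupport φ ⊆ U

/-- The Hilbert space `L²(ℝ^d) × L²(ℝ^d; ℝ^d)` with
`‖(u, g)‖² = ‖u‖² + ‖g‖²`. A Sobolev function `u` is represented by the pair `(u, ∇u)`, so the norm
of the pair is the `H¹` norm of `u`. -/
abbrev L2Pair (d : ℕ) : Type :=
  WithLp 2 (Lp ℝ 2 (volume : Measure (Eucl d)) × Lp (Eucl d) 2 (volume : Measure (Eucl d)))

lemma IsTestFun.gradient_add {d : ℕ} {U : Set (Eucl d)} {φ ψ : Eucl d → ℝ}
    (hφ : IsTestFun U φ) (hψ : IsTestFun U ψ) (x : Eucl d) :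
    ∇ (φ + ψ) x = ∇ φ x + ∇ ψ x := by
  have h1 : DifferentiableAt ℝ φ x := (hφ.smooth.differentiable (by simp)) x
  have h2 : DifferentiableAt ℝ ψ x := (hψ.smooth.differentiable (by simp)) x
  simp [gradient, fderiv_add h1 h2]

lemma IsTestFun.gradient_smul {d : ℕ} {U : Set (Eucl d)} {φ : Eucl d → ℝ}
    (hφ : IsTestFun U φ) (c : ℝ) (x : Eucl d) :
    ∇ (c • φ) x = c • ∇ φ x := by
  have h1 : DifferentiableAt ℝ φ x := (hφ.smooth.differentiable (by simp)) x
  simp [gradient, fderiv_const_smul h1]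

/-- The space `C_c^∞(U)`, embedded through `φ ↦ (φ, ∇φ)`. -/
def testPairs {d : ℕ} (U : Set (Eucl d)) : Submodule ℝ (L2Pair d) where
  carrier := {p | ∃ φ : Eucl d → ℝ, IsTestFun U φ ∧ p.fst =ᵐ[volume] φ ∧ p.snd =ᵐ[volume] ∇ φ}
  zero_mem' := by
    refine ⟨0, ⟨contDiff_const, HasCompactSupport.zero, by simp [tsupport]⟩, ?_, ?_⟩
    · exact Lp.coeFn_zero _ _ _
    · refine (Lp.coeFn_zero _ _ _).trans (Eventually.of_forall fun x => ?_)
      simp [gradient]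
  add_mem' := by
    rintro p q ⟨φ, hφ, hp1, hp2⟩ ⟨ψ, hψ, hq1, hq2⟩
    refine ⟨φ + ψ, ⟨hφ.smooth.add hψ.smooth, hφ.compact.add hψ.compact,
      (tsupport_add φ ψ).trans (union_subset hφ.support hψ.support)⟩, ?_, ?_⟩
    · exact (Lp.coeFn_add p.fst q.fst).trans (hp1.add hq1)
    · refine (Lp.coeFn_add p.snd q.snd).trans ((hp2.add hq2).trans
        (Eventually.of_forall fun x => ?_))
      exact (hφ.gradient_add hψ x).symm
  smul_mem' := by
    rintro c p ⟨φ, hφ, hp1, hp2⟩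
    refine ⟨c • φ, ⟨hφ.smooth.const_smul c, hφ.compact.smul_left (f := fun _ => c),
      (tsupport_smul_subset_right (fun _ => c) φ).trans hφ.support⟩, ?_, ?_⟩
    · exact (Lp.coeFn_smul c p.fst).trans (hp1.const_smul c)
    · refine (Lp.coeFn_smul c p.snd).trans ((hp2.const_smul c).trans
        (Eventually.of_forall fun x => ?_))
      exact (hφ.gradient_smul c x).symm

/-- The Sobolev space `H_0^1(U)`: the closure of `C_c^∞(U)` in the `H¹` norm. Its elements are
extended by zero to `ℝ^d`, so that `H_0^1(U) ⊆ H_0^1(W)` for `U ⊆ W`; the element `p` stands for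
the function `p.fst`, and `p.snd` is its weak gradient. -/
def H10 {d : ℕ} (U : Set (Eucl d)) : Submodule ℝ (L2Pair d) :=
  (testPairs U).topologicalClosure

/-- `p ∈ H_0^1(U)` and `(-Δ + V) p = f` in the sense of distributions on `U`. -/
def IsDirichletSolution {d : ℕ} (U : Set (Eucl d)) (V f : Eucl d → ℝ) (p : L2Pair d) : Prop :=
  p ∈ H10 U ∧ ∀ φ : Eucl d → ℝ, IsTestFun U φ →
    (∫ x in U, inner ℝ (p.snd x) (∇ φ x)) + (∫ x in U, V x * p.fst x * φ x)
      = ∫ x in U, f x * φ x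

/-- The tile `ε (A + i)`. -/
def tile {d : ℕ} (A : Set (Eucl d)) (ε : ℝ) (i : Eucl d) : Set (Eucl d) :=
  (fun x => ε • (x + i)) '' A

/-- The `i ∈ Λ` for which the tile `ε (A + i)` lies in `F`. -/
def innerIndices {d : ℕ} (A Λ : Set (Eucl d)) (ε : ℝ) (F : Set (Eucl d)) : Set (Eucl d) :=
  {i ∈ Λ | tile A ε i ⊆ F}

/-- The union of the holes of size `ε`: closed balls of radius `a ε k` around the `N k` centres
`x ε i j`, `j < N k`, for each tile `ε (A + i)` contained in `F k`. -/
def holes {d m : ℕ} (A Λ : Set (Eucl d)) (F : Fin m → Set (Eucl d)) (N : Fin m → ℕ)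
    (x : ℝ → Eucl d → ℕ → Eucl d) (a : ℝ → Fin m → ℝ) (ε : ℝ) : Set (Eucl d) :=
  ⋃ k : Fin m, ⋃ i ∈ innerIndices A Λ ε (F k), ⋃ j ∈ Finset.range (N k),
    Metric.closedBall (x ε i j) (a ε k)

/-- The quantity whose ratio to `ε^d` is required to converge for holes of radius `r`. -/
def capScale (d : ℕ) (r : ℝ) : ℝ :=
  if d = 2 then (-Real.log r)⁻¹ else r ^ (d - 2)

/-- The surface area of the unit sphere in `ℝ^d`. -/
def sphereArea (d : ℕ) : ℝ :=
  (volume : Measure (Eucl d)).toSphere.real univ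

/-- The constant `μ_d`, equal to `S_d / |A|` if `d = 2` and to `(d - 2) S_d / |A|` if `d ≥ 3`. -/
def muConst (d : ℕ) (A : Set (Eucl d)) : ℝ :=
  sphereArea d / (volume : Measure (Eucl d)).real A * (if d = 2 then 1 else (d : ℝ) - 2)

/-- The potential `V = μ_d ∑_k μ_k N_k 1_{F_k}`. -/
def holePotential {d m : ℕ} (A : Set (Eucl d)) (F : Fin m → Set (Eucl d)) (N : Fin m → ℕ)
    (μt : Fin m → ℝ) (y : Eucl d) : ℝ :=
  muConst d A * ∑ k : Fin m, μt k * (N k : ℝ) * (F k).indicator (fun _ => (1 : ℝ)) y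

end

/-! The proof is the method of oscillating test functions. For each small `ε` a smooth function `w`
is built that vanishes near the holes, equals 1 outside the balls of radius `R = Cε` around the
centres, and tends to 1 in `L²`. For a test function `φ` on `Ω`, the product `φ w` is admissible in
the perforated problem. Comparing `∫ ∇u · ∇(φ w)` with `∫ ∇u · ∇φ` leaves `∫ ∇(u φ) · ∇w` and terms
carrying the factor `w - 1`. The potential `V` appears because `-Δw`, tested against functions
vanishing on the holes, tends to `V`.

In one ball, with `y = (x - c) / R`, the exact capacitary potential would be affine in the
fundamental solution `fundSol d ‖y‖`, from 0 at the hole (level `T = fundSol d (a / R)`) to 1 at the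
unit sphere (level 0). The profile `descent T` is a smoothed version with slope about `-1 / T`,
flattened over layers of bounded width in the variable `fundSol`. The singular field `plateauConst T
• fluxField` differs from `∇w` only in a layer next to the hole, where the squared error is at most
`4 S_d (plateauConst T)²` (`norm_sq_residual_le`, `integral_layerWeight`). Its singularity at the
centre is invisible to functions vanishing on the hole, and its divergence is a fixed bounded
density of total mass `S_d`, up to sign and the factor `plateauConst T`. So `-Δw` becomes an
explicit bounded function, `holeDensity`, plus an error that tends to zero
(`abs_integral_gradient_corrector_sub_le`).

The critical scaling gives `plateauConst T * R^(d-2) * ε^(-d) → dimFactor d * μ`. The mean of the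
density over a tile in `F k` therefore tends to the value of `V` on `F k`. Since the frontiers are
null, tiles cut by a boundary are negligible, and the averages of density minus potential over small
balls tend to zero. A uniformly bounded family with this property tends to zero in `H⁻¹`
(`eventually_abs_integral_mul_le`): averaging costs `δ ‖∇g‖`, and for fixed `δ` the averages tend to
zero in `L²` by dominated convergence.

All estimates are uniform in `g` ranging over test functions on the perforated domain, with
right-hand side small times the `H¹` norm. By density they apply to the solution itself
(`abs_dirichletForm_sub_le`), so no compact embedding and no subsequence is needed. With the uniform
energy bound, the limit form tested on `φ` converges to `∫ f φ`; density of test functions and the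
Lax-Milgram theorem turn this into weak convergence (`IsCorrectorFamily.tendsto_dirichletSolution`).
-/

/-! ### Gradients, divergence and integration by parts -/

/-- The divergence of a vector field. -/
noncomputable def divergence {d : ℕ} (X : Eucl d → Eucl d) (x : Eucl d) : ℝ :=
  ∑ i, (fderiv ℝ X x (EuclideanSpace.single i 1)) i

/-- The factor `h` may be singular off the support of `ψ`, where the product is locally zero. This
is what allows fields with a pole inside a hole to be tested. -/
lemma continuous_mul_of_tsupport {α : Type*} [TopologicalSpace α] {ψ h : α → ℝ}
    (hψ : Continuous ψ) (hh : ∀ x ∈ tsupport ψ, ContinuousAt h x) :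
    Continuous fun x => ψ x * h x := by
  refine continuous_iff_continuousAt.2 fun x => ?_
  by_cases hx : x ∈ tsupport ψ
  · exact hψ.continuousAt.mul (hh x hx)
  · have h0 : (fun x => ψ x * h x) =ᶠ[𝓝 x] fun _ => 0 := by
      filter_upwards [notMem_tsupport_iff_eventuallyEq.1 hx] with y hy
      simp [hy]
    exact continuousAt_const.congr h0.symm

lemma integrable_mul_of_tsupport {d : ℕ} {ψ h : Eucl d → ℝ}
    (hψ : Continuous ψ) (hc : HasCompactSupport ψ) (hh : ∀ x ∈ tsupport ψ, ContinuousAt h x) :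
    Integrable fun x => ψ x * h x :=
  (continuous_mul_of_tsupport hψ hh).integrable_of_hasCompactSupport hc.mul_right

lemma inner_gradient_eq_sum {d : ℕ} (ψ : Eucl d → ℝ) (x v : Eucl d) :
    inner ℝ (∇ ψ x) v = ∑ i, fderiv ℝ ψ x (EuclideanSpace.single i 1) * v i := by
  rw [gradient, InnerProductSpace.toDual_symm_apply]
  conv_lhs => rw [← (EuclideanSpace.basisFun (Fin d) ℝ).sum_repr v]
  simp [mul_comm]

lemma continuous_gradient {d : ℕ} {ψ : Eucl d → ℝ} (hψ : ContDiff ℝ 1 ψ) : Continuous (∇ ψ) :=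
  (InnerProductSpace.toDual ℝ (Eucl d)).symm.continuous.comp (hψ.continuous_fderiv (by simp))

lemma tsupport_gradient_subset {d : ℕ} (ψ : Eucl d → ℝ) : tsupport (∇ ψ) ⊆ tsupport ψ := by
  refine (closure_mono fun x hx => ?_).trans (tsupport_fderiv_subset ℝ (f := ψ))
  intro h0
  exact hx (by simp [gradient, h0])

lemma HasCompactSupport.gradient {d : ℕ} {ψ : Eucl d → ℝ} (hc : HasCompactSupport ψ) :
    HasCompactSupport (∇ ψ) :=
  hc.of_isClosed_subset (isClosed_tsupport _) (tsupport_gradient_subset ψ)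

lemma gradient_eq_zero_of_notMem_tsupport {d : ℕ} {ψ : Eucl d → ℝ} {x : Eucl d}
    (hx : x ∉ tsupport ψ) : ∇ ψ x = 0 :=
  image_eq_zero_of_notMem_tsupport fun h => hx (tsupport_gradient_subset ψ h)

lemma norm_gradient {d : ℕ} (ψ : Eucl d → ℝ) (x : Eucl d) : ‖∇ ψ x‖ = ‖fderiv ℝ ψ x‖ := by
  simp [gradient]

/-- Integration by parts against a vector field which is regular on the support of the scalar
function. -/
lemma integral_inner_gradient_eq_neg_integral_divergence {d : ℕ} {ψ : Eucl d → ℝ}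
    {X : Eucl d → Eucl d} (hψ : ContDiff ℝ 1 ψ) (hc : HasCompactSupport ψ)
    (hX : ∀ x ∈ tsupport ψ, ContDiffAt ℝ 1 X x) :
    ∫ x, inner ℝ (∇ ψ x) (X x) = -∫ x, ψ x * divergence X x := by
  have hXi : ∀ i, ∀ x ∈ tsupport ψ, ContDiffAt ℝ 1 (fun y => X y i) x := fun i x hx =>
    (contDiffAt_euclidean.1 (hX x hx)) i
  have hfd : ∀ i, ∀ x ∈ tsupport ψ, fderiv ℝ X x (EuclideanSpace.single i 1) i
      = fderiv ℝ (fun y => X y i) x (EuclideanSpace.single i 1) := by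
    intro i x hx
    have h := ((hX x hx).differentiableAt (by simp)).hasFDerivAt
    have h2 := ((EuclideanSpace.proj i : Eucl d →L[ℝ] ℝ).hasFDerivAt).comp x h
    have h3 : fderiv ℝ (fun y => X y i) x = _ := h2.fderiv
    rw [h3]; rfl
  have hcont : ∀ i, ∀ x ∈ tsupport ψ,
      ContinuousAt (fun x => fderiv ℝ (fun y => X y i) x (EuclideanSpace.single i 1)) x :=
    fun i x hx => (((hXi i x hx).continuousAt_fderiv (by simp)).clm_apply continuousAt_const)
  have hts : ∀ i, tsupport (fun x => fderiv ℝ ψ x (EuclideanSpace.single i 1)) ⊆ tsupport ψ :=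
    fun i => (tsupport_fderiv_apply_subset ℝ _)
  have I1 : ∀ i, Integrable fun x => fderiv ℝ ψ x (EuclideanSpace.single i 1) * X x i := fun i =>
    integrable_mul_of_tsupport ((hψ.continuous_fderiv (by simp)).clm_apply continuous_const)
      (hc.of_isClosed_subset (isClosed_tsupport _) (hts i))
      (fun x hx => (hXi i x (hts i hx)).continuousAt)
  have I2 : ∀ i, Integrable fun x => ψ x * fderiv ℝ (fun y => X y i) x (EuclideanSpace.single i 1) :=
    fun i => integrable_mul_of_tsupport hψ.continuous hc (hcont i)
  have key : ∀ i, ∫ x, fderiv ℝ ψ x (EuclideanSpace.single i 1) * X x i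
      = -∫ x, ψ x * fderiv ℝ (fun y => X y i) x (EuclideanSpace.single i 1) := by
    intro i
    rw [integral_mul_fderiv_eq_neg_fderiv_mul_of_integrable (I1 i) (I2 i)
      (integrable_mul_of_tsupport hψ.continuous hc (fun x hx => (hXi i x hx).continuousAt))
      (fun x _ => hψ.differentiable (by simp) x)
      (fun x hx => (hXi i x hx).differentiableAt (by simp)), neg_neg]
  simp_rw [inner_gradient_eq_sum]
  rw [integral_finsetSum _ fun i _ => I1 i, Finset.sum_congr rfl fun i _ => key i,
    Finset.sum_neg_distrib, ← integral_finsetSum _ fun i _ => I2 i]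
  congr 1
  refine integral_congr_ae (Eventually.of_forall fun x => ?_)
  -- Off the support `X` need not be differentiable and `fderiv` may return its default value; the
  -- factor `ψ` removes it.
  by_cases hx : x ∈ tsupport ψ
  · simp only [divergence, Finset.mul_sum]
    exact Finset.sum_congr rfl fun i _ => by rw [hfd i x hx]
  · simp [image_eq_zero_of_notMem_tsupport hx]

/-- The `L¹` modulus of continuity of a `C¹` function with compact support. -/
lemma integral_abs_translate_sub_le {d : ℕ} {g : Eucl d → ℝ} (hg : ContDiff ℝ 1 g)
    (hc : HasCompactSupport g) (h : Eucl d) :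
    ∫ x, |g (x + h) - g x| ≤ ‖h‖ * ∫ x, ‖∇ g x‖ := by
  have hgc := continuous_gradient hg
  have hI : Integrable fun x => ‖∇ g x‖ :=
    (hgc.integrable_of_hasCompactSupport hc.gradient).norm
  have hdiff : Integrable fun x => |g (x + h) - g x| := by
    have h1 := hg.continuous.integrable_of_hasCompactSupport (μ := volume) hc
    exact ((h1.comp_add_right h).sub h1).abs
  -- Fundamental theorem of calculus along the segment from `x` to `x + h`. Fubini and translation
  -- invariance then remove the dependence on `t`.
  have hpt : ∀ x, |g (x + h) - g x| ≤ ∫ t in (0:ℝ)..1, ‖h‖ * ‖∇ g (x + t • h)‖ := by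
    intro x
    have hder : ∀ t ∈ uIcc (0:ℝ) 1, HasDerivAt (fun t : ℝ => g (x + t • h))
        (fderiv ℝ g (x + t • h) h) t := by
      intro t _
      have h1 : HasDerivAt (fun t : ℝ => x + t • h) h t := by
        simpa using ((hasDerivAt_id t).smul_const h).const_add x
      exact ((hg.differentiable (by simp) _).hasFDerivAt).comp_hasDerivAt t h1
    have hcd : Continuous fun t : ℝ => fderiv ℝ g (x + t • h) h :=
      ((hg.continuous_fderiv (by simp)).comp (by fun_prop)).clm_apply continuous_const
    have hftc := intervalIntegral.integral_eq_sub_of_hasDerivAt hder (hcd.intervalIntegrable _ _)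
    simp only [one_smul, zero_smul, add_zero] at hftc
    rw [← hftc]
    refine (intervalIntegral.abs_integral_le_integral_abs zero_le_one).trans
      (intervalIntegral.integral_mono_on zero_le_one (hcd.abs.intervalIntegrable _ _)
        (Continuous.intervalIntegrable (by fun_prop) _ _) fun t _ => ?_)
    rw [norm_gradient, mul_comm]
    exact (fderiv ℝ g (x + t • h)).le_opNorm h
  have hprod : Integrable (fun p : Eucl d × ℝ => ‖∇ g (p.1 + p.2 • h)‖)
      (volume.prod (volume.restrict (Ioc (0:ℝ) 1))) := by
    rw [integrable_prod_iff' (by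
      exact (hgc.norm.comp (by fun_prop)).aestronglyMeasurable)]
    refine ⟨Eventually.of_forall fun t => hI.comp_add_right (t • h), ?_⟩
    simp only [norm_norm]
    have : ∀ t : ℝ, ∫ x, ‖∇ g (x + t • h)‖ = ∫ x, ‖∇ g x‖ := fun t =>
      integral_add_right_eq_self (fun x => ‖∇ g x‖) (t • h)
    simp only [this]
    exact integrable_const _
  calc ∫ x, |g (x + h) - g x|
      ≤ ∫ x, ∫ t in (0:ℝ)..1, ‖h‖ * ‖∇ g (x + t • h)‖ := by
        refine integral_mono hdiff ?_ hpt
        simp only [intervalIntegral.integral_of_le zero_le_one]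
        exact (hprod.const_mul ‖h‖).integral_prod_left
    _ = ∫ x, ∫ t in Ioc (0:ℝ) 1, ‖h‖ * ‖∇ g (x + t • h)‖ := by
        simp only [intervalIntegral.integral_of_le zero_le_one]
    _ = ∫ t in Ioc (0:ℝ) 1, ∫ x, ‖h‖ * ‖∇ g (x + t • h)‖ :=
        integral_integral_swap (hprod.const_mul ‖h‖)
    _ = ∫ t in Ioc (0:ℝ) 1, ‖h‖ * ∫ x, ‖∇ g x‖ := by
        congr 1 with t
        rw [integral_const_mul, integral_add_right_eq_self (fun x => ‖∇ g x‖) (t • h)]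
    _ = ‖h‖ * ∫ x, ‖∇ g x‖ := by simp

/-! ### The `L²` norm and Cauchy-Schwarz -/

/-- The `L²` norm of a function on `ℝ^d`. -/
noncomputable def normL2 {d : ℕ} {E : Type*} [NormedAddCommGroup E] (f : Eucl d → E) : ℝ :=
  (eLpNorm f 2 (volume : Measure (Eucl d))).toReal

section normL2

variable {d : ℕ} {E : Type*} [NormedAddCommGroup E]

lemma normL2_nonneg (f : Eucl d → E) : 0 ≤ normL2 f := ENNReal.toReal_nonneg

lemma normL2_sq {f : Eucl d → E} (hf : MemLp f 2 volume) : normL2 f ^ 2 = ∫ x, ‖f x‖ ^ 2 := by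
  have h := hf.eLpNorm_eq_integral_rpow_norm (by simp) (by simp)
  have h0 : 0 ≤ ∫ x, ‖f x‖ ^ 2 := integral_nonneg fun x => by positivity
  simp only [ENNReal.toReal_ofNat, Real.rpow_ofNat] at h
  rw [normL2, h, ENNReal.toReal_ofReal (by positivity), ← Real.rpow_natCast, ← Real.rpow_mul h0]
  norm_num

lemma normL2_le_of_le {F : Type*} [NormedAddCommGroup F] {f : Eucl d → E} {g : Eucl d → F}
    (hg : MemLp g 2 volume) {c : ℝ} (hc : 0 ≤ c) (h : ∀ x, ‖f x‖ ≤ c * ‖g x‖) :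
    normL2 f ≤ c * normL2 g := by
  have h1 := eLpNorm_le_mul_eLpNorm_of_ae_le_mul (μ := (volume : Measure (Eucl d)))
    (Eventually.of_forall h) 2
  have h2 := ENNReal.toReal_mono (ENNReal.mul_ne_top ENNReal.ofReal_ne_top hg.eLpNorm_ne_top) h1
  rwa [ENNReal.toReal_mul, ENNReal.toReal_ofReal hc] at h2

lemma normL2_add_le {f g : Eucl d → E} (hf : MemLp f 2 volume) (hg : MemLp g 2 volume) :
    normL2 (f + g) ≤ normL2 f + normL2 g := by
  have h1 := eLpNorm_add_le hf.aestronglyMeasurable hg.aestronglyMeasurable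
    (p := 2) (by norm_num)
  rw [normL2, normL2, normL2, ← ENNReal.toReal_add hf.eLpNorm_ne_top hg.eLpNorm_ne_top]
  exact ENNReal.toReal_mono (ENNReal.add_ne_top.2 ⟨hf.eLpNorm_ne_top, hg.eLpNorm_ne_top⟩) h1

lemma abs_integral_inner_le_normL2 [InnerProductSpace ℝ E] {f g : Eucl d → E}
    (hf : MemLp f 2 volume) (hg : MemLp g 2 volume) :
    |∫ x, inner ℝ (f x) (g x)| ≤ normL2 f * normL2 g := by
  have h := abs_real_inner_le_norm (hf.toLp f) (hg.toLp g)
  rw [Lp.norm_toLp, Lp.norm_toLp, L2.inner_def] at h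
  refine le_of_eq_of_le (congrArg _ ?_) h
  refine integral_congr_ae ?_
  filter_upwards [hf.coeFn_toLp, hg.coeFn_toLp] with x h1 h2
  rw [h1, h2]

lemma abs_integral_mul_le_normL2 {f g : Eucl d → ℝ}
    (hf : MemLp f 2 volume) (hg : MemLp g 2 volume) :
    |∫ x, f x * g x| ≤ normL2 f * normL2 g := by
  simpa [mul_comm] using abs_integral_inner_le_normL2 hg hf

lemma integral_norm_mul_norm_le_normL2 {F : Type*} [NormedAddCommGroup F] {f : Eucl d → E}
    {g : Eucl d → F} (hf : MemLp f 2 volume) (hg : MemLp g 2 volume) :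
    ∫ x, ‖f x‖ * ‖g x‖ ≤ normL2 f * normL2 g := by
  have h := (le_abs_self _).trans (abs_integral_mul_le_normL2 hf.norm hg.norm)
  have e1 : normL2 (fun x => ‖f x‖) = normL2 f := by simp [normL2]
  have e2 : normL2 (fun x => ‖g x‖) = normL2 g := by simp [normL2]
  rwa [e1, e2] at h

lemma integral_norm_le_of_support {f : Eucl d → E} (hf : MemLp f 2 volume) {D : Set (Eucl d)}
    (hD : MeasurableSet D) (hDf : volume D ≠ ⊤) (hs : ∀ x ∉ D, f x = 0) :
    ∫ x, ‖f x‖ ≤ √(volume.real D) * normL2 f := by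
  have hm : MemLp (D.indicator fun _ => (1 : ℝ)) 2 (volume : Measure (Eucl d)) :=
    memLp_indicator_const 2 hD 1 (Or.inr hDf)
  have h := integral_norm_mul_norm_le_normL2 hm hf
  have e1 : normL2 (D.indicator fun _ => (1 : ℝ)) = √(volume.real D) := by
    rw [eq_comm, Real.sqrt_eq_iff_mul_self_eq measureReal_nonneg (normL2_nonneg _), ← sq,
      normL2_sq hm]
    have : (fun x => ‖D.indicator (fun _ => (1 : ℝ)) x‖ ^ 2) = D.indicator fun _ => (1 : ℝ) := by
      ext x; by_cases hx : x ∈ D <;> simp [hx]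
    rw [this, integral_indicator_const _ hD]; simp
  rw [e1] at h
  refine le_trans (le_of_eq ?_) h
  refine integral_congr_ae (Eventually.of_forall fun x => ?_)
  by_cases hx : x ∈ D
  · simp [hx]
  · simp [hs x hx]

end normL2

/-! ### Test functions and density in `H10` -/

namespace IsTestFun

variable {d : ℕ} {U W : Set (Eucl d)} {φ ψ : Eucl d → ℝ}

lemma mono (h : IsTestFun U φ) (hUW : U ⊆ W) : IsTestFun W φ :=
  ⟨h.smooth, h.compact, h.support.trans hUW⟩

lemma contDiff_one (h : IsTestFun U φ) : ContDiff ℝ 1 φ := h.smooth.of_le (by exact_mod_cast le_top)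

lemma continuous (h : IsTestFun U φ) : Continuous φ := h.smooth.continuous

lemma memLp (h : IsTestFun U φ) : MemLp φ 2 volume :=
  h.continuous.memLp_of_hasCompactSupport h.compact

lemma memLp_gradient (h : IsTestFun U φ) : MemLp (∇ φ) 2 volume :=
  (continuous_gradient h.contDiff_one).memLp_of_hasCompactSupport h.compact.gradient

lemma eq_zero (h : IsTestFun U φ) {x : Eucl d} (hx : x ∉ U) : φ x = 0 :=
  image_eq_zero_of_notMem_tsupport fun hx' => hx (h.support hx')

lemma gradient_eq_zero (h : IsTestFun U φ) {x : Eucl d} (hx : x ∉ U) : ∇ φ x = 0 :=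
  gradient_eq_zero_of_notMem_tsupport fun hx' => hx (h.support hx')

lemma mul_smooth (h : IsTestFun U φ) (hψ : ContDiff ℝ ∞ ψ) : IsTestFun U fun x => φ x * ψ x :=
  ⟨h.smooth.mul hψ, h.compact.mul_right, (tsupport_mul_subset_left).trans h.support⟩

lemma exists_bound (h : IsTestFun U φ) : ∃ K, 0 ≤ K ∧ ∀ x, |φ x| ≤ K := by
  obtain ⟨K, hK⟩ := h.compact.exists_bound_of_continuous h.continuous
  exact ⟨K, (norm_nonneg _).trans (hK 0), hK⟩

lemma exists_bound_gradient (h : IsTestFun U φ) : ∃ K, 0 ≤ K ∧ ∀ x, ‖∇ φ x‖ ≤ K := by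
  obtain ⟨K, hK⟩ := h.compact.gradient.exists_bound_of_continuous
    (continuous_gradient h.contDiff_one)
  exact ⟨K, (norm_nonneg _).trans (hK 0), hK⟩

end IsTestFun

lemma gradient_mul {d : ℕ} {φ ψ : Eucl d → ℝ} {x : Eucl d} (hφ : DifferentiableAt ℝ φ x)
    (hψ : DifferentiableAt ℝ ψ x) :
    ∇ (fun y => φ y * ψ y) x = φ x • ∇ ψ x + ψ x • ∇ φ x := by
  have : fderiv ℝ (fun y => φ y * ψ y) x = _ := fderiv_fun_mul hφ hψ
  simp [gradient, this]

/-- The pair `(φ, ∇φ)` of a test function. -/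
noncomputable def IsTestFun.pair {d : ℕ} {U : Set (Eucl d)} {φ : Eucl d → ℝ}
    (h : IsTestFun U φ) : L2Pair d :=
  WithLp.toLp 2 (h.memLp.toLp φ, h.memLp_gradient.toLp (∇ φ))

section pair

variable {d : ℕ} {U : Set (Eucl d)} {φ : Eucl d → ℝ}

lemma IsTestFun.pair_fst (h : IsTestFun U φ) : h.pair.fst =ᵐ[volume] φ := h.memLp.coeFn_toLp

lemma IsTestFun.pair_snd (h : IsTestFun U φ) : h.pair.snd =ᵐ[volume] ∇ φ :=
  h.memLp_gradient.coeFn_toLp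

lemma IsTestFun.norm_pair_fst (h : IsTestFun U φ) : ‖h.pair.fst‖ = normL2 φ :=
  Lp.norm_toLp _ h.memLp

lemma IsTestFun.norm_pair_snd (h : IsTestFun U φ) : ‖h.pair.snd‖ = normL2 (∇ φ) :=
  Lp.norm_toLp _ h.memLp_gradient

lemma IsTestFun.pair_mem_testPairs (h : IsTestFun U φ) : h.pair ∈ testPairs U :=
  ⟨φ, h, h.pair_fst, h.pair_snd⟩

lemma IsTestFun.pair_mem (h : IsTestFun U φ) : h.pair ∈ H10 U :=
  (testPairs U).le_topologicalClosure h.pair_mem_testPairs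

lemma exists_pair_of_mem_testPairs {p : L2Pair d} (hp : p ∈ testPairs U) :
    ∃ (φ : Eucl d → ℝ) (h : IsTestFun U φ), p = h.pair := by
  obtain ⟨φ, h, h1, h2⟩ := hp
  refine ⟨φ, h, WithLp.ofLp_injective 2 (Prod.ext ?_ ?_)⟩
  · exact Lp.ext (h1.trans h.pair_fst.symm)
  · exact Lp.ext (h2.trans h.pair_snd.symm)

/-- A closed condition which holds for all test functions holds on `H10`. -/
lemma H10_induction {P : L2Pair d → Prop} (hcl : IsClosed {p | P p})
    (htest : ∀ (φ : Eucl d → ℝ) (h : IsTestFun U φ), P h.pair) {p : L2Pair d} (hp : p ∈ H10 U) :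
    P p := by
  have hsub : (testPairs U : Set (L2Pair d)) ⊆ {p | P p} := by
    intro q hq
    obtain ⟨φ, h, rfl⟩ := exists_pair_of_mem_testPairs hq
    exact htest φ h
  have : p ∈ closure (testPairs U : Set (L2Pair d)) := hp
  exact closure_minimal hsub hcl this

end pair

/-! ### Poincaré's inequality -/

/-- Poincaré's inequality for test functions supported in a ball. -/
lemma IsTestFun.normL2_le {d : ℕ} (hd : 0 < d) {U : Set (Eucl d)} {r : ℝ} (hr : 0 < r)
    (hU : U ⊆ Metric.ball 0 r) {g : Eucl d → ℝ} (hg : IsTestFun U g) :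
    normL2 g ≤ 2 * r * normL2 (∇ g) := by
  -- Translation by `2r` moves the ball off itself. Hence `g²` and its translate have disjoint
  -- supports, and the `L¹` distance between them is exactly `2 ‖g‖²`; the modulus of continuity
  -- bounds it by `2r ∫ 2 |g| |∇g|`.
  set h : Eucl d := EuclideanSpace.single ⟨0, hd⟩ (2 * r) with hh
  have hnorm : ‖h‖ = 2 * r := by simp [hh, abs_of_pos hr]
  have hdisj : ∀ x, g x * g (x + h) = 0 := by
    intro x
    by_contra hne
    have h1 : x ∈ U := by
      by_contra hx; exact hne (by rw [hg.eq_zero hx, zero_mul])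
    have h2 : x + h ∈ U := by
      by_contra hx; exact hne (by rw [hg.eq_zero hx, mul_zero])
    have h1' := mem_ball_zero_iff.1 (hU h1)
    have h2' := mem_ball_zero_iff.1 (hU h2)
    have : ‖h‖ ≤ ‖x + h‖ + ‖x‖ := by simpa using norm_sub_le (x + h) x
    linarith
  have hsq : ContDiff ℝ 1 fun x => g x * g x := hg.contDiff_one.mul hg.contDiff_one
  have hkey := integral_abs_translate_sub_le hsq hg.compact.mul_right h
  have hint : Integrable fun x => g x * g x :=
    hsq.continuous.integrable_of_hasCompactSupport hg.compact.mul_right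
  have hL : ∫ x, |g (x + h) * g (x + h) - g x * g x| = 2 * normL2 g ^ 2 := by
    have e : ∀ x, |g (x + h) * g (x + h) - g x * g x| = g (x + h) * g (x + h) + g x * g x := by
      intro x
      rcases mul_eq_zero.1 (hdisj x) with h0 | h0 <;>
        simp [h0, abs_of_nonneg, mul_self_nonneg]
    simp_rw [e]
    rw [integral_add (hint.comp_add_right h) hint,
      integral_add_right_eq_self (fun x => g x * g x) h, normL2_sq hg.memLp]
    have : ∀ x, ‖g x‖ ^ 2 = g x * g x := fun x => by simp [sq]
    simp_rw [this]; ring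
  have hR : ∫ x, ‖∇ (fun x => g x * g x) x‖ ≤ 2 * (normL2 g * normL2 (∇ g)) := by
    have e : ∀ x, ‖∇ (fun x => g x * g x) x‖ = 2 * (‖g x‖ * ‖∇ g x‖) := by
      intro x
      have hx := hg.contDiff_one.differentiable (by simp) x
      rw [gradient_mul hx hx, ← two_smul ℝ, norm_smul, norm_smul]; simp
    simp_rw [e]
    rw [integral_const_mul]
    exact mul_le_mul_of_nonneg_left (integral_norm_mul_norm_le_normL2 hg.memLp hg.memLp_gradient)
      (by norm_num)
  rw [hL, hnorm] at hkey
  rcases (normL2_nonneg g).eq_or_lt with h0 | h0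
  · rw [← h0]; have := normL2_nonneg (∇ g); positivity
  · have h3 := hkey.trans (mul_le_mul_of_nonneg_left hR (by positivity))
    refine le_of_mul_le_mul_left ?_ h0
    nlinarith

lemma norm_fst_le_of_mem_H10 {d : ℕ} (hd : 0 < d) {U : Set (Eucl d)} {r : ℝ} (hr : 0 < r)
    (hU : U ⊆ Metric.ball 0 r) {p : L2Pair d} (hp : p ∈ H10 U) :
    ‖p.fst‖ ≤ 2 * r * ‖p.snd‖ := by
  refine H10_induction (P := fun p => ‖p.fst‖ ≤ 2 * r * ‖p.snd‖) ?_ (fun φ h => ?_) hp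
  · have c1 : Continuous fun p : L2Pair d => p.fst := (WithLp.fstL 2 ℝ _ _).continuous
    have c2 : Continuous fun p : L2Pair d => p.snd := (WithLp.sndL 2 ℝ _ _).continuous
    exact isClosed_le c1.norm (continuous_const.mul c2.norm)
  · rw [h.norm_pair_fst, h.norm_pair_snd]
    exact h.normL2_le hd hr hU

/-! ### The Dirichlet form and its coercivity -/

/-- A bounded measurable potential. -/
structure IsBddPotential {d : ℕ} (V : Eucl d → ℝ) : Prop where
  meas : AEStronglyMeasurable V volume
  bound : ∃ K, ∀ x, |V x| ≤ K

section form

variable {d : ℕ} {V : Eucl d → ℝ}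

lemma IsBddPotential.memLp_mul (hV : IsBddPotential V) (u : Lp ℝ 2 (volume : Measure (Eucl d))) :
    MemLp (fun x => V x * u x) 2 volume := by
  obtain ⟨K, hK⟩ := hV.bound
  refine (Lp.memLp u).of_le_mul (c := K) (hV.meas.mul (Lp.aestronglyMeasurable u))
    (Eventually.of_forall fun x => ?_)
  rw [norm_mul]
  exact mul_le_mul_of_nonneg_right (hK x) (norm_nonneg _)

/-- Multiplication by a bounded function, as an operator on `L²`. -/
noncomputable def mulOp (hV : IsBddPotential V) :
    Lp ℝ 2 (volume : Measure (Eucl d)) →L[ℝ] Lp ℝ 2 (volume : Measure (Eucl d)) :=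
  LinearMap.mkContinuousOfExistsBound
    { toFun := fun u => (hV.memLp_mul u).toLp _
      map_add' := fun u v => by
        refine Lp.ext ?_
        filter_upwards [(hV.memLp_mul (u + v)).coeFn_toLp, (hV.memLp_mul u).coeFn_toLp,
          (hV.memLp_mul v).coeFn_toLp, Lp.coeFn_add u v,
          Lp.coeFn_add ((hV.memLp_mul u).toLp _) ((hV.memLp_mul v).toLp _)] with x h1 h2 h3 h4 h5
        rw [h1, h5, Pi.add_apply, h2, h3, h4, Pi.add_apply, mul_add]
      map_smul' := fun c u => by
        refine Lp.ext ?_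
        filter_upwards [(hV.memLp_mul (c • u)).coeFn_toLp, (hV.memLp_mul u).coeFn_toLp,
          Lp.coeFn_smul c u, Lp.coeFn_smul c ((hV.memLp_mul u).toLp _)] with x h1 h2 h3 h4
        rw [RingHom.id_apply, h1, h4, Pi.smul_apply, h2, h3, Pi.smul_apply, smul_eq_mul,
          smul_eq_mul]
        ring }
    (by
      obtain ⟨K, hK⟩ := hV.bound
      refine ⟨K, fun u => Lp.norm_le_mul_norm_of_ae_le_mul ?_⟩
      filter_upwards [(hV.memLp_mul u).coeFn_toLp] with x h1
      change ‖((hV.memLp_mul u).toLp _ : Eucl d → ℝ) x‖ ≤ _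
      rw [h1, norm_mul]
      exact mul_le_mul_of_nonneg_right (hK x) (norm_nonneg _))

lemma mulOp_coeFn (hV : IsBddPotential V) (u : Lp ℝ 2 (volume : Measure (Eucl d))) :
    mulOp hV u =ᵐ[volume] fun x => V x * u x := (hV.memLp_mul u).coeFn_toLp

/-- The bilinear form `∫ ∇p · ∇q + ∫ V p q`. -/
noncomputable def dirichletForm (hV : IsBddPotential V) : L2Pair d →L[ℝ] L2Pair d →L[ℝ] ℝ :=
  (innerSL ℝ).bilinearComp (WithLp.sndL 2 ℝ _ _) (WithLp.sndL 2 ℝ _ _) +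
    (innerSL ℝ).bilinearComp ((mulOp hV).comp (WithLp.fstL 2 ℝ _ _)) (WithLp.fstL 2 ℝ _ _)

lemma dirichletForm_apply (hV : IsBddPotential V) (p q : L2Pair d) :
    dirichletForm hV p q = inner ℝ p.snd q.snd + inner ℝ (mulOp hV p.fst) q.fst := rfl

lemma dirichletForm_apply_integral (hV : IsBddPotential V) (p q : L2Pair d) :
    dirichletForm hV p q
      = (∫ x, inner ℝ (p.snd x) (q.snd x)) + ∫ x, V x * p.fst x * q.fst x := by
  rw [dirichletForm_apply, L2.inner_def, L2.inner_def]
  congr 1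
  refine integral_congr_ae ?_
  filter_upwards [mulOp_coeFn hV p.fst] with x hx
  rw [hx]; simp [mul_comm]

lemma dirichletForm_comm (hV : IsBddPotential V) (p q : L2Pair d) :
    dirichletForm hV p q = dirichletForm hV q p := by
  rw [dirichletForm_apply_integral, dirichletForm_apply_integral]
  congr 1
  · simp_rw [real_inner_comm]
  · congr 1 with x; ring

lemma dirichletForm_self_ge (hV : IsBddPotential V) (h0 : ∀ x, 0 ≤ V x) (p : L2Pair d) :
    ‖p.snd‖ ^ 2 ≤ dirichletForm hV p p := by
  rw [dirichletForm_apply, real_inner_self_eq_norm_sq, L2.inner_def]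
  refine le_add_of_nonneg_right (integral_nonneg_of_ae ?_)
  filter_upwards [mulOp_coeFn hV p.fst] with x hx
  rw [hx]
  have := mul_nonneg (h0 x) (mul_self_nonneg (p.fst x))
  simp only [RCLike.inner_apply, conj_trivial, Pi.zero_apply]
  linarith

/-- Poincaré's inequality gives `‖p‖² ≤ (1 + (2r)²) ‖p.snd‖²`, and a nonnegative potential only
increases the form. The constant depends on `U` only through an enclosing ball. -/
lemma dirichletForm_coercive (hV : IsBddPotential V) (h0 : ∀ x, 0 ≤ V x) (hd : 0 < d)
    {U : Set (Eucl d)} {r : ℝ} (hr : 0 < r) (hU : U ⊆ Metric.ball 0 r) {p : L2Pair d}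
    (hp : p ∈ H10 U) : (1 + (2 * r) ^ 2)⁻¹ * ‖p‖ * ‖p‖ ≤ dirichletForm hV p p := by
  refine le_trans ?_ (dirichletForm_self_ge hV h0 p)
  have h1 := norm_fst_le_of_mem_H10 hd hr hU hp
  have h2 : ‖p‖ ^ 2 ≤ (1 + (2 * r) ^ 2) * ‖p.snd‖ ^ 2 := by
    rw [WithLp.prod_norm_sq_eq_of_L2]
    have := pow_le_pow_left₀ (norm_nonneg _) h1 2
    rw [mul_pow] at this
    linarith
  rw [mul_assoc, ← sq, inv_mul_le_iff₀ (by positivity)]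
  exact h2

end form

/-! ### Lax-Milgram and weak convergence in Hilbert spaces -/

section Hilbert

variable {H : Type*} [NormedAddCommGroup H] [InnerProductSpace ℝ H]

lemma IsCoercive.exists_forall_apply_eq [CompleteSpace H] {B : H →L[ℝ] H →L[ℝ] ℝ}
    (hc : IsCoercive B) (l : H →L[ℝ] ℝ) : ∃ p, ∀ q, B p q = l q := by
  refine ⟨hc.continuousLinearEquivOfBilin.symm ((InnerProductSpace.toDual ℝ H).symm l),
    fun q => ?_⟩
  have h := hc.continuousLinearEquivOfBilin_apply
    (hc.continuousLinearEquivOfBilin.symm ((InnerProductSpace.toDual ℝ H).symm l)) q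
  rw [ContinuousLinearEquiv.apply_symm_apply, InnerProductSpace.toDual_symm_apply] at h
  exact h.symm

/-- The weak topology is tested by functionals as soon as these separate points; the functional
`inner (p - q)` separates `p` from `q`. -/
lemma tendsto_toWeakSpace_iff {ι : Type*} {l : Filter ι} {u : ι → H} {u₀ : H} :
    Tendsto (fun i => toWeakSpace ℝ H (u i)) l (𝓝 (toWeakSpace ℝ H u₀)) ↔
      ∀ y : H →L[ℝ] ℝ, Tendsto (fun i => y (u i)) l (𝓝 (y u₀)) := by
  have hinj : Function.Injective (topDualPairing ℝ H).flip := by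
    intro p q hpq
    by_contra hne
    have h1 : inner ℝ (p - q) p = inner ℝ (p - q) q :=
      DFunLike.congr_fun hpq (innerSL ℝ (p - q))
    have h2 : inner ℝ (p - q) (p - q) = 0 := by rw [inner_sub_right, h1, sub_self]
    exact hne (sub_eq_zero.1 (inner_self_eq_zero.1 h2))
  exact WeakBilin.tendsto_iff_forall_eval_tendsto _ hinj

/-- Convergence of bounded families, tested against a dense set, extends to its closure. -/
lemma tendsto_apply_of_mem_closure (B : H →L[ℝ] H →L[ℝ] ℝ) {ι : Type*} {l : Filter ι}
    {u : ι → H} {u₀ : H} {K : ℝ} (hK : ∀ᶠ i in l, ‖u i‖ ≤ K) {S : Set H}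
    (hS : ∀ q ∈ S, Tendsto (fun i => B (u i) q) l (𝓝 (B u₀ q))) {q : H} (hq : q ∈ closure S) :
    Tendsto (fun i => B (u i) q) l (𝓝 (B u₀ q)) := by
  rw [Metric.tendsto_nhds]
  intro ε hε
  -- Bounds `‖B‖ ‖u i - u₀‖` uniformly in `i`; the summand 1 keeps it positive, so that one can
  -- divide by it.
  set L := ‖B‖ * (|K| + ‖u₀‖) + 1 with hL
  have hLpos : 0 < L := by positivity
  obtain ⟨q', hq', hqq⟩ := Metric.mem_closure_iff.1 hq (ε / 2 / L) (by positivity)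
  filter_upwards [hK, Metric.tendsto_nhds.1 (hS q' hq') (ε / 2) (by positivity)] with i h1 h2
  rw [Real.dist_eq] at h2 ⊢
  have e : B (u i) q - B u₀ q = B (u i - u₀) (q - q') + (B (u i) q' - B u₀ q') := by
    simp only [map_sub, sub_apply]; ring
  have h3 : |B (u i - u₀) (q - q')| ≤ L * ‖q - q'‖ := by
    refine (B.le_opNorm₂ _ _).trans ?_
    refine mul_le_mul_of_nonneg_right ?_ (norm_nonneg _)
    have h4 : ‖u i - u₀‖ ≤ |K| + ‖u₀‖ :=
      (norm_sub_le _ _).trans (add_le_add_left (h1.trans (le_abs_self _)) _)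
    have := mul_le_mul_of_nonneg_left h4 (norm_nonneg B)
    linarith
  rw [dist_eq_norm, lt_div_iff₀' hLpos] at hqq
  rw [e]
  exact (abs_add_le _ _).trans_lt (by linarith)

end Hilbert

/-! ### Weak solutions: existence, uniqueness, energy bound -/

instance {d : ℕ} (U : Set (Eucl d)) : CompleteSpace (H10 U) :=
  Submodule.topologicalClosure.completeSpace (testPairs U)

section weak

variable {d : ℕ} {V f : Eucl d → ℝ} {Ω U : Set (Eucl d)}

/-- The right-hand side, extended by zero. -/
noncomputable def sourceTerm (hΩ : MeasurableSet Ω) (hf : MemLp f 2 (volume.restrict Ω)) :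
    Lp ℝ 2 (volume : Measure (Eucl d)) :=
  ((memLp_indicator_iff_restrict hΩ).2 hf).toLp _

lemma sourceTerm_coeFn (hΩ : MeasurableSet Ω) (hf : MemLp f 2 (volume.restrict Ω)) :
    sourceTerm hΩ hf =ᵐ[volume] Ω.indicator f :=
  ((memLp_indicator_iff_restrict hΩ).2 hf).coeFn_toLp

lemma inner_sourceTerm (hΩ : MeasurableSet Ω) (hf : MemLp f 2 (volume.restrict Ω)) (hU : U ⊆ Ω)
    {φ : Eucl d → ℝ} (hφ : IsTestFun U φ) :
    inner ℝ (sourceTerm hΩ hf) hφ.pair.fst = ∫ x in U, f x * φ x := by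
  rw [setIntegral_eq_integral_of_forall_compl_eq_zero
    (fun x hx => by rw [hφ.eq_zero hx, mul_zero]), L2.inner_def]
  refine integral_congr_ae ?_
  filter_upwards [sourceTerm_coeFn hΩ hf, hφ.pair_fst] with x h1 h2
  rw [h1, h2]
  by_cases hx : x ∈ Ω
  · simp [hx, mul_comm]
  · simp [hx, hφ.eq_zero fun h => hx (hU h)]

lemma dirichletForm_pair (hV : IsBddPotential V) (p : L2Pair d) {φ : Eucl d → ℝ}
    (hφ : IsTestFun U φ) :
    dirichletForm hV p hφ.pair
      = (∫ x in U, inner ℝ (p.snd x) (∇ φ x)) + ∫ x in U, V x * p.fst x * φ x := by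
  rw [setIntegral_eq_integral_of_forall_compl_eq_zero
    (fun x hx => by rw [hφ.gradient_eq_zero hx, inner_zero_right]),
    setIntegral_eq_integral_of_forall_compl_eq_zero
    (fun x hx => by rw [hφ.eq_zero hx, mul_zero]), dirichletForm_apply_integral]
  congr 1 <;> refine integral_congr_ae ?_
  · filter_upwards [hφ.pair_snd] with x hx
    rw [hx]
  · filter_upwards [hφ.pair_fst] with x hx
    rw [hx]

/-- Both sides are continuous in the test element, so density of test functions extends the equation
to all of `H10 U`. In particular the solution itself may be inserted. -/
lemma isDirichletSolution_iff (hΩ : MeasurableSet Ω) (hf : MemLp f 2 (volume.restrict Ω))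
    (hU : U ⊆ Ω) (hV : IsBddPotential V) (p : L2Pair d) :
    IsDirichletSolution U V f p ↔ p ∈ H10 U ∧
      ∀ q ∈ H10 U, dirichletForm hV p q = inner ℝ (sourceTerm hΩ hf) q.fst := by
  refine and_congr_right fun _ => ⟨fun h q hq => ?_, fun h φ hφ => ?_⟩
  · refine H10_induction
      (P := fun q => dirichletForm hV p q = inner ℝ (sourceTerm hΩ hf) q.fst) ?_ ?_ hq
    · refine isClosed_eq (dirichletForm hV p).continuous ?_
      exact ((innerSL ℝ (sourceTerm hΩ hf)).comp (WithLp.fstL 2 ℝ _ _)).continuous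
    · intro φ hφ
      rw [dirichletForm_pair, inner_sourceTerm hΩ hf hU, h φ hφ]
  · rw [← dirichletForm_pair hV p hφ, h _ hφ.pair_mem, inner_sourceTerm hΩ hf hU]

/-- The Dirichlet form on `H10 U`. -/
noncomputable def dirichletFormOn (U : Set (Eucl d)) (hV : IsBddPotential V) :
    H10 U →L[ℝ] H10 U →L[ℝ] ℝ :=
  (dirichletForm hV).bilinearComp (H10 U).subtypeL (H10 U).subtypeL

lemma isCoercive_dirichletFormOn (hV : IsBddPotential V) (h0 : ∀ x, 0 ≤ V x) (hd : 0 < d)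
    (hU : Bornology.IsBounded U) : IsCoercive (dirichletFormOn U hV) := by
  obtain ⟨r, hr, hUr⟩ := hU.subset_ball_lt 0 0
  exact ⟨(1 + (2 * r) ^ 2)⁻¹, by positivity, fun p =>
    dirichletForm_coercive hV h0 hd hr hUr p.2⟩

/-- Every functional on `H10 U` is represented by the Dirichlet form. -/
lemma exists_dirichletForm_eq (hV : IsBddPotential V) (h0 : ∀ x, 0 ≤ V x) (hd : 0 < d)
    (hU : Bornology.IsBounded U) (l : H10 U →L[ℝ] ℝ) :
    ∃ p : H10 U, ∀ q : H10 U, dirichletForm hV p q = l q :=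
  (isCoercive_dirichletFormOn hV h0 hd hU).exists_forall_apply_eq l

lemma existsUnique_dirichletSolution (hd : 0 < d) (hΩ : MeasurableSet Ω)
    (hΩb : Bornology.IsBounded Ω) (hf : MemLp f 2 (volume.restrict Ω)) (hU : U ⊆ Ω)
    (hV : IsBddPotential V) (h0 : ∀ x, 0 ≤ V x) : ∃! p, IsDirichletSolution U V f p := by
  obtain ⟨p, hp⟩ := exists_dirichletForm_eq hV h0 hd (hΩb.subset hU)
    (((innerSL ℝ (sourceTerm hΩ hf)).comp (WithLp.fstL 2 ℝ _ _)).comp (H10 U).subtypeL)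
  refine ⟨p, (isDirichletSolution_iff hΩ hf hU hV _).2 ⟨p.2, fun q hq => hp ⟨q, hq⟩⟩, ?_⟩
  intro v hv
  rw [isDirichletSolution_iff hΩ hf hU hV] at hv
  obtain ⟨r, hr, hUr⟩ := (hΩb.subset hU).subset_ball_lt 0 0
  have hmem : v - p ∈ H10 U := (H10 U).sub_mem hv.1 p.2
  have hz : dirichletForm hV (v - p) (v - p) = 0 := by
    have h1 := hv.2 _ hmem
    have h2 : dirichletForm hV p (v - p) = inner ℝ (sourceTerm hΩ hf) (v - p : L2Pair d).fst :=
      hp ⟨_, hmem⟩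
    rw [map_sub (dirichletForm hV), sub_apply, h1, h2, sub_self]
  have h3 := dirichletForm_coercive hV h0 hd hr hUr hmem
  rw [hz] at h3
  by_contra hne
  have : 0 < ‖v - p‖ := norm_pos_iff.2 (sub_ne_zero.2 hne)
  have : 0 < (1 + (2 * r) ^ 2)⁻¹ * ‖v - p‖ * ‖v - p‖ := by positivity
  linarith

/-- Test the equation with the solution and use coercivity. The radius `r` belongs to `Ω`, not to
`U`, so one bound serves all perforated domains. -/
lemma norm_dirichletSolution_le (hd : 0 < d) (hΩ : MeasurableSet Ω) {r : ℝ} (hr : 0 < r)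
    (hΩr : Ω ⊆ Metric.ball 0 r) (hf : MemLp f 2 (volume.restrict Ω)) (hU : U ⊆ Ω)
    (hV : IsBddPotential V) (h0 : ∀ x, 0 ≤ V x) {p : L2Pair d}
    (hp : IsDirichletSolution U V f p) :
    ‖p‖ ≤ (1 + (2 * r) ^ 2) * ‖sourceTerm hΩ hf‖ := by
  rw [isDirichletSolution_iff hΩ hf hU hV] at hp
  have h1 := dirichletForm_coercive hV h0 hd hr (hU.trans hΩr) hp.1
  rw [hp.2 p hp.1] at h1
  have h2 := real_inner_le_norm (sourceTerm hΩ hf) p.fst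
  have h3 := mul_le_mul_of_nonneg_left (WithLp.norm_fst_le _ p) (norm_nonneg (sourceTerm hΩ hf))
  rcases (norm_nonneg p).eq_or_lt with h4 | h4
  · rw [← h4]; positivity
  · have h5 : (1 + (2 * r) ^ 2)⁻¹ * ‖p‖ ≤ ‖sourceTerm hΩ hf‖ :=
      le_of_mul_le_mul_right (h1.trans (h2.trans h3)) h4
    rwa [inv_mul_le_iff₀ (by positivity)] at h5

/-- A bounded family in `H10 Ω` converges weakly as soon as it converges when tested, through the
Dirichlet form, against test functions. -/
lemma tendsto_weak_of_dirichletForm (hd : 0 < d) (hΩb : Bornology.IsBounded Ω)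
    (hV : IsBddPotential V) (h0 : ∀ x, 0 ≤ V x) {ι : Type*} {l : Filter ι} {u : ι → H10 Ω}
    {u₀ : H10 Ω} {K : ℝ} (hK : ∀ᶠ i in l, ‖(u i : L2Pair d)‖ ≤ K)
    (ht : ∀ (φ : Eucl d → ℝ) (hφ : IsTestFun Ω φ),
      Tendsto (fun i => dirichletForm hV (u i) hφ.pair) l (𝓝 (dirichletForm hV u₀ hφ.pair))) :
    Tendsto (fun i => toWeakSpace ℝ (H10 Ω) (u i)) l (𝓝 (toWeakSpace ℝ (H10 Ω) u₀)) := by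
  refine tendsto_toWeakSpace_iff.2 fun y => ?_
  -- By Lax-Milgram the functional `y` is the form with one slot frozen at some `p` in `H10 Ω`. By
  -- symmetry, `y (u i)` is then the form tested on `p`, which is a limit of test functions.
  obtain ⟨p, hp⟩ := exists_dirichletForm_eq hV h0 hd hΩb y
  have h1 := tendsto_apply_of_mem_closure (dirichletForm hV) hK
    (S := (testPairs Ω : Set (L2Pair d))) (u₀ := (u₀ : L2Pair d)) (fun q hq => by
      obtain ⟨φ, hφ, rfl⟩ := exists_pair_of_mem_testPairs hq
      exact ht φ hφ) (q := (p : L2Pair d)) p.2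
  simp_rw [dirichletForm_comm hV _ (p : L2Pair d), hp] at h1
  exact h1

end weak

/-! ### The fundamental solution as a radial coordinate -/

/-- The radial profile of the fundamental solution, `∫_r^1 s^(1-d) ds`. -/
noncomputable def fundSol (d : ℕ) (r : ℝ) : ℝ :=
  if d = 2 then -Real.log r else ((r ^ (d - 2))⁻¹ - 1) / ((d : ℝ) - 2)

section fundSol

variable {d : ℕ}

lemma hasDerivAt_fundSol (hd : 2 ≤ d) {r : ℝ} (hr : 0 < r) :
    HasDerivAt (fundSol d) (-(r ^ (d - 1))⁻¹) r := by
  rcases eq_or_ne d 2 with rfl | h2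
  · have : fundSol 2 = fun r => -Real.log r := by ext r; simp [fundSol]
    rw [this]
    exact ((Real.hasDerivAt_log hr.ne').fun_neg).congr_deriv (by simp)
  · obtain ⟨n, rfl⟩ : ∃ n, d = n + 3 := ⟨d - 3, by omega⟩
    have : fundSol (n + 3) = fun r => ((r ^ (n + 1))⁻¹ - 1) / (((n + 3 : ℕ) : ℝ) - 2) := by
      ext r; simp [fundSol]
    rw [this]
    have h1 := (((hasDerivAt_pow (n + 1) r).inv (by positivity)).sub_const 1).div_const
      (((n + 3 : ℕ) : ℝ) - 2)
    refine h1.congr_deriv ?_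
    have h3 : (((n + 3 : ℕ) : ℝ) - 2) ≠ 0 := by
      push_cast; linarith [(Nat.cast_nonneg n : (0:ℝ) ≤ n)]
    simp only [Nat.add_sub_cancel, show n + 3 - 1 = n + 2 by omega]
    field_simp
    push_cast
    ring

lemma contDiffAt_fundSol {r : ℝ} (hr : 0 < r) : ContDiffAt ℝ ∞ (fundSol d) r := by
  rcases eq_or_ne d 2 with rfl | h2
  · have : fundSol 2 = fun r => -Real.log r := by ext r; simp [fundSol]
    rw [this]
    exact (Real.contDiffAt_log.2 hr.ne').neg
  · have : fundSol d = fun r => ((r ^ (d - 2))⁻¹ - 1) / ((d : ℝ) - 2) := by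
      ext r; simp [fundSol, h2]
    rw [this]
    exact ((contDiffAt_id.pow _).inv (pow_pos hr _).ne').sub contDiffAt_const |>.div_const _

lemma continuousAt_fundSol {r : ℝ} (hr : 0 < r) : ContinuousAt (fundSol d) r :=
  (contDiffAt_fundSol hr).continuousAt

lemma measurable_fundSol : Measurable (fundSol d) := by
  unfold fundSol
  split_ifs <;> fun_prop

@[simp] lemma fundSol_one : fundSol d 1 = 0 := by simp [fundSol]

/-- At the pole the default values `log 0 = 0` and `0⁻¹ = 0` replace the infinite value. Being
nonpositive, the result falls outside the range of levels carrying the densities used below. -/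
lemma fundSol_zero_nonpos (hd : 2 ≤ d) : fundSol d 0 ≤ 0 := by
  rcases eq_or_ne d 2 with rfl | h2
  · simp [fundSol]
  · have h3 : (3 : ℝ) ≤ d := by exact_mod_cast (show 3 ≤ d by omega)
    simp only [fundSol, h2, if_false, zero_pow (show d - 2 ≠ 0 by omega), inv_zero, zero_sub]
    exact div_nonpos_of_nonpos_of_nonneg (by norm_num) (by linarith)

lemma fundSol_strictAntiOn (hd : 2 ≤ d) : StrictAntiOn (fundSol d) (Ioi 0) := by
  refine strictAntiOn_of_deriv_neg (convex_Ioi 0)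
    (fun r hr => (continuousAt_fundSol hr).continuousWithinAt) fun r hr => ?_
  rw [interior_Ioi] at hr
  have : 0 < r := hr
  rw [(hasDerivAt_fundSol hd this).deriv]
  simp only [Left.neg_neg_iff]
  positivity

lemma fundSol_nonpos (hd : 2 ≤ d) {r : ℝ} (hr : 1 ≤ r) : fundSol d r ≤ 0 := by
  rw [← fundSol_one (d := d)]
  exact (fundSol_strictAntiOn hd).antitoneOn (show (0:ℝ) < 1 by norm_num)
    (show 0 < r by linarith) hr

lemma tendsto_fundSol (hd : 2 ≤ d) : Tendsto (fundSol d) (𝓝[>] 0) atTop := by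
  rcases eq_or_ne d 2 with rfl | h2
  · have : fundSol 2 = fun r => -Real.log r := by ext r; simp [fundSol]
    rw [this]
    exact tendsto_neg_atBot_atTop.comp Real.tendsto_log_nhdsGT_zero
  · have : fundSol d = fun r => ((r ^ (d - 2))⁻¹ - 1) / ((d : ℝ) - 2) := by
      ext r; simp [fundSol, h2]
    rw [this]
    have h3 : (3 : ℝ) ≤ d := by exact_mod_cast (show 3 ≤ d by omega)
    refine Tendsto.atTop_div_const (by linarith) (tendsto_atTop_add_const_right _ _ ?_)
    refine Tendsto.inv_tendsto_nhdsGT_zero ?_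
    refine tendsto_nhdsWithin_iff.2 ⟨?_, ?_⟩
    · have : Tendsto (fun r : ℝ => r ^ (d - 2)) (𝓝 0) (𝓝 (0 ^ (d - 2))) :=
        (continuous_pow _).tendsto 0
      rw [zero_pow (by omega)] at this
      exact this.mono_left nhdsWithin_le_nhds
    · filter_upwards [self_mem_nhdsWithin] with r hr
      exact pow_pos (show 0 < r from hr) _

lemma exists_fundSol_ge (hd : 2 ≤ d) (T : ℝ) : ∃ r, 0 < r ∧ r < 1 ∧ T ≤ fundSol d r := by
  have h1 := (tendsto_fundSol hd).eventually_ge_atTop T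
  have h2 : ∀ᶠ r in 𝓝[>] (0:ℝ), r < 1 := nhdsWithin_le_nhds (eventually_lt_nhds one_pos)
  obtain ⟨r, h1, h2, h3⟩ := (h1.and (h2.and self_mem_nhdsWithin)).exists
  exact ⟨r, h3, h2, h1⟩

lemma sphereArea_eq : sphereArea d = d * (volume : Measure (Eucl d)).real (Metric.ball 0 1) := by
  rw [sphereArea, Measure.toSphere_real_apply_univ, finrank_euclideanSpace_fin]

lemma sphereArea_nonneg : 0 ≤ sphereArea d := measureReal_nonneg

/-- Integration over the level sets of the fundamental solution. -/
lemma integral_comp_fundSol (hd : 2 ≤ d) {g : ℝ → ℝ} (hg : Continuous g) {b : ℝ}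
    (h0 : ∀ t ≤ 0, g t = 0) (hb : ∀ t, b ≤ t → g t = 0) :
    Integrable (fun y : Eucl d => g (fundSol d ‖y‖) * ((‖y‖ ^ (d - 1))⁻¹) ^ 2) ∧
    ∫ y : Eucl d, g (fundSol d ‖y‖) * ((‖y‖ ^ (d - 1))⁻¹) ^ 2
      = sphereArea d * ∫ t in (0:ℝ)..b, g t := by
  have : Nontrivial (Eucl d) := by
    have : Nonempty (Fin d) := ⟨⟨0, by omega⟩⟩
    infer_instance
  -- Below `r₀` the level exceeds `b`, and beyond radius 1 it is nonpositive; the integrand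
  -- therefore lives on `(r₀, 1]`, away from the pole.
  obtain ⟨r₀, hr0, hr1, hrb⟩ := exists_fundSol_ge hd b
  set F : ℝ → ℝ := fun r => g (fundSol d r) * ((r ^ (d - 1))⁻¹) ^ 2 with hF
  set G : ℝ → ℝ := fun r => g (fundSol d r) * (r ^ (d - 1))⁻¹ with hG
  -- One factor `r^(1-d)` cancels the Jacobian of polar coordinates; the other is `|(fundSol d)'|`,
  -- which makes the substitution `t = fundSol d r` exact.
  have hFG : ∀ r ∈ Ioi (0:ℝ), r ^ (d - 1) • F r = G r := by
    intro r hr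
    have : r ^ (d - 1) ≠ 0 := (pow_pos (show 0 < r from hr) _).ne'
    simp only [hF, hG, smul_eq_mul]
    field_simp
  have hGc : ContinuousOn G (Icc r₀ 1) := by
    intro r hr
    have hr' : 0 < r := hr0.trans_le hr.1
    refine ContinuousAt.continuousWithinAt ?_
    exact (hg.continuousAt.comp (continuousAt_fundSol hr')).mul
      ((continuousAt_id.pow _).inv₀ (pow_pos hr' _).ne')
  have hzero : ∀ r ∈ Ioi (0:ℝ) \ Ioc r₀ 1, G r = 0 := by
    rintro r ⟨hr, hr'⟩
    rw [mem_Ioc, not_and_or, not_lt, not_le] at hr'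
    have : g (fundSol d r) = 0 := by
      rcases hr' with h | h
      · exact hb _ (hrb.trans ((fundSol_strictAntiOn hd).antitoneOn hr hr0 h))
      · exact h0 _ (fundSol_nonpos hd h.le)
    simp [hG, this]
  have hsub : Ioc r₀ 1 ⊆ Ioi (0:ℝ) := fun r hr => hr0.trans hr.1
  have hint : IntegrableOn (fun r => r ^ (d - 1) • F r) (Ioi 0) := by
    refine IntegrableOn.congr_fun ?_ (fun r hr => (hFG r hr).symm) measurableSet_Ioi
    refine IntegrableOn.of_forall_sdiff_eq_zero (s := Ioc r₀ 1) ?_ measurableSet_Ioi hzero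
    exact (hGc.integrableOn_Icc).mono_set Ioc_subset_Icc_self
  have hval : ∫ r in Ioi (0:ℝ), r ^ (d - 1) • F r = ∫ t in (0:ℝ)..b, g t := by
    rw [setIntegral_congr_fun measurableSet_Ioi hFG,
      setIntegral_eq_of_subset_of_forall_sdiff_eq_zero measurableSet_Ioi hsub hzero,
      ← intervalIntegral.integral_of_le hr1.le]
    have hder : ∀ r ∈ uIcc r₀ 1, HasDerivAt (fun r => -∫ t in (0:ℝ)..fundSol d r, g t) (G r) r := by
      intro r hr
      rw [uIcc_of_le hr1.le] at hr
      have h1 := (hg.integral_hasStrictDerivAt 0 (fundSol d r)).hasDerivAt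
      have h2 := (h1.comp r (hasDerivAt_fundSol hd (hr0.trans_le hr.1))).neg
      refine h2.congr_deriv ?_
      simp [hG]
    rw [intervalIntegral.integral_eq_sub_of_hasDerivAt hder
      ((by rwa [uIcc_of_le hr1.le] : ContinuousOn G (uIcc r₀ 1)).intervalIntegrable)]
    simp only [fundSol_one, intervalIntegral.integral_same, neg_zero, zero_sub, neg_neg]
    rw [← intervalIntegral.integral_add_adjacent_intervals (hg.intervalIntegrable 0 b)
      (hg.intervalIntegrable b (fundSol d r₀))]
    have : ∫ t in b..fundSol d r₀, g t = 0 := by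
      rw [intervalIntegral.integral_congr (g := fun _ => 0)]
      · simp
      · intro t ht
        rw [uIcc_of_le hrb] at ht
        exact hb t ht.1
    rw [this, add_zero]
  refine ⟨?_, ?_⟩
  · have := (integrable_fun_norm_addHaar (volume : Measure (Eucl d)) (f := F)).2
      (by rwa [finrank_euclideanSpace_fin])
    exact this
  · have := integral_fun_norm_addHaar (volume : Measure (Eucl d)) F
    rw [finrank_euclideanSpace_fin, hval] at this
    rw [sphereArea_eq, mul_assoc]
    simpa only [nsmul_eq_mul, smul_eq_mul] using this

end fundSol

/-! ### Calculus of radial functions -/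

section radial

variable {d : ℕ}

lemma hasFDerivAt_norm_of_ne {y : Eucl d} (hy : y ≠ 0) :
    HasFDerivAt (fun z : Eucl d => ‖z‖) (‖y‖⁻¹ • innerSL ℝ y) y := by
  have h1 := (hasStrictFDerivAt_norm_sq y).hasFDerivAt.sqrt (by positivity)
  have e : (fun z : Eucl d => √(‖z‖ ^ 2)) = fun z => ‖z‖ := by
    ext z; exact Real.sqrt_sq (norm_nonneg z)
  rw [e, Real.sqrt_sq (norm_nonneg y)] at h1
  refine h1.congr_fderiv ?_
  ext v
  simp
  ring

lemma hasFDerivAt_radial {q : ℝ → ℝ} {q' : ℝ} {y : Eucl d} (hy : y ≠ 0)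
    (hq : HasDerivAt q q' ‖y‖) :
    HasFDerivAt (fun z : Eucl d => q ‖z‖) ((q' * ‖y‖⁻¹) • innerSL ℝ y) y := by
  have h := hq.comp_hasFDerivAt y (hasFDerivAt_norm_of_ne hy)
  rwa [smul_smul] at h

lemma gradient_radial {q : ℝ → ℝ} {q' : ℝ} {y : Eucl d} (hy : y ≠ 0)
    (hq : HasDerivAt q q' ‖y‖) : ∇ (fun z : Eucl d => q ‖z‖) y = (q' * ‖y‖⁻¹) • y := by
  refine HasGradientAt.gradient (hasGradientAt_iff_hasFDerivAt.2 ?_)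
  refine (hasFDerivAt_radial hy hq).congr_fderiv ?_
  ext v
  simp

lemma divergence_radial {q : ℝ → ℝ} {q' : ℝ} {y : Eucl d} (hy : y ≠ 0)
    (hq : HasDerivAt q q' ‖y‖) :
    divergence (fun z : Eucl d => q ‖z‖ • z) y = d * q ‖y‖ + q' * ‖y‖ := by
  have h : fderiv ℝ (fun z : Eucl d => q ‖z‖ • z) y = _ :=
    ((hasFDerivAt_radial hy hq).smul (hasFDerivAt_id y)).fderiv
  have hy' : ‖y‖ ≠ 0 := norm_ne_zero_iff.2 hy
  have hn : ∑ i, y i * y i = ‖y‖ * ‖y‖ := by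
    rw [← sq, EuclideanSpace.real_norm_sq_eq]
    exact Finset.sum_congr rfl fun i _ => (sq _).symm
  simp only [divergence, h]
  simp [Finset.sum_add_distrib, mul_assoc, ← Finset.mul_sum, EuclideanSpace.inner_single_right, hn]
  field_simp
  simp

end radial

/-! ### The flux field and its divergence -/

/-- The gradient of the fundamental solution (up to sign), cut off near the unit sphere. -/
noncomputable def fluxField (d : ℕ) (y : Eucl d) : Eucl d :=
  (Real.smoothTransition (fundSol d ‖y‖ - 1) * (‖y‖ ^ d)⁻¹) • y

/-- Minus the divergence of `fluxField`. -/
noncomputable def fluxDensity (d : ℕ) (y : Eucl d) : ℝ :=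
  deriv Real.smoothTransition (fundSol d ‖y‖ - 1) * ((‖y‖ ^ (d - 1))⁻¹) ^ 2

section flux

variable {d : ℕ}

lemma continuous_deriv_smoothTransition : Continuous (deriv Real.smoothTransition) :=
  (Real.smoothTransition.contDiff (n := 1)).continuous_deriv (by simp)

lemma hasDerivAt_smoothTransition (t : ℝ) :
    HasDerivAt Real.smoothTransition (deriv Real.smoothTransition t) t :=
  ((Real.smoothTransition.contDiff (n := 1)).differentiable (by simp) t).hasDerivAt

lemma deriv_smoothTransition_of_nonpos {t : ℝ} (ht : t ≤ 0) :
    deriv Real.smoothTransition t = 0 := by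
  have h1 : ∀ s < 0, deriv Real.smoothTransition s = 0 := by
    intro s hs
    have : Real.smoothTransition =ᶠ[𝓝 s] fun _ => 0 := by
      filter_upwards [eventually_lt_nhds hs] with u hu
      exact Real.smoothTransition.zero_of_nonpos hu.le
    rw [this.deriv_eq]; simp
  have h2 : closure (Iio (0:ℝ)) ⊆ {s | deriv Real.smoothTransition s = 0} :=
    closure_minimal h1 (isClosed_eq continuous_deriv_smoothTransition continuous_const)
  rw [closure_Iio] at h2
  exact h2 ht

lemma deriv_smoothTransition_of_one_le {t : ℝ} (ht : 1 ≤ t) :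
    deriv Real.smoothTransition t = 0 := by
  have h1 : ∀ s ∈ Ioi (1:ℝ), deriv Real.smoothTransition s = 0 := by
    intro s hs
    have : Real.smoothTransition =ᶠ[𝓝 s] fun _ => 1 := by
      filter_upwards [eventually_gt_nhds hs] with u hu
      exact Real.smoothTransition.one_of_one_le hu.le
    rw [this.deriv_eq]; simp
  have h2 : closure (Ioi (1:ℝ)) ⊆ {s | deriv Real.smoothTransition s = 0} :=
    closure_minimal h1 (isClosed_eq continuous_deriv_smoothTransition continuous_const)
  rw [closure_Ioi] at h2
  exact h2 ht

/-- In the level variable the density is the derivative of a transition from 0 to 1, so the mass is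
the full flux `S_d`, whatever the shape of the cutoff. -/
lemma integral_fluxDensity (hd : 2 ≤ d) :
    Integrable (fluxDensity d) ∧ ∫ y, fluxDensity d y = sphereArea d := by
  have h := integral_comp_fundSol hd (g := fun t => deriv Real.smoothTransition (t - 1)) (b := 2)
    (continuous_deriv_smoothTransition.comp (by fun_prop))
    (fun t ht => deriv_smoothTransition_of_nonpos (by linarith))
    (fun t ht => deriv_smoothTransition_of_one_le (by linarith))
  refine ⟨h.1, h.2.trans ?_⟩
  have : ∫ t in (0:ℝ)..2, deriv Real.smoothTransition (t - 1) = 1 := by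
    rw [intervalIntegral.integral_comp_sub_right (fun t => deriv Real.smoothTransition t) 1,
      intervalIntegral.integral_eq_sub_of_hasDerivAt (fun t _ => hasDerivAt_smoothTransition t)
        (continuous_deriv_smoothTransition.intervalIntegrable _ _)]
    norm_num
  rw [this, mul_one]

lemma measurable_fluxDensity : Measurable (fluxDensity d) := by
  have h1 : Measurable fun y : Eucl d => deriv Real.smoothTransition (fundSol d ‖y‖ - 1) :=
    continuous_deriv_smoothTransition.measurable.comp
      ((measurable_fundSol.comp measurable_norm).sub_const 1)
  have h2 : Measurable fun y : Eucl d => ((‖y‖ ^ (d - 1))⁻¹) ^ 2 := by fun_prop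
  exact h1.mul h2

lemma fluxDensity_eq_zero (hd : 2 ≤ d) {y : Eucl d} (hy : 1 ≤ ‖y‖) : fluxDensity d y = 0 := by
  rw [fluxDensity, deriv_smoothTransition_of_nonpos (by linarith [fundSol_nonpos hd hy]), zero_mul]

/-- The density lives on the levels between 1 and 2, hence at a positive distance from the origin,
where the inverse power is bounded. -/
lemma exists_fluxDensity_bound (hd : 2 ≤ d) : ∃ K, 0 ≤ K ∧ ∀ y, |fluxDensity d y| ≤ K := by
  obtain ⟨K, hK⟩ := (isCompact_Icc (a := (0:ℝ)) (b := 1)).exists_bound_of_continuousOn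
    continuous_deriv_smoothTransition.continuousOn
  have hK0 : 0 ≤ K := (norm_nonneg _).trans (hK 0 (by simp))
  obtain ⟨r, hr0, hr1, hr⟩ := exists_fundSol_ge hd 2
  refine ⟨K * ((r ^ (d - 1))⁻¹) ^ 2, by positivity, fun y => ?_⟩
  by_cases h : fundSol d ‖y‖ - 1 ∈ Ioo (0:ℝ) 1
  · have hy0 : y ≠ 0 := by
      rintro rfl
      have := fundSol_zero_nonpos hd
      rw [norm_zero] at h
      linarith [h.1]
    have hy : 0 < ‖y‖ := norm_pos_iff.2 hy0
    have hry : r ≤ ‖y‖ := by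
      by_contra hlt
      push Not at hlt
      have := fundSol_strictAntiOn hd hy hr0 hlt
      linarith [h.2]
    rw [fluxDensity, abs_mul, abs_of_nonneg (by positivity : 0 ≤ ((‖y‖ ^ (d - 1))⁻¹) ^ 2)]
    have := hK _ (Ioo_subset_Icc_self h)
    rw [Real.norm_eq_abs] at this
    gcongr
  · have : fluxDensity d y = 0 := by
      rw [mem_Ioo, not_and_or, not_lt, not_lt] at h
      rcases h with h | h
      · rw [fluxDensity, deriv_smoothTransition_of_nonpos h, zero_mul]
      · rw [fluxDensity, deriv_smoothTransition_of_one_le h, zero_mul]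
    rw [this, abs_zero]; positivity

lemma contDiffAt_fluxField {y : Eucl d} (hy : y ≠ 0) : ContDiffAt ℝ 1 (fluxField d) y := by
  have hn : ContDiffAt ℝ 1 (fun y : Eucl d => ‖y‖) y := contDiffAt_norm ℝ hy
  have hpos : 0 < ‖y‖ := norm_pos_iff.2 hy
  have h1 : ContDiffAt ℝ 1 (fun y : Eucl d => fundSol d ‖y‖) y :=
    ((contDiffAt_fundSol hpos).of_le (by exact_mod_cast le_top)).comp y hn
  have h2 : ContDiffAt ℝ 1 (fun y : Eucl d => Real.smoothTransition (fundSol d ‖y‖ - 1)) y :=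
    (Real.smoothTransition.contDiff (n := 1)).contDiffAt.comp y (h1.sub contDiffAt_const)
  have h3 : ContDiffAt ℝ 1 (fun y : Eucl d => (‖y‖ ^ d)⁻¹) y :=
    (hn.pow d).inv (pow_pos hpos d).ne'
  exact (h2.mul h3).smul contDiffAt_id

/-- The field `‖y‖^(-d) y` is divergence free away from the origin, so only the derivative of the
cutoff contributes. -/
lemma divergence_fluxField (hd : 2 ≤ d) {y : Eucl d} (hy : y ≠ 0) :
    divergence (fluxField d) y = -fluxDensity d y := by
  have hpos : 0 < ‖y‖ := norm_pos_iff.2 hy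
  have h1 := (hasDerivAt_smoothTransition (fundSol d ‖y‖ - 1)).comp ‖y‖
    ((hasDerivAt_fundSol hd hpos).sub_const 1)
  have h2 := (hasDerivAt_pow d ‖y‖).inv (pow_pos hpos d).ne'
  have h := divergence_radial hy (h1.mul h2)
  refine Eq.trans h ?_
  obtain ⟨n, rfl⟩ : ∃ n, d = n + 1 := ⟨d - 1, by omega⟩
  simp only [fluxDensity, Pi.mul_apply, Function.comp, Nat.add_sub_cancel, Pi.inv_apply]
  field_simp
  push_cast
  ring

lemma integral_inner_gradient_fluxField (hd : 2 ≤ d) {ψ : Eucl d → ℝ} (hψ : ContDiff ℝ 1 ψ)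
    (hc : HasCompactSupport ψ) (h0 : (0 : Eucl d) ∉ tsupport ψ) :
    ∫ y, inner ℝ (∇ ψ y) (fluxField d y) = ∫ y, ψ y * fluxDensity d y := by
  have hne : ∀ y ∈ tsupport ψ, y ≠ 0 := fun y hy h => h0 (h ▸ hy)
  rw [integral_inner_gradient_eq_neg_integral_divergence hψ hc
    fun y hy => contDiffAt_fluxField (hne y hy), ← integral_neg]
  refine integral_congr_ae (Eventually.of_forall fun y => ?_)
  by_cases hy : y ∈ tsupport ψ
  · simp only [divergence_fluxField hd (hne y hy)]; ring
  · simp [image_eq_zero_of_notMem_tsupport hy]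

/-- Change of variables under a dilation and a translation. -/
lemma integral_comp_scale (F : Eucl d → ℝ) (c : Eucl d) {R : ℝ} (hR : 0 < R) :
    ∫ x, F (R⁻¹ • (x - c)) = R ^ d * ∫ y, F y := by
  rw [integral_sub_right_eq_self (fun x => F (R⁻¹ • x)) c,
    Measure.integral_comp_inv_smul_of_nonneg _ _ hR.le, finrank_euclideanSpace_fin, smul_eq_mul]

lemma integrable_comp_scale {F : Eucl d → ℝ} (hF : Integrable F) (c : Eucl d) {R : ℝ}
    (hR : 0 < R) : Integrable fun x => F (R⁻¹ • (x - c)) :=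
  ((integrable_comp_smul_iff volume F (inv_ne_zero hR.ne')).2 hF).comp_sub_right c

lemma gradient_comp_scale {ψ : Eucl d → ℝ} (c : Eucl d) (R : ℝ) {x : Eucl d}
    (hψ : DifferentiableAt ℝ ψ (R⁻¹ • (x - c))) :
    ∇ (fun x => ψ (R⁻¹ • (x - c))) x = R⁻¹ • ∇ ψ (R⁻¹ • (x - c)) := by
  have h1 : HasFDerivAt (fun x : Eucl d => R⁻¹ • (x - c))
      (R⁻¹ • ContinuousLinearMap.id ℝ (Eucl d)) x :=
    ((hasFDerivAt_id x).sub_const c).const_smul R⁻¹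
  have h2 : fderiv ℝ (fun x => ψ (R⁻¹ • (x - c))) x = _ := (hψ.hasFDerivAt.comp x h1).fderiv
  rw [gradient, gradient, h2]
  simp

lemma integral_inner_gradient_fluxField_scale (hd : 2 ≤ d) {ψ : Eucl d → ℝ} (hψ : ContDiff ℝ 1 ψ)
    (hc : HasCompactSupport ψ) {c : Eucl d} (h0 : c ∉ tsupport ψ) {R : ℝ} (hR : 0 < R) :
    ∫ x, inner ℝ (∇ ψ x) (R⁻¹ • fluxField d (R⁻¹ • (x - c)))
      = ∫ x, ψ x * (R⁻¹ ^ 2 * fluxDensity d (R⁻¹ • (x - c))) := by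
  set χ : Eucl d → ℝ := fun y => ψ (c + R • y) with hχ
  have hinv : ∀ x : Eucl d, c + R • (R⁻¹ • (x - c)) = x := fun x => by
    rw [smul_inv_smul₀ hR.ne']; abel
  have hgrad : ∀ y, ∇ χ y = R • ∇ ψ (c + R • y) := by
    intro y
    have h1 : HasFDerivAt (fun y : Eucl d => c + R • y)
        (R • ContinuousLinearMap.id ℝ (Eucl d)) y :=
      ((hasFDerivAt_id y).const_smul R).const_add c
    have h2 : fderiv ℝ χ y = _ :=
      (((hψ.differentiable (by simp) (c + R • y)).hasFDerivAt).comp y h1).fderiv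
    rw [gradient, gradient, h2]
    simp
  have hχ1 : ContDiff ℝ 1 χ := hψ.comp (by fun_prop)
  have hcont : Continuous fun y : Eucl d => c + R • y := by fun_prop
  let e : Eucl d ≃ₜ Eucl d :=
    (Homeomorph.smulOfNeZero R hR.ne').trans (Homeomorph.addLeft c)
  have hχc : HasCompactSupport χ := hc.comp_homeomorph e
  have hχ0 : (0 : Eucl d) ∉ tsupport χ := by
    intro h
    have := tsupport_comp_subset_preimage ψ hcont h
    simp at this
    exact h0 this
  have key := integral_inner_gradient_fluxField hd hχ1 hχc hχ0
  have e1 := integral_comp_scale (fun y => inner ℝ (∇ χ y) (fluxField d y)) c hR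
  have e2 := integral_comp_scale (fun y => χ y * fluxDensity d y) c hR
  rw [key, ← e2] at e1
  simp only [hgrad] at e1
  simp only [hχ, hinv] at e1
  have e3 : ∀ x, inner ℝ (∇ ψ x) (R⁻¹ • fluxField d (R⁻¹ • (x - c)))
      = R⁻¹ ^ 2 * inner ℝ (R • ∇ ψ x) (fluxField d (R⁻¹ • (x - c))) := by
    intro x
    rw [inner_smul_right, real_inner_smul_left]
    field_simp
  simp_rw [e3]
  rw [integral_const_mul, e1, ← integral_const_mul]
  congr 1 with x
  ring

end flux

/-! ### The smoothed affine profile -/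

/-- A smooth function equal to `1` on `[2, T - 2]` and to `0` outside `[1, T - 1]`. -/
noncomputable def plateau (T t : ℝ) : ℝ :=
  Real.smoothTransition (t - 1) * Real.smoothTransition (T - 1 - t)

/-- The inverse of the integral of `plateau T`. -/
noncomputable def plateauConst (T : ℝ) : ℝ := (∫ t in (1:ℝ)..T, plateau T t)⁻¹

/-- A smooth function decreasing from `1` to `0` on `[1, T - 1]`, almost affine there. -/
noncomputable def descent (T t : ℝ) : ℝ := plateauConst T * ∫ s in t..T, plateau T s

section descent

variable {T t : ℝ}

lemma contDiff_plateau (T : ℝ) : ContDiff ℝ ∞ (plateau T) :=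
  (Real.smoothTransition.contDiff.comp (by fun_prop)).mul
    (Real.smoothTransition.contDiff.comp (by fun_prop))

lemma continuous_plateau (T : ℝ) : Continuous (plateau T) := (contDiff_plateau T).continuous

lemma plateau_nonneg (T t : ℝ) : 0 ≤ plateau T t :=
  mul_nonneg (Real.smoothTransition.nonneg _) (Real.smoothTransition.nonneg _)

lemma plateau_le_one (T t : ℝ) : plateau T t ≤ 1 :=
  mul_le_one₀ (Real.smoothTransition.le_one _) (Real.smoothTransition.nonneg _)
    (Real.smoothTransition.le_one _)

lemma plateau_eq_zero_of_le (ht : t ≤ 1) : plateau T t = 0 := by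
  rw [plateau, Real.smoothTransition.zero_of_nonpos (by linarith), zero_mul]

lemma plateau_eq_zero_of_ge (ht : T - 1 ≤ t) : plateau T t = 0 := by
  rw [plateau, Real.smoothTransition.zero_of_nonpos (x := T - 1 - t) (by linarith), mul_zero]

lemma plateau_eq_one (h1 : 2 ≤ t) (h2 : t ≤ T - 2) : plateau T t = 1 := by
  rw [plateau, Real.smoothTransition.one_of_one_le (by linarith),
    Real.smoothTransition.one_of_one_le (by linarith), one_mul]

lemma intervalIntegrable_plateau (T a b : ℝ) : IntervalIntegrable (plateau T) volume a b :=
  (continuous_plateau T).intervalIntegrable a b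

lemma integral_plateau_nonneg {a b : ℝ} (hab : a ≤ b) : 0 ≤ ∫ t in a..b, plateau T t :=
  intervalIntegral.integral_nonneg hab fun t _ => plateau_nonneg T t

lemma integral_plateau_le {a b : ℝ} (hab : a ≤ b) : ∫ t in a..b, plateau T t ≤ b - a := by
  have := intervalIntegral.integral_mono_on hab (intervalIntegrable_plateau T a b)
    (intervalIntegrable_const (c := (1:ℝ))) fun t _ => plateau_le_one T t
  simpa using this

/-- Smoothing loses at most a bounded length, independent of `T`. This is why the slope
`plateauConst T` is asymptotic to `1 / T`. -/
lemma integral_plateau_ge (hT : 4 < T) : T - 4 ≤ ∫ t in (1:ℝ)..T, plateau T t := by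
  rw [← intervalIntegral.integral_add_adjacent_intervals (intervalIntegrable_plateau T 1 2)
    (intervalIntegrable_plateau T 2 T),
    ← intervalIntegral.integral_add_adjacent_intervals (intervalIntegrable_plateau T 2 (T - 2))
    (intervalIntegrable_plateau T (T - 2) T)]
  have h1 : 0 ≤ ∫ t in (1:ℝ)..2, plateau T t := integral_plateau_nonneg (by norm_num)
  have h2 : 0 ≤ ∫ t in (T - 2)..T, plateau T t := integral_plateau_nonneg (by linarith)
  have h3 : ∫ t in (2:ℝ)..(T - 2), plateau T t = T - 4 := by
    rw [intervalIntegral.integral_congr (g := fun _ => (1:ℝ))]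
    · simp; ring
    · intro t ht
      rw [uIcc_of_le (by linarith)] at ht
      exact plateau_eq_one ht.1 ht.2
  linarith

lemma plateauConst_inv_ge (hT : 4 < T) : T - 4 ≤ (plateauConst T)⁻¹ := by
  rw [plateauConst, inv_inv]; exact integral_plateau_ge hT

lemma plateauConst_inv_le (hT : 4 < T) : (plateauConst T)⁻¹ ≤ T := by
  rw [plateauConst, inv_inv]
  have := integral_plateau_le (T := T) (show (1:ℝ) ≤ T by linarith)
  linarith

lemma plateauConst_pos (hT : 4 < T) : 0 < plateauConst T :=
  inv_pos.1 (lt_of_lt_of_le (by linarith) (plateauConst_inv_ge hT))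

lemma tendsto_plateauConst : Tendsto plateauConst atTop (𝓝 0) := by
  have h : Tendsto (fun T => (plateauConst T)⁻¹) atTop atTop := by
    refine tendsto_atTop_mono' _ ?_ (tendsto_atTop_add_const_right atTop (-4:ℝ) tendsto_id)
    filter_upwards [eventually_gt_atTop 4] with T hT
    simpa using plateauConst_inv_ge hT
  exact h.inv_tendsto_atTop.congr fun T => by simp

lemma one_sub_descent (hT : 4 < T) (t : ℝ) :
    1 - descent T t = plateauConst T * ∫ s in (1:ℝ)..t, plateau T s := by
  have h1 : plateauConst T * ∫ s in (1:ℝ)..T, plateau T s = 1 := by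
    rw [plateauConst]
    exact inv_mul_cancel₀ (by have := integral_plateau_ge hT; linarith)
  rw [← intervalIntegral.integral_add_adjacent_intervals
    (intervalIntegrable_plateau T 1 t) (intervalIntegrable_plateau T t T)] at h1
  rw [descent]
  linarith

lemma descent_eq_one (hT : 4 < T) (ht : t ≤ 1) : descent T t = 1 := by
  have h := one_sub_descent hT t
  rw [intervalIntegral.integral_congr (g := fun _ => (0:ℝ))] at h
  · simp at h; linarith
  · intro s hs
    rw [uIcc_of_ge ht] at hs
    exact plateau_eq_zero_of_le hs.2

lemma descent_eq_zero (ht : T - 1 ≤ t) : descent T t = 0 := by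
  rw [descent, intervalIntegral.integral_congr (g := fun _ => (0:ℝ))]
  · simp
  · intro s hs
    refine plateau_eq_zero_of_ge (le_trans ?_ hs.1)
    exact le_min ht (by linarith)

lemma descent_nonneg (hT : 4 < T) (t : ℝ) : 0 ≤ descent T t := by
  rcases le_total t T with h | h
  · exact mul_nonneg (plateauConst_pos hT).le (integral_plateau_nonneg h)
  · rw [descent_eq_zero (by linarith)]

lemma descent_le_one (hT : 4 < T) (t : ℝ) : descent T t ≤ 1 := by
  rcases le_total t 1 with h | h
  · rw [descent_eq_one hT h]
  · have := mul_nonneg (plateauConst_pos hT).le (integral_plateau_nonneg (T := T) h)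
    linarith [one_sub_descent hT t]

/-- At a fixed level the profile tends to 1 as `T → ∞`, because its slope tends to zero. -/
lemma one_sub_descent_le (hT : 4 < T) (t : ℝ) : 1 - descent T t ≤ plateauConst T * |t| := by
  rcases le_total t 1 with h | h
  · rw [descent_eq_one hT h, sub_self]
    exact mul_nonneg (plateauConst_pos hT).le (abs_nonneg _)
  · rw [one_sub_descent hT]
    refine mul_le_mul_of_nonneg_left ?_ (plateauConst_pos hT).le
    have := integral_plateau_le (T := T) h
    linarith [le_abs_self t]

lemma hasDerivAt_descent (T t : ℝ) : HasDerivAt (descent T) (-(plateauConst T * plateau T t)) t := by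
  have h := intervalIntegral.integral_hasDerivAt_left (intervalIntegrable_plateau T t T)
    (continuous_plateau T).stronglyMeasurable.stronglyMeasurableAtFilter
    (continuous_plateau T).continuousAt
  refine (h.const_mul (plateauConst T)).congr_deriv (by ring)

lemma contDiff_descent (T : ℝ) : ContDiff ℝ ∞ (descent T) := by
  refine contDiff_infty_iff_deriv.2 ⟨fun t => (hasDerivAt_descent T t).differentiableAt, ?_⟩
  have : deriv (descent T) = fun t => -(plateauConst T * plateau T t) :=
    funext fun t => (hasDerivAt_descent T t).deriv
  rw [this]
  exact (contDiff_const.mul (contDiff_plateau T)).neg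

end descent

/-! ### The corrector of one hole -/

/-- The corrector around a hole `{y | T ≤ fundSol d ‖y‖}`: it vanishes near the hole and is equal
to `1` outside the unit ball. -/
noncomputable def unitCorrector (d : ℕ) (T : ℝ) (y : Eucl d) : ℝ :=
  open Classical in if y = 0 then 0 else descent T (fundSol d ‖y‖)

section unitCorrector

variable {d : ℕ} {T : ℝ}

lemma unitCorrector_of_ne {y : Eucl d} (hy : y ≠ 0) :
    unitCorrector d T y = descent T (fundSol d ‖y‖) := if_neg hy

lemma unitCorrector_eq_zero (hd : 2 ≤ d) {s : ℝ} (hs : T - 1 ≤ fundSol d s) {y : Eucl d}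
    (hy : ‖y‖ ≤ s) : unitCorrector d T y = 0 := by
  rcases eq_or_ne y 0 with h | h
  · exact if_pos h
  · have h0 : 0 < ‖y‖ := norm_pos_iff.2 h
    rw [unitCorrector_of_ne h]
    exact descent_eq_zero (hs.trans
      ((fundSol_strictAntiOn hd).antitoneOn h0 (h0.trans_le hy) hy))

lemma unitCorrector_eq_one (hd : 2 ≤ d) (hT : 4 < T) {s : ℝ} (hs0 : 0 < s)
    (hs : fundSol d s ≤ 1) {y : Eucl d} (hy : s ≤ ‖y‖) : unitCorrector d T y = 1 := by
  have h0 : 0 < ‖y‖ := hs0.trans_le hy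
  rw [unitCorrector_of_ne (norm_pos_iff.1 h0)]
  exact descent_eq_one hT (((fundSol_strictAntiOn hd).antitoneOn hs0 h0 hy).trans hs)

lemma exists_fundSol_le_one (d : ℕ) : ∃ s, 0 < s ∧ s < 1 ∧ fundSol d s ≤ 1 := by
  have h := (continuousAt_fundSol (d := d) one_pos).tendsto.mono_left
    (nhdsWithin_le_nhds (s := Iio 1))
  rw [fundSol_one] at h
  have h1 := h.eventually (eventually_lt_nhds one_pos)
  have h2 : ∀ᶠ s in 𝓝[<] (1:ℝ), 0 < s := nhdsWithin_le_nhds (eventually_gt_nhds one_pos)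
  obtain ⟨s, h1, h2, h3⟩ := (h1.and (h2.and self_mem_nhdsWithin)).exists
  exact ⟨s, h2, h3, h1.le⟩

lemma unitCorrector_nonneg (hT : 4 < T) (y : Eucl d) : 0 ≤ unitCorrector d T y := by
  unfold unitCorrector
  split_ifs
  · rfl
  · exact descent_nonneg hT _

lemma unitCorrector_le_one (hT : 4 < T) (y : Eucl d) : unitCorrector d T y ≤ 1 := by
  unfold unitCorrector
  split_ifs
  · exact zero_le_one
  · exact descent_le_one hT _

/-- Smoothness at the origin rests on this. The value 0 imposed there matters: the default value of
`fundSol d 0` is nonpositive, and `descent T` would be 1 on it once `T > 4`. -/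
lemma unitCorrector_eventuallyEq (hd : 2 ≤ d) (T : ℝ) :
    unitCorrector d T =ᶠ[𝓝 0] fun _ => 0 := by
  obtain ⟨r, hr0, -, hr⟩ := exists_fundSol_ge hd (T - 1)
  filter_upwards [Metric.ball_mem_nhds (0 : Eucl d) hr0] with y hy
  exact unitCorrector_eq_zero hd hr (mem_ball_zero_iff.1 hy).le

lemma contDiff_unitCorrector (hd : 2 ≤ d) (T : ℝ) : ContDiff ℝ ∞ (unitCorrector d T) := by
  refine contDiff_iff_contDiffAt.2 fun y => ?_
  rcases eq_or_ne y 0 with rfl | h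
  · exact contDiffAt_const.congr_of_eventuallyEq (unitCorrector_eventuallyEq hd T)
  · have h1 : unitCorrector d T =ᶠ[𝓝 y] fun y => descent T (fundSol d ‖y‖) := by
      filter_upwards [isOpen_ne.mem_nhds h] with z hz
      exact unitCorrector_of_ne hz
    refine ContDiffAt.congr_of_eventuallyEq ?_ h1
    exact (contDiff_descent T).contDiffAt.comp y
      ((contDiffAt_fundSol (norm_pos_iff.2 h)).comp y (contDiffAt_norm ℝ h))

lemma gradient_unitCorrector (hd : 2 ≤ d) (T : ℝ) (y : Eucl d) :
    ∇ (unitCorrector d T) y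
      = (plateauConst T * plateau T (fundSol d ‖y‖) * (‖y‖ ^ d)⁻¹) • y := by
  rcases eq_or_ne y 0 with rfl | h
  · rw [(unitCorrector_eventuallyEq hd T).gradient_eq]; simp [gradient]
  · have h1 : unitCorrector d T =ᶠ[𝓝 y] fun y => descent T (fundSol d ‖y‖) := by
      filter_upwards [isOpen_ne.mem_nhds h] with z hz
      exact unitCorrector_of_ne hz
    have hpos : 0 < ‖y‖ := norm_pos_iff.2 h
    rw [h1.gradient_eq, gradient_radial h (q := fun r => descent T (fundSol d r))
      ((hasDerivAt_descent T _).comp _ (hasDerivAt_fundSol hd hpos))]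
    congr 1
    obtain ⟨n, rfl⟩ : ∃ n, d = n + 1 := ⟨d - 1, by omega⟩
    simp only [Nat.add_sub_cancel]
    field_simp
    ring

/-- A bump equal to `1` on `[T - 2, T]`. -/
noncomputable def layerBump (T t : ℝ) : ℝ :=
  Real.smoothTransition (t - T + 3) * Real.smoothTransition (T + 1 - t)

/-- A function which bounds the squared difference of `∇ (unitCorrector d T)` and the flux field
outside the hole. -/
noncomputable def layerWeight (d : ℕ) (T : ℝ) (y : Eucl d) : ℝ :=
  layerBump T (fundSol d ‖y‖) * ((‖y‖ ^ (d - 1))⁻¹) ^ 2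

lemma layerWeight_nonneg (y : Eucl d) : 0 ≤ layerWeight d T y :=
  mul_nonneg (mul_nonneg (Real.smoothTransition.nonneg _) (Real.smoothTransition.nonneg _))
    (by positivity)

/-- The two fields differ only through the inner cutoff of `plateau`, which is 1 up to level `T -
2`. Outside the hole this leaves the levels from `T - 2` to `T`, where `layerBump T` equals 1. -/
lemma norm_sq_residual_le (hd : 2 ≤ d) {y : Eucl d} (hy : fundSol d ‖y‖ ≤ T) :
    ‖∇ (unitCorrector d T) y - plateauConst T • fluxField d y‖ ^ 2
      ≤ plateauConst T ^ 2 * layerWeight d T y := by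
  rcases eq_or_ne y 0 with rfl | h
  · rw [gradient_unitCorrector hd]
    simp only [fluxField, smul_zero, sub_zero, norm_zero]
    simpa using mul_nonneg (sq_nonneg (plateauConst T)) (layerWeight_nonneg (d := d) (T := T) 0)
  have hpos : 0 < ‖y‖ := norm_pos_iff.2 h
  set t := fundSol d ‖y‖ with ht
  have e : ∇ (unitCorrector d T) y - plateauConst T • fluxField d y
      = (plateauConst T * (Real.smoothTransition (t - 1) *
          (Real.smoothTransition (T - 1 - t) - 1)) * (‖y‖ ^ d)⁻¹) • y := by
    rw [gradient_unitCorrector hd, fluxField, smul_smul, ← sub_smul, ← ht, plateau]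
    congr 1; ring
  have e2 : ‖∇ (unitCorrector d T) y - plateauConst T • fluxField d y‖ ^ 2
      = plateauConst T ^ 2 * ((Real.smoothTransition (t - 1) *
          (Real.smoothTransition (T - 1 - t) - 1)) ^ 2 * ((‖y‖ ^ (d - 1))⁻¹) ^ 2) := by
    rw [e, norm_smul, mul_pow, Real.norm_eq_abs, sq_abs]
    obtain ⟨n, rfl⟩ : ∃ n, d = n + 1 := ⟨d - 1, by omega⟩
    simp only [Nat.add_sub_cancel]
    field_simp
    ring
  rw [e2, layerWeight]
  refine mul_le_mul_of_nonneg_left (mul_le_mul_of_nonneg_right ?_ (by positivity)) (by positivity)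
  rw [← ht]
  rcases le_total t (T - 2) with h2 | h2
  · rw [Real.smoothTransition.one_of_one_le (x := T - 1 - t) (by linarith)]
    simp only [sub_self, mul_zero, ne_eq, OfNat.ofNat_ne_zero, not_false_eq_true, zero_pow]
    exact mul_nonneg (Real.smoothTransition.nonneg _) (Real.smoothTransition.nonneg _)
  · rw [layerBump, Real.smoothTransition.one_of_one_le (x := t - T + 3) (by linarith),
      Real.smoothTransition.one_of_one_le (x := T + 1 - t) (by linarith), one_mul, sq_le_one_iff_abs_le_one,
      abs_mul, abs_of_nonneg (Real.smoothTransition.nonneg _)]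
    refine mul_le_one₀ (Real.smoothTransition.le_one _) (abs_nonneg _) ?_
    rw [abs_le]
    constructor <;>
      linarith [Real.smoothTransition.nonneg (T - 1 - t), Real.smoothTransition.le_one (T - 1 - t)]

/-- The bump is at most 1 and lives on `[T - 3, T + 1]`; the bound 4 is the length of that interval
and does not grow with `T`. -/
lemma integral_layerWeight (hd : 2 ≤ d) (hT : 4 < T) :
    Integrable (layerWeight d T) ∧ ∫ y, layerWeight d T y ≤ 4 * sphereArea d := by
  have hc : Continuous (layerBump T) := by
    unfold layerBump
    exact (Real.smoothTransition.continuous.comp (by fun_prop)).mul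
      (Real.smoothTransition.continuous.comp (by fun_prop))
  have hz : ∀ t ≤ T - 3, layerBump T t = 0 := fun t ht => by
    rw [layerBump, Real.smoothTransition.zero_of_nonpos (by linarith), zero_mul]
  have h := integral_comp_fundSol hd hc (b := T + 1)
    (fun t ht => hz t (by linarith)) (fun t ht => by
      rw [layerBump, Real.smoothTransition.zero_of_nonpos (x := T + 1 - t) (by linarith),
        mul_zero])
  refine ⟨h.1, h.2.le.trans ?_⟩
  rw [mul_comm (4:ℝ)]
  refine mul_le_mul_of_nonneg_left ?_ sphereArea_nonneg
  rw [← intervalIntegral.integral_add_adjacent_intervals (hc.intervalIntegrable 0 (T - 3))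
    (hc.intervalIntegrable (T - 3) (T + 1))]
  have h1 : ∫ t in (0:ℝ)..(T - 3), layerBump T t = 0 := by
    rw [intervalIntegral.integral_congr (g := fun _ => (0:ℝ))]
    · simp
    · intro t ht
      rw [uIcc_of_le (by linarith)] at ht
      exact hz t ht.2
  have h2 : ∫ t in (T - 3)..(T + 1), layerBump T t ≤ ∫ t in (T - 3)..(T + 1), (1:ℝ) :=
    intervalIntegral.integral_mono_on (by linarith) (hc.intervalIntegrable _ _)
      intervalIntegrable_const fun t _ => mul_le_one₀ (Real.smoothTransition.le_one _)
        (Real.smoothTransition.nonneg _) (Real.smoothTransition.le_one _)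
  have h3 : ∫ t in (T - 3)..(T + 1), (1:ℝ) = 4 := by simp; ring
  linarith

/-- Dominated convergence: at each `y ≠ 0` the level is fixed while `T → ∞`, and everything happens
in the unit ball. -/
lemma tendsto_integral_one_sub_unitCorrector (hd : 2 ≤ d) :
    Tendsto (fun T => ∫ y, (1 - unitCorrector d T y) ^ 2) atTop (𝓝 0) := by
  have h0 : ∫ _ : Eucl d, (0:ℝ) = 0 := by simp
  rw [← h0]
  have : Nonempty (Fin d) := ⟨⟨0, by omega⟩⟩
  have hne : ∀ᵐ y : Eucl d, y ≠ 0 := by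
    rw [ae_iff]; simp
  obtain ⟨s, hs0, hs1, hs⟩ := exists_fundSol_le_one d
  refine tendsto_integral_filter_of_dominated_convergence
    ((Metric.closedBall (0 : Eucl d) 1).indicator fun _ => (1:ℝ)) ?_ ?_ ?_ ?_
  · exact Eventually.of_forall fun T => Continuous.aestronglyMeasurable
      ((continuous_const.sub (contDiff_unitCorrector hd T).continuous).pow 2)
  · filter_upwards [eventually_gt_atTop 4] with T hT
    refine Eventually.of_forall fun y => ?_
    by_cases hy : y ∈ Metric.closedBall (0 : Eucl d) 1
    · rw [indicator_of_mem hy, Real.norm_of_nonneg (by positivity)]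
      have h1 := unitCorrector_nonneg hT y
      have h2 := unitCorrector_le_one hT y
      nlinarith
    · rw [mem_closedBall_zero_iff, not_le] at hy
      rw [unitCorrector_eq_one hd hT hs0 hs (hs1.trans hy).le]
      simp only [sub_self, ne_eq, OfNat.ofNat_ne_zero, not_false_eq_true, zero_pow, norm_zero]
      exact indicator_nonneg (fun _ _ => zero_le_one) _
  · exact (integrable_indicator_iff Metric.isClosed_closedBall.measurableSet).2
      (integrableOn_const (measure_closedBall_lt_top.ne))
  · filter_upwards [hne] with y hy
    have h1 : Tendsto (fun T => plateauConst T * |fundSol d ‖y‖|) atTop (𝓝 0) := by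
      simpa using tendsto_plateauConst.mul_const |fundSol d ‖y‖|
    have h2 : Tendsto (fun T => 1 - unitCorrector d T y) atTop (𝓝 0) := by
      refine tendsto_of_tendsto_of_tendsto_of_le_of_le' tendsto_const_nhds h1 ?_ ?_
      · filter_upwards [eventually_gt_atTop 4] with T hT
        linarith [unitCorrector_le_one hT y]
      · filter_upwards [eventually_gt_atTop 4] with T hT
        rw [unitCorrector_of_ne hy]
        exact one_sub_descent_le hT _
    simpa using h2.pow 2

end unitCorrector

/-! ### Local averages and smallness in `H⁻¹` -/

section averages

variable {d : ℕ}

lemma stronglyMeasurable_average {σ : Eucl d → ℝ} (hm : Measurable σ) (δ : ℝ) :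
    StronglyMeasurable fun y => ∫ h in Metric.ball (0 : Eucl d) δ, σ (y - h) := by
  have : StronglyMeasurable fun p : Eucl d × Eucl d => σ (p.1 - p.2) :=
    (hm.comp (measurable_fst.sub measurable_snd)).stronglyMeasurable
  exact this.integral_prod_right

lemma abs_average_le {σ : Eucl d → ℝ} {M : ℝ} (hM : ∀ x, |σ x| ≤ M) (δ : ℝ) (y : Eucl d) :
    |∫ h in Metric.ball (0 : Eucl d) δ, σ (y - h)|
      ≤ M * (volume : Measure (Eucl d)).real (Metric.ball 0 δ) := by
  rw [← Real.norm_eq_abs]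
  exact norm_setIntegral_le_of_norm_le_const measure_ball_lt_top fun h _ => hM (y - h)

/-- Replacing a bounded function by its averages over balls costs little when testing against
functions with an integrable gradient. -/
lemma abs_integral_mul_sub_average_le {σ : Eucl d → ℝ} (hm : Measurable σ) {M : ℝ}
    (hM : ∀ x, |σ x| ≤ M) {g : Eucl d → ℝ} (hg : ContDiff ℝ 1 g) (hc : HasCompactSupport g)
    (δ : ℝ) :
    |(volume : Measure (Eucl d)).real (Metric.ball 0 δ) * (∫ x, σ x * g x)
        - ∫ y, (∫ h in Metric.ball (0 : Eucl d) δ, σ (y - h)) * g y|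
      ≤ M * δ * (∫ x, ‖∇ g x‖) * (volume : Measure (Eucl d)).real (Metric.ball 0 δ) := by
  set B := Metric.ball (0 : Eucl d) δ with hB
  have hM0 : 0 ≤ M := (abs_nonneg _).trans (hM 0)
  have hgi : Integrable g := hg.continuous.integrable_of_hasCompactSupport hc
  have hfin : IsFiniteMeasure (volume.restrict B) :=
    ⟨by rw [Measure.restrict_apply_univ]; exact measure_ball_lt_top⟩
  have hprod : Integrable (fun p : Eucl d × Eucl d => σ (p.2 - p.1) * g p.2)
      ((volume.restrict B).prod volume) := by
    refine Integrable.mono' ((hgi.norm.const_mul M).comp_snd (volume.restrict B)) ?_ ?_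
    · exact ((hm.comp (measurable_snd.sub measurable_fst)).mul
        (hg.continuous.measurable.comp measurable_snd)).aestronglyMeasurable
    · refine Eventually.of_forall fun p => ?_
      rw [norm_mul]
      exact mul_le_mul_of_nonneg_right (hM _) (norm_nonneg _)
  have hσg : ∀ h : Eucl d, Integrable fun x => σ x * g (x + h) := fun h =>
    (hgi.comp_add_right h).bdd_mul hm.aestronglyMeasurable (Eventually.of_forall hM)
  -- Translation moves the average from `σ`, which is merely bounded, onto `g`, whose increments are
  -- controlled by its gradient.
  have hshift : ∀ h : Eucl d, ∫ y, σ (y - h) * g y = ∫ x, σ x * g (x + h) := fun h => by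
    rw [← integral_sub_right_eq_self (fun x => σ x * g (x + h)) h]
    simp
  have hswap : ∫ y, (∫ h in B, σ (y - h)) * g y = ∫ h in B, ∫ x, σ x * g (x + h) := by
    simp_rw [← hshift, ← integral_mul_const]
    exact (integral_integral_swap hprod).symm
  have hint : IntegrableOn (fun h => ∫ x, σ x * g (x + h)) B := by
    have := hprod.integral_prod_left
    simp_rw [hshift] at this
    exact this
  have hconst : volume.real B * (∫ x, σ x * g x) = ∫ _ in B, ∫ x, σ x * g x := by
    simp
  rw [hswap, hconst, ← integral_sub (integrable_const _) hint]
  rw [← Real.norm_eq_abs]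
  refine norm_setIntegral_le_of_norm_le_const
    (measure_ball_lt_top (μ := (volume : Measure (Eucl d)))) fun h hh => ?_
  have h0 : Integrable fun x => σ x * g x := by simpa using hσg 0
  rw [← integral_sub h0 (hσg h)]
  calc ‖∫ x, (σ x * g x - σ x * g (x + h))‖
      ≤ ∫ x, M * |g (x + h) - g x| := by
        refine norm_integral_le_of_norm_le (((hgi.comp_add_right h).sub hgi).abs.const_mul M)
          (Eventually.of_forall fun x => ?_)
        rw [← mul_sub, norm_mul, abs_sub_comm]
        exact mul_le_mul_of_nonneg_right (hM x) (abs_nonneg _)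
    _ = M * ∫ x, |g (x + h) - g x| := integral_const_mul _ _
    _ ≤ M * (δ * ∫ x, ‖∇ g x‖) := by
        refine mul_le_mul_of_nonneg_left ((integral_abs_translate_sub_le hg hc h).trans ?_) hM0
        exact mul_le_mul_of_nonneg_right (mem_ball_zero_iff.1 hh).le
          (integral_nonneg fun x => norm_nonneg _)
    _ = M * δ * ∫ x, ‖∇ g x‖ := by ring

/-- Bounded functions whose averages over small balls tend to zero tend to zero in `H⁻¹`. -/
theorem eventually_abs_integral_mul_le {ι : Type*} {l : Filter ι} [l.IsCountablyGenerated]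
    {σ : ι → Eucl d → ℝ} {M r : ℝ} (hM0 : 0 ≤ M)
    (hm : ∀ᶠ i in l, Measurable (σ i)) (hM : ∀ᶠ i in l, ∀ x, |σ i x| ≤ M)
    (hconv : ∀ y ∈ Metric.ball (0 : Eucl d) r, ∀ δ, 0 < δ → δ < 1 →
      Tendsto (fun i => ∫ h in Metric.ball (0 : Eucl d) δ, σ i (y - h)) l (𝓝 0))
    {Ω : Set (Eucl d)} (hΩ : Ω ⊆ Metric.ball 0 r) {η : ℝ} (hη : 0 < η) :
    ∀ᶠ i in l, ∀ g, IsTestFun Ω g → |∫ x, σ i x * g x| ≤ η * (normL2 g + normL2 (∇ g)) := by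
  set D := Metric.ball (0 : Eucl d) r with hD
  set L := M * √(volume.real D) + 1 with hL
  have hLpos : 0 < L := by positivity
  -- Chosen so that `M δ √|D| ≤ η`, which absorbs the cost of averaging; `1 / 2` keeps `δ` in the
  -- range covered by `hconv`.
  set δ := min (η / L) (1 / 2) with hδdef
  have hδ : 0 < δ := lt_min (by positivity) (by norm_num)
  have hδ1 : δ < 1 := (min_le_right _ _).trans_lt (by norm_num)
  set β := (volume : Measure (Eucl d)).real (Metric.ball 0 δ) with hβdef
  have hβ : 0 < β := ENNReal.toReal_pos (Metric.measure_ball_pos _ _ hδ).ne'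
    measure_ball_lt_top.ne
  set S : ι → Eucl d → ℝ := fun i => D.indicator fun y =>
    ∫ h in Metric.ball (0 : Eucl d) δ, σ i (y - h) with hS
  have hDm : MeasurableSet D := Metric.isOpen_ball.measurableSet
  have hSb : ∀ i, (∀ x, |σ i x| ≤ M) → ∀ y, ‖S i y‖ ≤ M * β := by
    intro i hi y
    by_cases hy : y ∈ D
    · simp only [hS, indicator_of_mem hy]; exact abs_average_le hi δ y
    · simp only [hS, indicator_of_notMem hy, norm_zero]; positivity
  have hSm : ∀ i, Measurable (σ i) → StronglyMeasurable (S i) := fun i hi =>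
    (stronglyMeasurable_average hi δ).indicator hDm
  have hSL : ∀ i, Measurable (σ i) → (∀ x, |σ i x| ≤ M) → MemLp (S i) 2 volume := by
    intro i h1 h2
    have h3 : MemLp (D.indicator fun _ => (M * β)) 2 (volume : Measure (Eucl d)) :=
      memLp_indicator_const 2 hDm _ (Or.inr measure_ball_lt_top.ne)
    refine h3.mono (hSm i h1).aestronglyMeasurable (Eventually.of_forall fun y => ?_)
    by_cases hy : y ∈ D
    · rw [indicator_of_mem hy]
      exact (hSb i h2 y).trans (le_abs_self _)
    · simp [hS, indicator_of_notMem hy]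
  -- With `δ` fixed, the averages are bounded on the ball `D` and tend to zero pointwise, hence in
  -- `L²`.
  have hlim : Tendsto (fun i => ∫ y, ‖S i y‖ ^ 2) l (𝓝 0) := by
    have h0 : ∫ _ : Eucl d, (0:ℝ) = 0 := by simp
    rw [← h0]
    refine tendsto_integral_filter_of_dominated_convergence (D.indicator fun _ => (M * β) ^ 2)
      ?_ ?_ ?_ ?_
    · filter_upwards [hm] with i hi
      exact ((hSm i hi).norm.pow 2).aestronglyMeasurable
    · filter_upwards [hM] with i hi
      refine Eventually.of_forall fun y => ?_
      rw [Real.norm_of_nonneg (by positivity)]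
      by_cases hy : y ∈ D
      · rw [indicator_of_mem hy]
        exact pow_le_pow_left₀ (norm_nonneg _) (hSb i hi y) 2
      · simp [hS, indicator_of_notMem hy]
    · exact (integrable_indicator_iff hDm).2 (integrableOn_const measure_ball_lt_top.ne)
    · refine Eventually.of_forall fun y => ?_
      by_cases hy : y ∈ D
      · have := ((hconv y hy δ hδ hδ1).norm).pow 2
        simpa [hS, indicator_of_mem hy] using this
      · simpa [hS, indicator_of_notMem hy] using tendsto_const_nhds
  have hsmall : ∀ᶠ i in l, ∫ y, ‖S i y‖ ^ 2 < (η * β) ^ 2 :=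
    hlim.eventually (eventually_lt_nhds (by positivity))
  filter_upwards [hm, hM, hsmall] with i h1 h2 h3 g hg
  have hSn : normL2 (S i) ≤ η * β := by
    rw [← normL2_sq (hSL i h1 h2)] at h3
    exact (lt_of_pow_lt_pow_left₀ 2 (by positivity) h3).le
  have hA := abs_integral_mul_sub_average_le h1 h2 hg.contDiff_one hg.compact δ
  have hB : ∫ y, (∫ h in Metric.ball (0 : Eucl d) δ, σ i (y - h)) * g y = ∫ y, S i y * g y := by
    refine integral_congr_ae (Eventually.of_forall fun y => ?_)
    by_cases hy : y ∈ D
    · simp [hS, indicator_of_mem hy]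
    · simp [hg.eq_zero fun h => hy (hΩ h)]
  have hC := abs_integral_mul_le_normL2 (hSL i h1 h2) hg.memLp
  have hE : ∫ x, ‖∇ g x‖ ≤ √(volume.real D) * normL2 (∇ g) :=
    integral_norm_le_of_support hg.memLp_gradient hDm measure_ball_lt_top.ne
      fun x hx => hg.gradient_eq_zero fun h => hx (hΩ h)
  rw [hB, ← hβdef] at hA
  have hF : M * δ * (∫ x, ‖∇ g x‖) ≤ η * normL2 (∇ g) := by
    have h4 : δ * L ≤ η := by
      rw [← le_div_iff₀ hLpos]; exact min_le_left _ _
    have h5 : M * δ * √(volume.real D) ≤ η := by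
      rw [hL] at h4; nlinarith
    calc M * δ * (∫ x, ‖∇ g x‖) ≤ M * δ * (√(volume.real D) * normL2 (∇ g)) :=
          mul_le_mul_of_nonneg_left hE (by positivity)
      _ = M * δ * √(volume.real D) * normL2 (∇ g) := by ring
      _ ≤ η * normL2 (∇ g) := mul_le_mul_of_nonneg_right h5 (normL2_nonneg _)
  have hG : normL2 (S i) * normL2 g ≤ η * β * normL2 g :=
    mul_le_mul_of_nonneg_right hSn (normL2_nonneg _)
  have hH := mul_le_mul_of_nonneg_right hF hβ.le
  refine le_of_mul_le_mul_left ?_ hβ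
  have hI : |β * ∫ x, σ i x * g x|
      ≤ |β * (∫ x, σ i x * g x) - ∫ y, S i y * g y| + |∫ y, S i y * g y| := by
    have := abs_add_le (β * (∫ x, σ i x * g x) - ∫ y, S i y * g y) (∫ y, S i y * g y)
    rwa [sub_add_cancel] at this
  rw [abs_mul, abs_of_pos hβ] at hI
  calc β * |∫ x, σ i x * g x| ≤ _ := hI
    _ ≤ η * normL2 (∇ g) * β + η * β * normL2 g := add_le_add (hA.trans hH) (hC.trans hG)
    _ = β * (η * (normL2 g + normL2 (∇ g))) := by ring

end averages

/-! ### Sums with at most one nonzero term -/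

section disjointSum

variable {ι F : Type*} [NormedAddCommGroup F]

lemma Finset.sum_eq_zero_or_eq_single {s : Finset ι} {f : ι → F}
    (h : ∀ p ∈ s, ∀ q ∈ s, p ≠ q → f p = 0 ∨ f q = 0) :
    (∀ p ∈ s, f p = 0) ∨ ∃ p ∈ s, ∀ q ∈ s, q ≠ p → f q = 0 := by
  by_cases h0 : ∀ p ∈ s, f p = 0
  · exact Or.inl h0
  · push Not at h0
    obtain ⟨p, hp, hne⟩ := h0
    exact Or.inr ⟨p, hp, fun q hq hqp => (h q hq p hp hqp).resolve_right hne⟩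

lemma Finset.norm_sum_sq_of_disjoint {s : Finset ι} {f : ι → F}
    (h : ∀ p ∈ s, ∀ q ∈ s, p ≠ q → f p = 0 ∨ f q = 0) :
    ‖∑ p ∈ s, f p‖ ^ 2 = ∑ p ∈ s, ‖f p‖ ^ 2 := by
  rcases Finset.sum_eq_zero_or_eq_single h with h0 | ⟨p, hp, h0⟩
  · rw [Finset.sum_eq_zero h0, Finset.sum_eq_zero fun p hp => by rw [h0 p hp]; simp]; simp
  · rw [Finset.sum_eq_single_of_mem p hp h0,
      Finset.sum_eq_single_of_mem p hp fun q hq hqp => by rw [h0 q hq hqp]; simp]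

lemma Finset.norm_sum_le_of_disjoint {s : Finset ι} {f : ι → F} {K : ℝ} (hK : 0 ≤ K)
    (h : ∀ p ∈ s, ∀ q ∈ s, p ≠ q → f p = 0 ∨ f q = 0) (hf : ∀ p ∈ s, ‖f p‖ ≤ K) :
    ‖∑ p ∈ s, f p‖ ≤ K := by
  rcases Finset.sum_eq_zero_or_eq_single h with h0 | ⟨p, hp, h0⟩
  · rw [Finset.sum_eq_zero h0]; simpa using hK
  · rw [Finset.sum_eq_single_of_mem p hp h0]; exact hf p hp

end disjointSum

/-! ### The corrector of finitely many holes -/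

/-- The corrector of a finite family of holes with centres `c p`, at the scale `R`. -/
noncomputable def corrector {d : ℕ} {ι : Type*} (s : Finset ι) (c : ι → Eucl d) (T : ι → ℝ) (R : ℝ)
    (x : Eucl d) : ℝ :=
  1 - ∑ p ∈ s, (1 - unitCorrector d (T p) (R⁻¹ • (x - c p)))

/-- The density of `-Δ (corrector s c T R)` away from the holes. -/
noncomputable def correctorDensity {d : ℕ} {ι : Type*} (s : Finset ι) (c : ι → Eucl d) (T : ι → ℝ)
    (R : ℝ) (x : Eucl d) : ℝ :=
  ∑ p ∈ s, plateauConst (T p) * (R⁻¹ ^ 2 * fluxDensity d (R⁻¹ • (x - c p)))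

section corrector

variable {d : ℕ} {ι : Type*} {s : Finset ι} {c : ι → Eucl d} {T : ι → ℝ} {R : ℝ}

lemma norm_scale_lt_one_iff (hR : 0 < R) (x z : Eucl d) :
    ‖R⁻¹ • (x - z)‖ < 1 ↔ x ∈ Metric.ball z R := by
  rw [norm_smul, Real.norm_of_nonneg (by positivity), inv_mul_lt_iff₀ hR, mul_one,
    mem_ball_iff_norm]

/-- Functions carried by disjoint balls have disjoint supports. -/
lemma disjoint_support_of_balls {F : Type*} [Zero F] (hR : 0 < R)
    (hdisj : (s : Set ι).PairwiseDisjoint fun p => Metric.ball (c p) R) {f : ι → Eucl d → F}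
    (hf : ∀ p ∈ s, ∀ y, 1 ≤ ‖y‖ → f p y = 0) (x : Eucl d) :
    ∀ p ∈ s, ∀ q ∈ s, p ≠ q → f p (R⁻¹ • (x - c p)) = 0 ∨ f q (R⁻¹ • (x - c q)) = 0 := by
  intro p hp q hq hpq
  by_contra hne
  push Not at hne
  have h1 : x ∈ Metric.ball (c p) R := by
    rw [← norm_scale_lt_one_iff hR]
    by_contra h
    exact hne.1 (hf p hp _ (not_lt.1 h))
  have h2 : x ∈ Metric.ball (c q) R := by
    rw [← norm_scale_lt_one_iff hR]
    by_contra h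
    exact hne.2 (hf q hq _ (not_lt.1 h))
  exact Set.disjoint_left.1 (hdisj hp hq hpq) h1 h2

lemma unitCorrector_eq_one_of_one_le (hd : 2 ≤ d) {T : ℝ} (hT : 4 < T) {y : Eucl d}
    (hy : 1 ≤ ‖y‖) : unitCorrector d T y = 1 :=
  unitCorrector_eq_one hd hT one_pos (by simp) hy

lemma contDiff_corrector (hd : 2 ≤ d) : ContDiff ℝ ∞ (corrector s c T R) := by
  refine contDiff_const.sub (ContDiff.sum fun p _ => contDiff_const.sub ?_)
  exact (contDiff_unitCorrector hd (T p)).comp (by fun_prop)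

lemma corrector_sub_one (x : Eucl d) :
    corrector s c T R x - 1 = -∑ p ∈ s, (1 - unitCorrector d (T p) (R⁻¹ • (x - c p))) := by
  rw [corrector]; ring

lemma hasCompactSupport_corrector_sub_one (hd : 2 ≤ d) (hR : 0 < R) (hT : ∀ p ∈ s, 4 < T p) :
    HasCompactSupport fun x => corrector s c T R x - 1 := by
  refine HasCompactSupport.intro
    (s.isCompact_biUnion fun p _ => isCompact_closedBall (c p) R) fun x hx => ?_
  rw [corrector_sub_one, Finset.sum_eq_zero, neg_zero]
  intro p hp
  rw [unitCorrector_eq_one_of_one_le hd (hT p hp), sub_self]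
  by_contra h
  rw [not_le, norm_scale_lt_one_iff hR] at h
  exact hx (mem_iUnion₂.2 ⟨p, hp, Metric.ball_subset_closedBall h⟩)

lemma memLp_corrector_sub_one (hd : 2 ≤ d) (hR : 0 < R) (hT : ∀ p ∈ s, 4 < T p) :
    MemLp (fun x => corrector s c T R x - 1) 2 volume :=
  ((contDiff_corrector hd).continuous.sub continuous_const).memLp_of_hasCompactSupport
    (hasCompactSupport_corrector_sub_one hd hR hT)

lemma integrable_one_sub_unitCorrector_sq (hd : 2 ≤ d) {T : ℝ} (hT : 4 < T) :
    Integrable fun y => (1 - unitCorrector d T y) ^ 2 := by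
  refine Continuous.integrable_of_hasCompactSupport
    ((continuous_const.sub (contDiff_unitCorrector hd T).continuous).pow 2) ?_
  refine HasCompactSupport.intro (isCompact_closedBall (0 : Eucl d) 1) fun y hy => ?_
  rw [mem_closedBall_zero_iff, not_le] at hy
  rw [unitCorrector_eq_one_of_one_le hd hT hy.le]
  simp

/-- Disjointness of the balls removes the cross terms, and each hole contributes its unit-scale
integral times `R^d`. -/
lemma normL2_corrector_sub_one_sq (hd : 2 ≤ d) (hR : 0 < R) (hT : ∀ p ∈ s, 4 < T p)
    (hdisj : (s : Set ι).PairwiseDisjoint fun p => Metric.ball (c p) R) :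
    normL2 (fun x => corrector s c T R x - 1) ^ 2
      = ∑ p ∈ s, R ^ d * ∫ y, (1 - unitCorrector d (T p) y) ^ 2 := by
  rw [normL2_sq (memLp_corrector_sub_one hd hR hT)]
  have e : ∀ x, ‖corrector s c T R x - 1‖ ^ 2
      = ∑ p ∈ s, (1 - unitCorrector d (T p) (R⁻¹ • (x - c p))) ^ 2 := by
    intro x
    rw [corrector_sub_one, norm_neg, Finset.norm_sum_sq_of_disjoint]
    · simp
    · exact disjoint_support_of_balls hR hdisj (f := fun p y => 1 - unitCorrector d (T p) y)
        (fun p hp y hy => by rw [unitCorrector_eq_one_of_one_le hd (hT p hp) hy, sub_self]) x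
  simp_rw [e]
  rw [integral_finsetSum _ fun p hp => integrable_comp_scale
    (integrable_one_sub_unitCorrector_sq hd (hT p hp)) (c p) hR]
  exact Finset.sum_congr rfl fun p _ =>
    integral_comp_scale (fun y => (1 - unitCorrector d (T p) y) ^ 2) (c p) hR

/-- The corrector vanishes near the holes. -/
lemma notMem_tsupport_corrector (hd : 2 ≤ d) (hR : 0 < R) (hT : ∀ p ∈ s, 4 < T p)
    (hdisj : (s : Set ι).PairwiseDisjoint fun p => Metric.ball (c p) R) {p : ι} (hp : p ∈ s)
    {a : ℝ} (ha : 0 < a) (haT : T p ≤ fundSol d (a / R)) {x : Eucl d}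
    (hx : x ∈ Metric.closedBall (c p) a) : x ∉ tsupport (corrector s c T R) := by
  have haR : 0 < a / R := by positivity
  -- The profile already vanishes from level `T - 1` on, one unit before the level `T`. Hence the
  -- corrector vanishes on a strictly larger ball, and the closed hole misses even the closed
  -- support.
  have h1 : ∀ᶠ r in 𝓝[>] (a / R), T p - 1 < fundSol d r := by
    have := (continuousAt_fundSol (d := d) haR).tendsto.mono_left
      (nhdsWithin_le_nhds (s := Ioi (a / R)))
    exact this.eventually (eventually_gt_nhds (by linarith))
  obtain ⟨r, hr, har⟩ := (h1.and self_mem_nhdsWithin).exists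
  have har' : a < r * R := (div_lt_iff₀ hR).1 har
  have hr1 : r < 1 := by
    by_contra h
    have := fundSol_nonpos hd (not_lt.1 h)
    linarith [hT p hp]
  rw [notMem_tsupport_iff_eventuallyEq]
  have hxr : x ∈ Metric.ball (c p) (r * R) :=
    Metric.closedBall_subset_ball har' hx
  filter_upwards [Metric.isOpen_ball.mem_nhds hxr] with z hz
  have hzR : z ∈ Metric.ball (c p) R :=
    Metric.ball_subset_ball (by nlinarith) hz
  have hz0 : unitCorrector d (T p) (R⁻¹ • (z - c p)) = 0 := by
    refine unitCorrector_eq_zero hd hr.le ?_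
    rw [norm_smul, Real.norm_of_nonneg (by positivity), inv_mul_le_iff₀ hR]
    rw [mem_ball_iff_norm] at hz
    linarith
  rw [corrector, Finset.sum_eq_single_of_mem p hp, hz0]
  · simp
  · intro q hq hqp
    rw [unitCorrector_eq_one_of_one_le hd (hT q hq), sub_self]
    by_contra h
    rw [not_le, norm_scale_lt_one_iff hR] at h
    exact Set.disjoint_left.1 (hdisj hq hp hqp) h hzR

lemma measurable_correctorDensity : Measurable (correctorDensity s c T R) := by
  refine Finset.measurable_fun_sum _ fun p _ => ?_
  exact ((measurable_fluxDensity.comp (by fun_prop)).const_mul _).const_mul _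

lemma abs_correctorDensity_le (hd : 2 ≤ d) (hR : 0 < R)
    (hdisj : (s : Set ι).PairwiseDisjoint fun p => Metric.ball (c p) R) {K L : ℝ} (hL : 0 ≤ L)
    (hK : ∀ y, |fluxDensity d y| ≤ K) (hT : ∀ p ∈ s, |plateauConst (T p)| * R⁻¹ ^ 2 ≤ L)
    (x : Eucl d) : |correctorDensity s c T R x| ≤ L * K := by
  have hK0 : 0 ≤ K := (abs_nonneg _).trans (hK 0)
  rw [← Real.norm_eq_abs, correctorDensity]
  refine Finset.norm_sum_le_of_disjoint (by positivity) ?_ ?_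
  · exact disjoint_support_of_balls hR hdisj
      (f := fun p y => plateauConst (T p) * (R⁻¹ ^ 2 * fluxDensity d y))
      (fun p _ y hy => by rw [fluxDensity_eq_zero hd hy, mul_zero, mul_zero]) x
  · intro p hp
    rw [← mul_assoc, norm_mul, norm_mul, Real.norm_eq_abs, Real.norm_eq_abs, Real.norm_eq_abs,
      abs_of_nonneg (by positivity : 0 ≤ R⁻¹ ^ 2)]
    exact mul_le_mul (hT p hp) (hK _) (abs_nonneg _) hL

lemma gradient_corrector (hd : 2 ≤ d) (x : Eucl d) :
    ∇ (corrector s c T R) x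
      = ∑ p ∈ s, R⁻¹ • ∇ (unitCorrector d (T p)) (R⁻¹ • (x - c p)) := by
  have hdiff : ∀ p, Differentiable ℝ (unitCorrector d (T p)) := fun p =>
    (contDiff_unitCorrector hd (T p)).differentiable (by simp)
  have hdiff' : ∀ p, DifferentiableAt ℝ (fun x => unitCorrector d (T p) (R⁻¹ • (x - c p))) x :=
    fun p => (hdiff p).differentiableAt.comp x (by fun_prop)
  have h1 : fderiv ℝ (corrector s c T R) x
      = ∑ p ∈ s, fderiv ℝ (fun x => unitCorrector d (T p) (R⁻¹ • (x - c p))) x := by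
    have h2 := HasFDerivAt.fun_sum (u := s) fun p _ => (hdiff' p).hasFDerivAt.const_sub 1
    have h3 := (h2.const_sub 1).fderiv
    rw [Finset.sum_neg_distrib, neg_neg] at h3
    exact h3
  rw [gradient, h1, map_sum]
  refine Finset.sum_congr rfl fun p _ => ?_
  rw [← gradient_comp_scale (c p) R ((hdiff p) _), gradient]

lemma layerWeight_eq_zero (hd : 2 ≤ d) {T : ℝ} (hT : 4 < T) {y : Eucl d} (hy : 1 ≤ ‖y‖) :
    layerWeight d T y = 0 := by
  rw [layerWeight, layerBump, Real.smoothTransition.zero_of_nonpos (x := _ - T + 3)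
    (by linarith [fundSol_nonpos hd hy]), zero_mul, zero_mul]

lemma measurable_layerWeight (T : ℝ) : Measurable (layerWeight d T) := by
  have h1 : Measurable fun y : Eucl d => fundSol d ‖y‖ := measurable_fundSol.comp measurable_norm
  have h2 : Measurable fun y : Eucl d => layerBump T (fundSol d ‖y‖) :=
    (Real.smoothTransition.continuous.measurable.comp ((h1.sub_const T).add_const 3)).mul
      (Real.smoothTransition.continuous.measurable.comp (h1.const_sub (T + 1)))
  have h3 : Measurable fun y : Eucl d => ((‖y‖ ^ (d - 1))⁻¹) ^ 2 := by fun_prop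
  exact h2.mul h3

lemma integrable_inner_gradient {g : Eucl d → ℝ} {X : Eucl d → Eucl d} (hg : ContDiff ℝ 1 g)
    (hc : HasCompactSupport g) (hX : ∀ x ∈ tsupport g, ContinuousAt X x) :
    Integrable fun x => inner ℝ (∇ g x) (X x) := by
  refine Continuous.integrable_of_hasCompactSupport ?_ ?_
  · refine continuous_iff_continuousAt.2 fun x => ?_
    by_cases hx : x ∈ tsupport g
    · exact (continuous_gradient hg).continuousAt.inner (hX x hx)
    · have h0 : (fun x => inner ℝ (∇ g x) (X x)) =ᶠ[𝓝 x] fun _ => (0:ℝ) := by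
        filter_upwards [(isClosed_tsupport g).isOpen_compl.mem_nhds hx] with y hy
        rw [gradient_eq_zero_of_notMem_tsupport hy, inner_zero_left]
      exact continuousAt_const.congr h0.symm
  · refine HasCompactSupport.intro hc fun x hx => ?_
    rw [gradient_eq_zero_of_notMem_tsupport hx, inner_zero_left]

/-- The square root of the residual bound, summed over the holes. -/
noncomputable def residualBound {d : ℕ} {ι : Type*} (s : Finset ι) (c : ι → Eucl d) (T : ι → ℝ)
    (R : ℝ) (x : Eucl d) : ℝ :=
  ∑ p ∈ s, R⁻¹ * (plateauConst (T p) * √(layerWeight d (T p) (R⁻¹ • (x - c p))))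

lemma residualBound_sq (hd : 2 ≤ d) (hR : 0 < R) (hT : ∀ p ∈ s, 4 < T p)
    (hdisj : (s : Set ι).PairwiseDisjoint fun p => Metric.ball (c p) R) (x : Eucl d) :
    ‖residualBound s c T R x‖ ^ 2 = ∑ p ∈ s, R⁻¹ ^ 2 * (plateauConst (T p) ^ 2 *
      layerWeight d (T p) (R⁻¹ • (x - c p))) := by
  rw [residualBound, Finset.norm_sum_sq_of_disjoint]
  · refine Finset.sum_congr rfl fun p _ => ?_
    rw [Real.norm_eq_abs, sq_abs, mul_pow, mul_pow, Real.sq_sqrt (layerWeight_nonneg _)]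
  · exact disjoint_support_of_balls hR hdisj
      (f := fun p y => R⁻¹ * (plateauConst (T p) * √(layerWeight d (T p) y)))
      (fun p hp y hy => by rw [layerWeight_eq_zero hd (hT p hp) hy]; simp) x

/-- Each hole contributes `R^(d-2)` by scaling, times `(plateauConst (T p))²` and the layer bound `4
S_d`. The extra power of `plateauConst` is what makes the total vanish in the limit. -/
lemma integral_residualBound_sq (hd : 2 ≤ d) (hR : 0 < R) (hT : ∀ p ∈ s, 4 < T p)
    (hdisj : (s : Set ι).PairwiseDisjoint fun p => Metric.ball (c p) R) :
    MemLp (residualBound s c T R) 2 volume ∧ normL2 (residualBound s c T R) ^ 2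
      ≤ ∑ p ∈ s, R⁻¹ ^ 2 * R ^ d * (plateauConst (T p) ^ 2 * (4 * sphereArea d)) := by
  have hint : ∀ p ∈ s, Integrable fun x => R⁻¹ ^ 2 * (plateauConst (T p) ^ 2 *
      layerWeight d (T p) (R⁻¹ • (x - c p))) := fun p hp =>
    ((integrable_comp_scale (integral_layerWeight hd (hT p hp)).1 (c p) hR).const_mul _).const_mul _
  have hmeas : Measurable (residualBound s c T R) := by
    refine Finset.measurable_fun_sum _ fun p _ => ?_
    exact (((measurable_layerWeight (T p)).comp (by fun_prop)).sqrt.const_mul _).const_mul _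
  have hmem : MemLp (residualBound s c T R) 2 volume := by
    rw [memLp_two_iff_integrable_sq_norm hmeas.aestronglyMeasurable]
    simp_rw [residualBound_sq hd hR hT hdisj]
    exact integrable_finsetSum _ hint
  refine ⟨hmem, ?_⟩
  rw [normL2_sq hmem]
  simp_rw [residualBound_sq hd hR hT hdisj]
  rw [integral_finsetSum _ hint]
  refine Finset.sum_le_sum fun p hp => ?_
  rw [integral_const_mul, integral_const_mul,
    integral_comp_scale (layerWeight d (T p)) (c p) hR]
  have := mul_le_mul_of_nonneg_left (integral_layerWeight hd (hT p hp)).2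
    (by positivity : 0 ≤ R⁻¹ ^ 2 * R ^ d * plateauConst (T p) ^ 2)
  calc _ = R⁻¹ ^ 2 * R ^ d * plateauConst (T p) ^ 2 * ∫ y, layerWeight d (T p) y := by ring
    _ ≤ _ := this
    _ = _ := by ring

/-- Outside the holes, the residual is controlled by `residualBound`. -/
lemma norm_residual_le (hd : 2 ≤ d) (hR : 0 < R) (hT : ∀ p ∈ s, 4 < T p) {a : ι → ℝ}
    (ha : ∀ p ∈ s, 0 < a p) (haT : ∀ p ∈ s, fundSol d (a p / R) ≤ T p) {x : Eucl d}
    (hx : ∀ p ∈ s, x ∉ Metric.closedBall (c p) (a p)) :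
    ‖∇ (corrector s c T R) x - ∑ p ∈ s, plateauConst (T p) •
      (R⁻¹ • fluxField d (R⁻¹ • (x - c p)))‖ ≤ ‖residualBound s c T R x‖ := by
  rw [gradient_corrector hd, ← Finset.sum_sub_distrib]
  refine (norm_sum_le _ _).trans (le_trans ?_ (le_abs_self _))
  refine Finset.sum_le_sum fun p hp => ?_
  set y := R⁻¹ • (x - c p) with hy
  rw [smul_comm, ← smul_sub, norm_smul, Real.norm_of_nonneg (by positivity)]
  refine mul_le_mul_of_nonneg_left ?_ (by positivity)
  have hk := (plateauConst_pos (hT p hp)).le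
  have hxp : a p / R ≤ ‖y‖ := by
    have := hx p hp
    rw [mem_closedBall_iff_norm, not_le] at this
    rw [hy, norm_smul, Real.norm_of_nonneg (by positivity), div_eq_inv_mul]
    exact mul_le_mul_of_nonneg_left this.le (by positivity)
  have h0 : 0 < a p / R := div_pos (ha p hp) hR
  have hyT : fundSol d ‖y‖ ≤ T p :=
    ((fundSol_strictAntiOn hd).antitoneOn h0 (h0.trans_le hxp) hxp).trans (haT p hp)
  refine le_of_sq_le_sq ?_ (mul_nonneg hk (Real.sqrt_nonneg _))
  rw [mul_pow, Real.sq_sqrt (layerWeight_nonneg _)]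
  exact norm_sq_residual_le hd hyT

lemma integrable_inner_gradient_fluxField (hR : 0 < R) {g : Eucl d → ℝ}
    (hg : ContDiff ℝ 1 g) (hc : HasCompactSupport g) {z : Eucl d} (hz : z ∉ tsupport g) :
    Integrable fun x => inner ℝ (∇ g x) (R⁻¹ • fluxField d (R⁻¹ • (x - z))) := by
  refine integrable_inner_gradient hg hc fun x hx => ?_
  have hne : R⁻¹ • (x - z) ≠ 0 := by
    refine smul_ne_zero (by positivity) (sub_ne_zero.2 ?_)
    rintro rfl
    exact hz hx
  have h1 : ContinuousAt (fun x => fluxField d (R⁻¹ • (x - z))) x :=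
    ContinuousAt.comp (f := fun x => R⁻¹ • (x - z)) (g := fluxField d)
      (contDiffAt_fluxField hne).continuousAt
      (show ContinuousAt (fun x => R⁻¹ • (x - z)) x by fun_prop)
  exact h1.const_smul R⁻¹

lemma inner_sum_smul (v : Eucl d) (k : ι → ℝ) (X : ι → Eucl d) :
    inner ℝ v (∑ p ∈ s, k p • X p) = ∑ p ∈ s, k p * inner ℝ v (X p) := by
  rw [inner_sum]
  exact Finset.sum_congr rfl fun p _ => real_inner_smul_right _ _ _

/-- The divergence theorem for the sum of the flux fields. Only the centres have to avoid the
support of `g`, since the fields are singular nowhere else. -/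
lemma integral_correctorDensity_mul (hd : 2 ≤ d) (hR : 0 < R) {g : Eucl d → ℝ}
    (hg : ContDiff ℝ 1 g) (hc : HasCompactSupport g) (hcen : ∀ p ∈ s, c p ∉ tsupport g) :
    ∫ x, correctorDensity s c T R x * g x
      = ∫ x, inner ℝ (∇ g x) (∑ p ∈ s, plateauConst (T p) •
        (R⁻¹ • fluxField d (R⁻¹ • (x - c p)))) := by
  obtain ⟨K, -, hK⟩ := exists_fluxDensity_bound (d := d) hd
  have hI4 : ∀ p ∈ s, Integrable fun x => plateauConst (T p) *
      (R⁻¹ ^ 2 * fluxDensity d (R⁻¹ • (x - c p))) * g x := by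
    intro p hp
    refine ((hg.continuous.integrable_of_hasCompactSupport hc).bdd_mul
      (c := |plateauConst (T p)| * (R⁻¹ ^ 2 * K)) ?_ (Eventually.of_forall fun x => ?_))
    · exact (((measurable_fluxDensity.comp (by fun_prop)).const_mul _).const_mul _
        |>.aestronglyMeasurable)
    · rw [norm_mul, norm_mul, Real.norm_of_nonneg (by positivity : 0 ≤ R⁻¹ ^ 2)]
      refine mul_le_mul_of_nonneg_left (mul_le_mul_of_nonneg_left (hK _) (by positivity))
        (abs_nonneg _)
  simp_rw [correctorDensity, Finset.sum_mul, inner_sum_smul]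
  rw [integral_finsetSum _ hI4, integral_finsetSum _ fun p hp =>
    (integrable_inner_gradient_fluxField hR hg hc (hcen p hp)).const_mul _]
  refine Finset.sum_congr rfl fun p hp => ?_
  rw [integral_const_mul, integral_inner_gradient_fluxField_scale hd hg hc (hcen p hp) hR,
    ← integral_const_mul]
  congr 1 with x
  ring

/-- The corrector solves `-Δ w = correctorDensity` away from the holes, up to a small error. -/
lemma abs_integral_gradient_corrector_sub_le (hd : 2 ≤ d) (hR : 0 < R) (hT : ∀ p ∈ s, 4 < T p)
    (hdisj : (s : Set ι).PairwiseDisjoint fun p => Metric.ball (c p) R) {a : ι → ℝ}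
    (ha : ∀ p ∈ s, 0 < a p) (haT : ∀ p ∈ s, fundSol d (a p / R) ≤ T p) {g : Eucl d → ℝ}
    (hg : ContDiff ℝ 1 g) (hc : HasCompactSupport g)
    (hgs : ∀ p ∈ s, Disjoint (Metric.closedBall (c p) (a p)) (tsupport g)) :
    |(∫ x, inner ℝ (∇ g x) (∇ (corrector s c T R) x)) - ∫ x, correctorDensity s c T R x * g x|
      ≤ normL2 (∇ g) * normL2 (residualBound s c T R) := by
  have hcen : ∀ p ∈ s, c p ∉ tsupport g := fun p hp h =>
    Set.disjoint_left.1 (hgs p hp) (Metric.mem_closedBall_self (ha p hp).le) h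
  have hI2 : Integrable fun x => inner ℝ (∇ g x) (∇ (corrector s c T R) x) :=
    integrable_inner_gradient hg hc fun x _ =>
      (continuous_gradient ((contDiff_corrector hd).of_le (by exact_mod_cast le_top))).continuousAt
  have hI3 : Integrable fun x => inner ℝ (∇ g x) (∑ p ∈ s, plateauConst (T p) •
        (R⁻¹ • fluxField d (R⁻¹ • (x - c p)))) := by
    simp_rw [inner_sum_smul]
    exact integrable_finsetSum _ fun p hp =>
      (integrable_inner_gradient_fluxField hR hg hc (hcen p hp)).const_mul _
  obtain ⟨hmem, -⟩ := integral_residualBound_sq hd hR hT hdisj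
  have hgm : MemLp (∇ g) 2 volume :=
    (continuous_gradient hg).memLp_of_hasCompactSupport hc.gradient
  -- After the density is traded for the flux fields, the difference is `∇g` against the residual;
  -- on the support of `g`, which misses the holes, the residual bound applies.
  rw [integral_correctorDensity_mul hd hR hg hc hcen, ← integral_sub hI2 hI3]
  refine le_trans ?_ (integral_norm_mul_norm_le_normL2 hgm hmem)
  rw [← Real.norm_eq_abs]
  refine norm_integral_le_of_norm_le (hgm.norm.integrable_mul hmem.norm)
    (Eventually.of_forall fun x => ?_)
  by_cases hx : x ∈ tsupport g
  · rw [← inner_sub_right]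
    refine (norm_inner_le_norm _ _).trans (mul_le_mul_of_nonneg_left ?_ (norm_nonneg _))
    exact norm_residual_le hd hR hT ha haT fun p hp h => Set.disjoint_left.1 (hgs p hp) h hx
  · rw [gradient_eq_zero_of_notMem_tsupport hx]; simp

end corrector

/-! ### Geometry of the tiling -/

lemma IsPreconnected.inter_frontier_nonempty_of_mem {X : Type*} [TopologicalSpace X] {S G : Set X}
    (hS : IsPreconnected S) {x y : X} (hx : x ∈ S) (hxG : x ∈ G) (hy : y ∈ S) (hyG : y ∉ G) :
    (S ∩ frontier G).Nonempty := by
  by_contra h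
  rw [not_nonempty_iff_eq_empty] at h
  have hsub : S ⊆ interior G ∪ interior Gᶜ := by
    rw [← compl_frontier_eq_union_interior]
    exact fun z hz hzG => (h ▸ (⟨hz, hzG⟩ : z ∈ S ∩ frontier G) : z ∈ (∅ : Set X))
  have hx' : x ∈ interior G := (hsub hx).resolve_right fun h' => interior_subset h' hxG
  have hy' : y ∈ interior Gᶜ := (hsub hy).resolve_left fun h' => hyG (interior_subset h')
  obtain ⟨z, -, h1, h2⟩ := hS _ _ isOpen_interior isOpen_interior hsub ⟨x, hx, hx'⟩ ⟨y, hy, hy'⟩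
  exact interior_subset h2 (interior_subset h1)

section tiles

variable {d : ℕ} {A Λ : Set (Eucl d)} {ε ρ : ℝ}

lemma tile_eq_preimage (A : Set (Eucl d)) (hε : 0 < ε) (i : Eucl d) :
    tile A ε i = (fun y => ε⁻¹ • y - i) ⁻¹' A := by
  ext y
  simp only [tile, mem_image, mem_preimage]
  constructor
  · rintro ⟨z, hz, rfl⟩
    rwa [inv_smul_smul₀ hε.ne', add_sub_cancel_right]
  · intro h
    exact ⟨_, h, by rw [sub_add_cancel, smul_inv_smul₀ hε.ne']⟩

lemma tile_eq_smul (A : Set (Eucl d)) (ε : ℝ) (i : Eucl d) :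
    tile A ε i = (fun y => ε • y) '' ((fun y => y + i) '' A) := by
  rw [image_image]; rfl

lemma nullMeasurableSet_tile (hA : NullMeasurableSet A volume) (hε : 0 < ε) (i : Eucl d) :
    NullMeasurableSet (tile A ε i) volume := by
  rw [tile_eq_preimage A hε]
  refine hA.preimage ?_
  have h1 : Measure.QuasiMeasurePreserving (fun y : Eucl d => ε⁻¹ • y) volume volume := by
    refine ⟨by fun_prop, ?_⟩
    rw [Measure.map_addHaar_smul _ (inv_ne_zero hε.ne')]
    exact Measure.smul_absolutelyContinuous
  exact (measurePreserving_sub_right volume i).quasiMeasurePreserving.comp h1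

open scoped Pointwise in
lemma volume_tile (hε : 0 < ε) (i : Eucl d) :
    volume (tile A ε i) = ENNReal.ofReal (ε ^ d) * volume A := by
  rw [tile_eq_smul, show (fun y : Eucl d => ε • y) '' ((fun y => y + i) '' A)
    = ε • ((fun y => y + i) '' A) from rfl, Measure.addHaar_smul, finrank_euclideanSpace_fin,
    abs_of_pos (by positivity), image_add_right, measure_preimage_add_right]

lemma disjoint_tile (hdisj : Λ.PairwiseDisjoint fun i => (fun y => y + i) '' A) (hε : 0 < ε)
    {i j : Eucl d} (hi : i ∈ Λ) (hj : j ∈ Λ) (hij : i ≠ j) :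
    Disjoint (tile A ε i) (tile A ε j) := by
  rw [tile_eq_smul, tile_eq_smul]
  exact (disjoint_image_iff (smul_right_injective _ hε.ne')).2 (hdisj hi hj hij)

lemma exists_mem_tile (hcover : (⋃ i ∈ Λ, (fun y => y + i) '' A) = univ) (hε : 0 < ε)
    (x : Eucl d) : ∃ i ∈ Λ, x ∈ tile A ε i := by
  have h : ε⁻¹ • x ∈ ⋃ i ∈ Λ, (fun y => y + i) '' A := hcover ▸ mem_univ _
  obtain ⟨i, hi, hx⟩ := mem_iUnion₂.1 h
  refine ⟨i, hi, ?_⟩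
  rw [tile_eq_smul]
  exact ⟨_, hx, smul_inv_smul₀ hε.ne' x⟩

lemma dist_le_of_mem_tile (hAρ : A ⊆ Metric.ball 0 ρ) (hε : 0 < ε) {i y z : Eucl d}
    (hy : y ∈ tile A ε i) (hz : z ∈ tile A ε i) : dist y z ≤ 2 * ρ * ε := by
  obtain ⟨u, hu, rfl⟩ := hy
  obtain ⟨v, hv, rfl⟩ := hz
  have h1 := mem_ball_zero_iff.1 (hAρ hu)
  have h2 := mem_ball_zero_iff.1 (hAρ hv)
  simp only [dist_eq_norm, ← smul_sub, add_sub_add_right_eq_sub, norm_smul,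
    Real.norm_of_nonneg hε.le]
  have h3 := norm_sub_le u v
  nlinarith

/-- A tile which meets a set without being contained in it is close to the frontier. -/
lemma mem_cthickening_frontier_of_mem_tile (hAρ : A ⊆ Metric.ball 0 ρ) (hε : 0 < ε)
    {G : Set (Eucl d)} {i x : Eucl d} (hx : x ∈ tile A ε i) (hxG : x ∈ G)
    (hi : ¬ tile A ε i ⊆ G) : x ∈ Metric.cthickening (2 * ρ * ε) (frontier G) := by
  obtain ⟨y, hy, hyG⟩ := not_subset.1 hi
  obtain ⟨z, hz, hzG⟩ := (convex_segment x y).isPreconnected.inter_frontier_nonempty_of_mem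
    (left_mem_segment ℝ x y) hxG (right_mem_segment ℝ x y) hyG
  refine Metric.mem_cthickening_of_dist_le x z _ _ hzG ?_
  refine le_trans ?_ (dist_le_of_mem_tile hAρ hε hx hy)
  have := dist_add_dist_of_mem_segment hz
  linarith [dist_nonneg (x := z) (y := y)]

/-- Closed neighbourhoods of a compact set shrink to it in measure, and the frontier is null. -/
lemma tendsto_volume_cthickening_frontier {G : Set (Eucl d)} (hG : Bornology.IsBounded G)
    (h0 : volume (frontier G) = 0) (ρ : ℝ) :
    Tendsto (fun ε : ℝ => (volume : Measure (Eucl d)).real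
      (Metric.cthickening (2 * ρ * ε) (frontier G))) (𝓝[>] 0) (𝓝 0) := by
  have hc : IsCompact (frontier G) :=
    Metric.isCompact_of_isClosed_isBounded isClosed_frontier
      (hG.closure.subset frontier_subset_closure)
  have h1 := tendsto_measure_cthickening_of_isCompact (μ := volume) hc
  rw [h0] at h1
  have h2 : Tendsto (fun ε : ℝ => 2 * ρ * ε) (𝓝[>] 0) (𝓝 0) := by
    have : Tendsto (fun ε : ℝ => 2 * ρ * ε) (𝓝 0) (𝓝 (2 * ρ * 0)) :=
      (continuous_const.mul continuous_id).tendsto 0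
    rw [mul_zero] at this
    exact this.mono_left nhdsWithin_le_nhds
  have h3 := (ENNReal.tendsto_toReal ENNReal.zero_ne_top).comp (h1.comp h2)
  rw [ENNReal.toReal_zero] at h3
  exact h3

/-- If a function has vanishing integral over each tile contained in `G`, its integral over `G` is
controlled by the size of a neighbourhood of the frontier of `G`. -/
lemma abs_setIntegral_le_of_tiles (hA : NullMeasurableSet A volume) (hΛ : Λ.Countable)
    (hcover : (⋃ i ∈ Λ, (fun y => y + i) '' A) = univ)
    (hdisj : Λ.PairwiseDisjoint fun i => (fun y => y + i) '' A) (hAρ : A ⊆ Metric.ball 0 ρ)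
    (hε : 0 < ε) {G : Set (Eucl d)} (hG : Bornology.IsBounded G) (hGm : NullMeasurableSet G volume)
    {h : Eucl d → ℝ} (hm : Measurable h) {M : ℝ} (hM : ∀ x, |h x| ≤ M)
    (hz : ∀ i ∈ Λ, tile A ε i ⊆ G → ∫ x in tile A ε i, h x = 0) :
    |∫ x in G, h x| ≤ M * (volume : Measure (Eucl d)).real
      (Metric.cthickening (2 * ρ * ε) (frontier G)) := by
  have hGfin : volume G ≠ ⊤ := hG.measure_lt_top.ne
  have hint : IntegrableOn h G volume := by
    have : IsFiniteMeasure (volume.restrict G) := ⟨by simpa using hG.measure_lt_top⟩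
    exact Integrable.of_bound hm.aestronglyMeasurable M (Eventually.of_forall hM)
  set J : Set (Eucl d) := {i ∈ Λ | tile A ε i ⊆ G} with hJ
  have : Countable J := (hΛ.mono (sep_subset _ _)).to_subtype
  set U : Set (Eucl d) := ⋃ i : J, tile A ε i with hU
  have htm : ∀ i : J, NullMeasurableSet (tile A ε i) volume := fun i =>
    nullMeasurableSet_tile hA hε i
  have hUm : NullMeasurableSet U volume := NullMeasurableSet.iUnion htm
  have hUG : U ⊆ G := iUnion_subset fun i => i.2.2
  have htd : Pairwise (Function.onFun (AEDisjoint volume) fun i : J => tile A ε i) :=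
    fun i j hij => (disjoint_tile hdisj hε i.2.1 j.2.1 fun h => hij (Subtype.ext h)).aedisjoint
  -- Countable additivity over the tiles inside `G`; what remains of `G` lies in tiles crossing its
  -- frontier.
  have hU0 : ∫ x in U, h x = 0 := by
    have hs := hasSum_integral_iUnion_ae htm htd (hint.mono_set hUG)
    have h0 : (fun i : J => ∫ x in tile A ε i, h x) = fun _ => 0 :=
      funext fun i => hz i i.2.1 i.2.2
    rw [h0] at hs
    exact hs.unique hasSum_zero
  have hsplit : ∫ x in G, h x = ∫ x in G \ U, h x := by
    have h1 : G = U ∪ (G \ U) := (union_sdiff_cancel hUG).symm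
    conv_lhs => rw [h1]
    rw [setIntegral_union₀ disjoint_sdiff_right.aedisjoint (hGm.diff hUm) (hint.mono_set hUG)
      (hint.mono_set sdiff_subset), hU0, zero_add]
  have hsub : G \ U ⊆ Metric.cthickening (2 * ρ * ε) (frontier G) := by
    rintro x ⟨hxG, hxU⟩
    obtain ⟨i, hi, hxi⟩ := exists_mem_tile hcover hε x
    refine mem_cthickening_frontier_of_mem_tile hAρ hε hxi hxG fun hsub => hxU ?_
    exact mem_iUnion.2 ⟨⟨i, hi, hsub⟩, hxi⟩
  have hfin : volume (Metric.cthickening (2 * ρ * ε) (frontier G)) ≠ ⊤ :=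
    (Bornology.IsBounded.cthickening
      (hG.closure.subset frontier_subset_closure)).measure_lt_top.ne
  rw [hsplit, ← Real.norm_eq_abs]
  have hM0 : 0 ≤ M := (abs_nonneg _).trans (hM 0)
  refine (norm_setIntegral_le_of_norm_le_const
    ((measure_mono hsub).trans_lt hfin.lt_top) fun x _ => hM x).trans ?_
  exact mul_le_mul_of_nonneg_left (measureReal_mono hsub hfin) hM0

end tiles

/-! ### Counting holes and averaging the density over tiles -/

/-- At the scale `ε`, the balls of radius `R` around the centres of the holes are pairwise disjoint
and contained in their tiles. -/
structure IsPerforation {d m : ℕ} (A Λ : Set (Eucl d)) (F : Fin m → Set (Eucl d)) (N : Fin m → ℕ)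
    (ε R : ℝ) (z : Eucl d → ℕ → Eucl d) : Prop where
  ball_subset : ∀ k, ∀ i ∈ innerIndices A Λ ε (F k), ∀ j < N k, Metric.ball (z i j) R ⊆ tile A ε i
  disjoint : ∀ k, ∀ i ∈ innerIndices A Λ ε (F k), ∀ j < N k, ∀ l < N k, j ≠ l →
    Disjoint (Metric.ball (z i j) R) (Metric.ball (z i l) R)

/-- The indices of the holes in the tiles which meet `D`. -/
def holeIndices {d m : ℕ} (A Λ : Set (Eucl d)) (F : Fin m → Set (Eucl d)) (N : Fin m → ℕ)
    (ε : ℝ) (D : Set (Eucl d)) : Set (Fin m × Eucl d × ℕ) :=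
  {p | p.2.1 ∈ innerIndices A Λ ε (F p.1) ∧ p.2.2 < N p.1 ∧ (tile A ε p.2.1 ∩ D).Nonempty}

section indices

variable {d m : ℕ} {A Λ : Set (Eucl d)} {F : Fin m → Set (Eucl d)} {N : Fin m → ℕ} {ε R ρ : ℝ}
  {z : Eucl d → ℕ → Eucl d} {D : Set (Eucl d)}

lemma eq_of_tile_subset (hFd : Pairwise fun k l => Disjoint (F k) (F l)) {k l : Fin m}
    {i : Eucl d} (hne : (tile A ε i).Nonempty) (hk : tile A ε i ⊆ F k) (hl : tile A ε i ⊆ F l) :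
    k = l := by
  by_contra h
  obtain ⟨x, hx⟩ := hne
  exact Set.disjoint_left.1 (hFd h) (hk hx) (hl hx)

lemma pairwiseDisjoint_balls (hFd : Pairwise fun k l => Disjoint (F k) (F l))
    (hdisj : Λ.PairwiseDisjoint fun i => (fun y => y + i) '' A) (hε : 0 < ε)
    (hz : IsPerforation A Λ F N ε R z) :
    (holeIndices A Λ F N ε D).PairwiseDisjoint fun p => Metric.ball (z p.2.1 p.2.2) R := by
  rintro ⟨k, i, j⟩ ⟨hi, hj, hne⟩ ⟨k', i', j'⟩ ⟨hi', hj', -⟩ hpq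
  simp only [Function.onFun] at *
  by_cases h : i = i'
  · subst h
    -- A nonempty tile lies in at most one region, so the tile index determines `k`.
    have hk : k = k' := eq_of_tile_subset hFd (hne.mono inter_subset_left) hi.2 hi'.2
    subst hk
    exact hz.disjoint k i hi j hj j' hj' fun h => hpq (by rw [h])
  · exact (disjoint_tile hdisj hε hi.1 hi'.1 h).mono (hz.ball_subset k i hi j hj)
      (hz.ball_subset k' i' hi' j' hj')

lemma volume_real_ball (c : Eucl d) (hR : 0 < R) :
    (volume : Measure (Eucl d)).real (Metric.ball c R)
      = R ^ d * (volume : Measure (Eucl d)).real (Metric.ball 0 1) := by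
  rw [measureReal_def, Measure.addHaar_ball_of_pos _ _ hR, finrank_euclideanSpace_fin,
    ENNReal.toReal_mul, ENNReal.toReal_ofReal (by positivity), measureReal_def]

/-- A packing bound: disjoint balls of radius `R` fit into one fixed ball, since tiles have diameter
at most `2 |ρ|` for `ε ≤ 1`. The number of holes is thus `O(R^(-d))`. -/
lemma card_mul_le (hFd : Pairwise fun k l => Disjoint (F k) (F l))
    (hdisj : Λ.PairwiseDisjoint fun i => (fun y => y + i) '' A) (hAρ : A ⊆ Metric.ball 0 ρ)
    (hε : 0 < ε) (hε1 : ε ≤ 1) (hR : 0 < R) (hz : IsPerforation A Λ F N ε R z) {r : ℝ}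
    (hD : D ⊆ Metric.ball 0 r) {t : Finset (Fin m × Eucl d × ℕ)}
    (ht : (t : Set (Fin m × Eucl d × ℕ)) ⊆ holeIndices A Λ F N ε D) :
    (t.card : ℝ) * (R ^ d * (volume : Measure (Eucl d)).real (Metric.ball 0 1))
      ≤ (volume : Measure (Eucl d)).real (Metric.ball 0 (r + 2 * |ρ|)) := by
  have hsub : (⋃ p ∈ t, Metric.ball (z p.2.1 p.2.2) R) ⊆ Metric.ball 0 (r + 2 * |ρ|) := by
    refine iUnion₂_subset fun p hp x hx => ?_
    obtain ⟨hi, hj, w, hw, hwD⟩ := ht hp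
    have h1 := dist_le_of_mem_tile hAρ hε (hz.ball_subset _ _ hi _ hj hx) hw
    have h2 := mem_ball_zero_iff.1 (hD hwD)
    have h3 : 2 * ρ * ε ≤ 2 * |ρ| := by
      have := le_abs_self ρ
      have := abs_nonneg ρ
      nlinarith
    rw [mem_ball_zero_iff]
    rw [dist_eq_norm] at h1
    have h4 : ‖x‖ ≤ ‖x - w‖ + ‖w‖ := by simpa using norm_add_le (x - w) w
    linarith
  have h1 : (volume : Measure (Eucl d)).real (⋃ p ∈ t, Metric.ball (z p.2.1 p.2.2) R)
      = ∑ p ∈ t, (volume : Measure (Eucl d)).real (Metric.ball (z p.2.1 p.2.2) R) :=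
    measureReal_biUnion_finset ((pairwiseDisjoint_balls hFd hdisj hε hz).subset ht)
      (fun p _ => Metric.isOpen_ball.measurableSet) (fun p _ => measure_ball_lt_top.ne)
  simp only [volume_real_ball _ hR, Finset.sum_const, nsmul_eq_mul] at h1
  rw [← h1]
  exact measureReal_mono hsub measure_ball_lt_top.ne

/-- The packing bound holds for every finite subset with the same constant, so local finiteness of
`Λ` need not be assumed. -/
lemma finite_holeIndices (hFd : Pairwise fun k l => Disjoint (F k) (F l))
    (hdisj : Λ.PairwiseDisjoint fun i => (fun y => y + i) '' A) (hAρ : A ⊆ Metric.ball 0 ρ)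
    (hε : 0 < ε) (hε1 : ε ≤ 1) (hR : 0 < R) (hz : IsPerforation A Λ F N ε R z) {r : ℝ}
    (hD : D ⊆ Metric.ball 0 r) : (holeIndices A Λ F N ε D).Finite := by
  by_contra hinf
  have hpos : 0 < R ^ d * (volume : Measure (Eucl d)).real (Metric.ball 0 1) := by
    refine mul_pos (by positivity) (ENNReal.toReal_pos ?_ measure_ball_lt_top.ne)
    exact (Metric.measure_ball_pos _ _ one_pos).ne'
  obtain ⟨n, hn⟩ := exists_nat_gt ((volume : Measure (Eucl d)).real
    (Metric.ball 0 (r + 2 * |ρ|)) / (R ^ d * (volume : Measure (Eucl d)).real (Metric.ball 0 1)))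
  obtain ⟨t, ht, hcard⟩ := Set.Infinite.exists_subset_card_eq hinf n
  have := card_mul_le hFd hdisj hAρ hε hε1 hR hz hD ht
  rw [hcard] at this
  rw [div_lt_iff₀ hpos] at hn
  linarith

variable {s : Finset (Fin m × Eucl d × ℕ)} {T : Fin m → ℝ}

lemma term_eq_zero (hd : 2 ≤ d) (hR : 0 < R) {c x : Eucl d} (hx : x ∉ Metric.ball c R) (κ : ℝ) :
    κ * (R⁻¹ ^ 2 * fluxDensity d (R⁻¹ • (x - c))) = 0 := by
  rw [fluxDensity_eq_zero hd, mul_zero, mul_zero]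
  by_contra h
  rw [not_le, norm_scale_lt_one_iff hR] at h
  exact hx h

lemma integral_term (hd : 2 ≤ d) (hR : 0 < R) (c : Eucl d) (κ : ℝ) :
    Integrable (fun x => κ * (R⁻¹ ^ 2 * fluxDensity d (R⁻¹ • (x - c)))) ∧
    ∫ x, κ * (R⁻¹ ^ 2 * fluxDensity d (R⁻¹ • (x - c)))
      = κ * (R⁻¹ ^ 2 * (R ^ d * sphereArea d)) := by
  refine ⟨((integrable_comp_scale (integral_fluxDensity hd).1 c hR).const_mul _).const_mul _, ?_⟩
  rw [integral_const_mul, integral_const_mul, integral_comp_scale _ c hR, (integral_fluxDensity hd).2]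

/-- The integral of the density over a tile contained in `F k`. -/
lemma setIntegral_tile_correctorDensity (hd : 2 ≤ d)
    (hFd : Pairwise fun k l => Disjoint (F k) (F l))
    (hdisj : Λ.PairwiseDisjoint fun i => (fun y => y + i) '' A) (hε : 0 < ε) (hR : 0 < R)
    (hz : IsPerforation A Λ F N ε R z) (hs : ∀ p, p ∈ s ↔ p ∈ holeIndices A Λ F N ε D)
    {k : Fin m} {i : Eucl d} (hi : i ∈ innerIndices A Λ ε (F k))
    (hne : (tile A ε i ∩ D).Nonempty) :
    ∫ x in tile A ε i, correctorDensity s (fun p => z p.2.1 p.2.2) (fun p => T p.1) R x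
      = N k * (plateauConst (T k) * (R⁻¹ ^ 2 * (R ^ d * sphereArea d))) := by
  classical
  simp only [correctorDensity]
  rw [integral_finsetSum _ fun p _ => (integral_term hd hR _ _).1.integrableOn]
  have hterm : ∀ p ∈ s, ∫ x in tile A ε i, plateauConst (T p.1) * (R⁻¹ ^ 2 *
      fluxDensity d (R⁻¹ • (x - z p.2.1 p.2.2)))
      = if p.2.1 = i then plateauConst (T k) * (R⁻¹ ^ 2 * (R ^ d * sphereArea d)) else 0 := by
    rintro ⟨k', i', j⟩ hp
    obtain ⟨hi', hj, hne'⟩ := (hs _).1 hp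
    simp only at hi' hj hne' ⊢
    split_ifs with h
    · subst h
      have hk : k' = k := eq_of_tile_subset hFd (hne.mono inter_subset_left) hi'.2 hi.2
      subst hk
      rw [setIntegral_eq_integral_of_forall_compl_eq_zero fun x hx => term_eq_zero hd hR
        (fun h => hx (hz.ball_subset _ _ hi' _ hj h)) _, (integral_term hd hR _ _).2]
    · refine setIntegral_eq_zero_of_forall_eq_zero fun x hx => term_eq_zero hd hR (fun hb => ?_) _
      exact Set.disjoint_left.1 (disjoint_tile hdisj hε hi'.1 hi.1 h)
        (hz.ball_subset _ _ hi' _ hj hb) hx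
  rw [Finset.sum_congr rfl hterm, ← Finset.sum_filter, Finset.sum_const, nsmul_eq_mul]
  congr 2
  -- Exactly the `N k` holes of the tile `i` survive, each with its whole ball inside the tile.
  have : s.filter (fun p => p.2.1 = i) = (Finset.range (N k)).image fun j => (k, i, j) := by
    ext ⟨k', i', j⟩
    simp only [Finset.mem_filter, hs, Finset.mem_image, Finset.mem_range, Prod.mk.injEq]
    constructor
    · rintro ⟨⟨hi', hj, -⟩, rfl⟩
      have hk : k' = k := eq_of_tile_subset hFd (hne.mono inter_subset_left) hi'.2 hi.2
      subst hk
      exact ⟨j, hj, rfl, rfl, rfl⟩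
    · rintro ⟨j', hj', rfl, rfl, rfl⟩
      exact ⟨⟨hi, hj', hne⟩, rfl⟩
  rw [this, Finset.card_image_of_injective _ (fun a b h => by simpa using h), Finset.card_range]

/-- The density is carried by the sets `F k`. -/
lemma exists_mem_of_correctorDensity_ne_zero (hd : 2 ≤ d) (hR : 0 < R)
    (hz : IsPerforation A Λ F N ε R z) (hs : ∀ p, p ∈ s ↔ p ∈ holeIndices A Λ F N ε D)
    {x : Eucl d} (hx : correctorDensity s (fun p => z p.2.1 p.2.2) (fun p => T p.1) R x ≠ 0) :
    ∃ k, x ∈ F k := by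
  by_contra hcon
  push Not at hcon
  refine hx (Finset.sum_eq_zero fun p hp => term_eq_zero hd hR (fun hb => ?_) _)
  obtain ⟨hi, hj, -⟩ := (hs p).1 hp
  exact hcon p.1 (hi.2 (hz.ball_subset _ _ hi _ hj hb))

/-- The mean of the density over a tile contained in `F k`. -/
noncomputable def meanDensity (d : ℕ) (A : Set (Eucl d)) (n : ℕ) (ε R T : ℝ) : ℝ :=
  n * (plateauConst T * (R⁻¹ ^ 2 * (R ^ d * sphereArea d))) /
    (ε ^ d * (volume : Measure (Eucl d)).real A)

lemma volume_real_tile (hε : 0 < ε) (i : Eucl d) :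
    (volume : Measure (Eucl d)).real (tile A ε i) = ε ^ d * (volume : Measure (Eucl d)).real A := by
  rw [measureReal_def, volume_tile hε, ENNReal.toReal_mul, ENNReal.toReal_ofReal (by positivity),
    measureReal_def]

/-- Density minus mean integrates to zero over each tile inside `E ∩ F k`. All holes of such a tile
are counted, because the tile meets `D` through `E ⊆ D`. -/
lemma abs_setIntegral_correctorDensity_sub_le (hd : 2 ≤ d)
    (hFd : Pairwise fun k l => Disjoint (F k) (F l)) (hA : NullMeasurableSet A volume)
    (hA0 : volume A ≠ 0) (hΛ : Λ.Countable)
    (hcover : (⋃ i ∈ Λ, (fun y => y + i) '' A) = univ)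
    (hdisj : Λ.PairwiseDisjoint fun i => (fun y => y + i) '' A) (hAρ : A ⊆ Metric.ball 0 ρ)
    (hε : 0 < ε) (hR : 0 < R) (hz : IsPerforation A Λ F N ε R z)
    (hs : ∀ p, p ∈ s ↔ p ∈ holeIndices A Λ F N ε D) {E : Set (Eucl d)} (hED : E ⊆ D)
    (hE : Bornology.IsBounded E) (k : Fin m) (hEF : NullMeasurableSet (E ∩ F k) volume) {M M' : ℝ}
    (hM : ∀ x, |correctorDensity s (fun p => z p.2.1 p.2.2) (fun p => T p.1) R x| ≤ M)
    (hM' : |meanDensity d A (N k) ε R (T k)| ≤ M') :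
    |∫ x in E ∩ F k, (correctorDensity s (fun p => z p.2.1 p.2.2) (fun p => T p.1) R x
        - meanDensity d A (N k) ε R (T k))|
      ≤ (M + M') * (volume : Measure (Eucl d)).real
        (Metric.cthickening (2 * ρ * ε) (frontier (E ∩ F k))) := by
  have hAfin : volume A ≠ ⊤ := (Metric.isBounded_ball.subset hAρ).measure_lt_top.ne
  have hApos : 0 < (volume : Measure (Eucl d)).real A := ENNReal.toReal_pos hA0 hAfin
  have hAne : A.Nonempty := nonempty_of_measure_ne_zero hA0
  refine abs_setIntegral_le_of_tiles hA hΛ hcover hdisj hAρ hε (hE.subset inter_subset_left) hEF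
    (measurable_correctorDensity.sub_const _)
    (fun x => (abs_sub _ _).trans (add_le_add (hM x) hM')) fun i hi hsub => ?_
  have htne : (tile A ε i).Nonempty := hAne.image _
  have hne : (tile A ε i ∩ D).Nonempty := by
    rw [inter_eq_left.2 (hsub.trans (inter_subset_left.trans hED))]
    exact htne
  have htfin : volume (tile A ε i) ≠ ⊤ := by
    rw [volume_tile hε]; exact ENNReal.mul_ne_top ENNReal.ofReal_ne_top hAfin
  have hint : IntegrableOn (correctorDensity s (fun p => z p.2.1 p.2.2) (fun p => T p.1) R)
      (tile A ε i) volume := by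
    unfold correctorDensity
    exact integrable_finsetSum _ fun p _ => (integral_term hd hR _ _).1.integrableOn
  rw [integral_sub hint (integrableOn_const htfin),
    setIntegral_tile_correctorDensity hd hFd hdisj hε hR hz hs ⟨hi, hsub.trans inter_subset_right⟩
      hne, setIntegral_const, volume_real_tile hε, meanDensity, smul_eq_mul]
  have : ε ^ d * (volume : Measure (Eucl d)).real A ≠ 0 := by positivity
  rw [mul_div_cancel₀ _ this, sub_self]

end indices

/-! ### Asymptotics at the critical scale -/

section asymptotics

variable {d : ℕ} {C μ : ℝ} {a : ℝ → ℝ}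

lemma tendsto_plateauConst_mul_self : Tendsto (fun T => plateauConst T * T) atTop (𝓝 1) := by
  have h1 : Tendsto (fun T : ℝ => (plateauConst T)⁻¹ / T) atTop (𝓝 1) := by
    have h2 : Tendsto (fun T : ℝ => 1 - 4 * T⁻¹) atTop (𝓝 1) := by
      simpa using (tendsto_const_nhds (x := (1:ℝ))).sub (tendsto_inv_atTop_zero.const_mul 4)
    refine tendsto_of_tendsto_of_tendsto_of_le_of_le' h2 tendsto_const_nhds ?_ ?_
    · filter_upwards [eventually_gt_atTop 4] with T hT
      have h3 := plateauConst_inv_ge hT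
      have hT0 : 0 < T := by linarith
      rw [le_div_iff₀ hT0]
      have : (1 - 4 * T⁻¹) * T = T - 4 := by field_simp
      linarith
    · filter_upwards [eventually_gt_atTop 4] with T hT
      rw [div_le_one (by linarith)]
      exact plateauConst_inv_le hT
  have h2 := h1.inv₀ one_ne_zero
  rw [inv_one] at h2
  refine h2.congr fun T => ?_
  rw [inv_div, div_inv_eq_mul, mul_comm]

/-- The dimensional factor in `muConst`. -/
noncomputable def dimFactor (d : ℕ) : ℝ := if d = 2 then 1 else (d : ℝ) - 2

lemma dimFactor_pos (hd : 2 ≤ d) : 0 < dimFactor d := by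
  unfold dimFactor
  split_ifs with h
  · exact one_pos
  · have : (3 : ℝ) ≤ d := by exact_mod_cast (show 3 ≤ d by omega)
    linarith

lemma capScale_pos {r : ℝ} (hr : 0 < r) (h2 : d = 2 → r < 1) : 0 < capScale d r := by
  unfold capScale
  split_ifs with h
  · exact inv_pos.2 (neg_pos.2 (Real.log_neg hr (h2 h)))
  · positivity

lemma tendsto_sq_mul_log (hC : 0 < C) :
    Tendsto (fun ε : ℝ => ε ^ 2 * Real.log (C * ε)) (𝓝[>] 0) (𝓝 0) := by
  have h1 : Tendsto (fun ε : ℝ => Real.log ε * ε ^ (2:ℝ)) (𝓝[>] 0) (𝓝 0) :=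
    tendsto_log_mul_rpow_nhdsGT_zero (by norm_num)
  have h2 : Tendsto (fun ε : ℝ => ε ^ 2 * Real.log C) (𝓝[>] 0) (𝓝 0) := by
    have : Tendsto (fun ε : ℝ => ε ^ 2 * Real.log C) (𝓝 0) (𝓝 (0 ^ 2 * Real.log C)) :=
      ((continuous_pow 2).mul continuous_const).tendsto 0
    simp only [ne_eq, OfNat.ofNat_ne_zero, not_false_eq_true, zero_pow, zero_mul] at this
    exact this.mono_left nhdsWithin_le_nhds
  have h3 := h2.add h1
  rw [add_zero] at h3
  refine h3.congr' ?_
  filter_upwards [self_mem_nhdsWithin] with ε hε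
  have hε' : 0 < ε := hε
  rw [Real.log_mul hC.ne' hε'.ne', Real.rpow_two]
  ring

/-- The capacity scale is of order at most `ε^d`, and division by `(Cε)^(d-2)` leaves a factor `ε²`.
Thus holes are negligible compared with their balls. -/
lemma tendsto_capScale_mul (hd : 2 ≤ d)
    (hcrit : Tendsto (fun ε : ℝ => (ε ^ d)⁻¹ * capScale d (a ε)) (𝓝[>] 0) (𝓝 μ)) :
    Tendsto (fun ε : ℝ => capScale d (a ε) * ((C * ε) ^ (d - 2))⁻¹) (𝓝[>] 0) (𝓝 0) := by
  have h1 : Tendsto (fun ε : ℝ => ε ^ 2 * (C ^ (d - 2))⁻¹) (𝓝[>] 0) (𝓝 0) := by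
    have : Tendsto (fun ε : ℝ => ε ^ 2 * (C ^ (d - 2))⁻¹) (𝓝 0) (𝓝 (0 ^ 2 * (C ^ (d - 2))⁻¹)) :=
      ((continuous_pow 2).mul continuous_const).tendsto 0
    simp only [ne_eq, OfNat.ofNat_ne_zero, not_false_eq_true, zero_pow, zero_mul] at this
    exact this.mono_left nhdsWithin_le_nhds
  have h2 := hcrit.mul h1
  rw [mul_zero] at h2
  refine h2.congr' ?_
  filter_upwards [self_mem_nhdsWithin] with ε hε
  have hε' : 0 < ε := hε
  obtain ⟨n, rfl⟩ : ∃ n, d = n + 2 := ⟨d - 2, by omega⟩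
  simp only [Nat.add_sub_cancel, mul_pow, mul_inv]
  field_simp
  ring

/-- With `R = Cε`: for `d = 2` the product is `1 + log R / (-log a)`, whose second term behaves like
`μ ε² log R`; for `d ≥ 3` it is `(1 - a^(d-2) R^(-(d-2))) / (d - 2)`. -/
lemma tendsto_fundSol_mul_capScale (hd : 2 ≤ d) (hC : 0 < C)
    (ha : ∀ᶠ ε in 𝓝[>] (0:ℝ), 0 < a ε) (ha2 : d = 2 → ∀ᶠ ε in 𝓝[>] (0:ℝ), a ε < 1)
    (hcrit : Tendsto (fun ε : ℝ => (ε ^ d)⁻¹ * capScale d (a ε)) (𝓝[>] 0) (𝓝 μ)) :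
    Tendsto (fun ε : ℝ => fundSol d (a ε / (C * ε)) *
      (capScale d (a ε) * ((C * ε) ^ (d - 2))⁻¹)) (𝓝[>] 0) (𝓝 (dimFactor d)⁻¹) := by
  rcases eq_or_ne d 2 with rfl | h2
  · have h1 := hcrit.mul (tendsto_sq_mul_log hC)
    have h3 := (tendsto_const_nhds (x := (1:ℝ))).add h1
    rw [mul_zero, add_zero] at h3
    simp only [dimFactor, if_true, inv_one]
    refine h3.congr' ?_
    filter_upwards [self_mem_nhdsWithin, ha, ha2 rfl] with ε hε h0 h1
    have hε' : 0 < ε := hε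
    have hlog : Real.log (a ε) < 0 := Real.log_neg h0 h1
    simp only [fundSol, capScale, if_true, Nat.sub_self, pow_zero, inv_one, mul_one]
    rw [Real.log_div h0.ne' (by positivity)]
    have : Real.log (a ε) ≠ 0 := hlog.ne
    field_simp
    ring
  · have h1 := tendsto_capScale_mul (C := C) hd hcrit
    have h3 := ((tendsto_const_nhds (x := (1:ℝ))).sub h1).div_const ((d:ℝ) - 2)
    rw [sub_zero, one_div] at h3
    simp only [dimFactor, h2, if_false]
    refine h3.congr' ?_
    filter_upwards [self_mem_nhdsWithin, ha] with ε hε h0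
    have hε' : 0 < ε := hε
    simp only [fundSol, capScale, h2, if_false, div_pow]
    have h4 : a ε ^ (d - 2) ≠ 0 := by positivity
    have h5 : (C * ε) ^ (d - 2) ≠ 0 := by positivity
    have h6 : (d:ℝ) - 2 ≠ 0 := by
      have := dimFactor_pos hd
      simp only [dimFactor, h2, if_false] at this
      exact this.ne'
    field_simp

lemma tendsto_fundSol_radius (hd : 2 ≤ d) (hC : 0 < C)
    (ha : ∀ᶠ ε in 𝓝[>] (0:ℝ), 0 < a ε) (ha2 : d = 2 → ∀ᶠ ε in 𝓝[>] (0:ℝ), a ε < 1)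
    (hcrit : Tendsto (fun ε : ℝ => (ε ^ d)⁻¹ * capScale d (a ε)) (𝓝[>] 0) (𝓝 μ)) :
    Tendsto (fun ε : ℝ => fundSol d (a ε / (C * ε))) (𝓝[>] 0) atTop := by
  have hpos : ∀ᶠ ε in 𝓝[>] (0:ℝ), 0 < capScale d (a ε) * ((C * ε) ^ (d - 2))⁻¹ := by
    by_cases h2 : d = 2
    · filter_upwards [self_mem_nhdsWithin, ha, ha2 h2] with ε hε h0 h1
      have hε' : 0 < ε := hε
      have := capScale_pos (d := d) h0 fun _ => h1
      positivity
    · filter_upwards [self_mem_nhdsWithin, ha] with ε hε h0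
      have hε' : 0 < ε := hε
      have := capScale_pos (d := d) h0 fun h => absurd h h2
      positivity
  have h1 : Tendsto (fun ε : ℝ => (capScale d (a ε) * ((C * ε) ^ (d - 2))⁻¹)⁻¹) (𝓝[>] 0) atTop :=
    Tendsto.inv_tendsto_nhdsGT_zero
      (tendsto_nhdsWithin_iff.2 ⟨tendsto_capScale_mul hd hcrit, hpos⟩)
  have h2 := (tendsto_fundSol_mul_capScale hd hC ha ha2 hcrit).pos_mul_atTop
    (inv_pos.2 (dimFactor_pos hd)) h1
  refine h2.congr' ?_
  filter_upwards [hpos] with ε hε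
  rw [mul_inv_cancel_right₀ hε.ne']

/-- Since `plateauConst T` is asymptotic to `1 / T`, the quantity `plateauConst T * R^(d-2)` follows
`dimFactor d` times the capacity scale. Times `S_d`, it is the mass one hole adds to the density. -/
lemma tendsto_plateauConst_mul (hd : 2 ≤ d) (hC : 0 < C)
    (ha : ∀ᶠ ε in 𝓝[>] (0:ℝ), 0 < a ε) (ha2 : d = 2 → ∀ᶠ ε in 𝓝[>] (0:ℝ), a ε < 1)
    (hcrit : Tendsto (fun ε : ℝ => (ε ^ d)⁻¹ * capScale d (a ε)) (𝓝[>] 0) (𝓝 μ)) :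
    Tendsto (fun ε : ℝ => plateauConst (fundSol d (a ε / (C * ε))) * (C * ε) ^ (d - 2) *
      (ε ^ d)⁻¹) (𝓝[>] 0) (𝓝 (dimFactor d * μ)) := by
  have hT := tendsto_fundSol_radius hd hC ha ha2 hcrit
  have h1 := tendsto_plateauConst_mul_self.comp hT
  have h2 := (tendsto_fundSol_mul_capScale hd hC ha ha2 hcrit).inv₀
    (inv_ne_zero (dimFactor_pos hd).ne')
  rw [inv_inv] at h2
  have h3 := (h1.mul h2).mul hcrit
  rw [one_mul] at h3
  have hpos : ∀ᶠ ε in 𝓝[>] (0:ℝ), 0 < capScale d (a ε) := by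
    by_cases h2 : d = 2
    · filter_upwards [ha, ha2 h2] with ε h0 h1
      exact capScale_pos (d := d) h0 fun _ => h1
    · filter_upwards [ha] with ε h0
      exact capScale_pos (d := d) h0 fun h => absurd h h2
  refine h3.congr' ?_
  filter_upwards [self_mem_nhdsWithin, hpos, hT.eventually_gt_atTop 0] with ε hε h4 h5
  have hε' : 0 < ε := hε
  have h6 : (C * ε) ^ (d - 2) ≠ 0 := by positivity
  simp only [Function.comp]
  field_simp

/-- This is the height of the density in a ball; its convergence keeps the densities bounded
uniformly in `ε`. -/
lemma tendsto_plateauConst_div_sq (hd : 2 ≤ d) (hC : 0 < C)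
    (ha : ∀ᶠ ε in 𝓝[>] (0:ℝ), 0 < a ε) (ha2 : d = 2 → ∀ᶠ ε in 𝓝[>] (0:ℝ), a ε < 1)
    (hcrit : Tendsto (fun ε : ℝ => (ε ^ d)⁻¹ * capScale d (a ε)) (𝓝[>] 0) (𝓝 μ)) :
    Tendsto (fun ε : ℝ => plateauConst (fundSol d (a ε / (C * ε))) * (C * ε)⁻¹ ^ 2) (𝓝[>] 0)
      (𝓝 (dimFactor d * μ * (C ^ d)⁻¹)) := by
  refine ((tendsto_plateauConst_mul hd hC ha ha2 hcrit).mul_const (C ^ d)⁻¹).congr' ?_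
  filter_upwards [self_mem_nhdsWithin] with ε hε
  have hε' : 0 < ε := hε
  obtain ⟨n, rfl⟩ : ∃ n, d = n + 2 := ⟨d - 2, by omega⟩
  simp only [Nat.add_sub_cancel]
  field_simp
  ring

lemma tendsto_meanDensity (hd : 2 ≤ d) (hC : 0 < C)
    (ha : ∀ᶠ ε in 𝓝[>] (0:ℝ), 0 < a ε) (ha2 : d = 2 → ∀ᶠ ε in 𝓝[>] (0:ℝ), a ε < 1)
    (hcrit : Tendsto (fun ε : ℝ => (ε ^ d)⁻¹ * capScale d (a ε)) (𝓝[>] 0) (𝓝 μ))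
    (A : Set (Eucl d)) (n : ℕ) :
    Tendsto (fun ε : ℝ => meanDensity d A n ε (C * ε) (fundSol d (a ε / (C * ε)))) (𝓝[>] 0)
      (𝓝 (muConst d A * (μ * n))) := by
  have h := (tendsto_plateauConst_mul hd hC ha ha2 hcrit).const_mul
    (n * (sphereArea d / (volume : Measure (Eucl d)).real A))
  have e : n * (sphereArea d / (volume : Measure (Eucl d)).real A) * (dimFactor d * μ)
      = muConst d A * (μ * n) := by
    rw [muConst, dimFactor]; ring
  rw [e] at h
  refine h.congr' ?_
  filter_upwards [self_mem_nhdsWithin] with ε hε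
  have hε' : 0 < ε := hε
  have h2 : (C * ε) ^ d = (C * ε) ^ (d - 2) * (C * ε) ^ 2 := by
    rw [← pow_add]; congr 1; omega
  have h3 : (C * ε)⁻¹ ^ 2 * ((C * ε) ^ d * sphereArea d) = (C * ε) ^ (d - 2) * sphereArea d := by
    rw [h2]; field_simp
  rw [meanDensity, h3, div_eq_mul_inv, div_eq_mul_inv, mul_inv]
  ring

end asymptotics

/-! ### Oscillating test functions and passage to the limit -/

section oscillating

variable {d : ℕ} {Ω U : Set (Eucl d)} {V f φ g w : Eucl d → ℝ}

lemma contDiff_gradient {n : ℕ∞} (hφ : ContDiff ℝ ∞ φ) : ContDiff ℝ n (∇ φ) := by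
  have h1 : ContDiff ℝ n (fderiv ℝ φ) := hφ.fderiv_right (by exact_mod_cast le_top)
  exact (InnerProductSpace.toDual ℝ (Eucl d)).symm.toContinuousLinearEquiv.contDiff.comp h1

lemma divergence_smul {X : Eucl d → Eucl d} {x : Eucl d} (hg : DifferentiableAt ℝ g x)
    (hX : DifferentiableAt ℝ X x) :
    divergence (fun y => g y • X y) x = inner ℝ (∇ g x) (X x) + g x * divergence X x := by
  rw [inner_gradient_eq_sum, divergence, divergence, fderiv_fun_smul hg hX, Finset.mul_sum,
    ← Finset.sum_add_distrib]
  refine Finset.sum_congr rfl fun i _ => ?_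
  simp [add_comm]

lemma continuous_divergence_gradient (hφ : ContDiff ℝ ∞ φ) : Continuous (divergence (∇ φ)) := by
  have h := (contDiff_gradient hφ (n := 1)).continuous_fderiv (by simp)
  unfold divergence
  refine continuous_finsetSum _ fun i _ => ?_
  exact (EuclideanSpace.proj (𝕜 := ℝ) i).continuous.comp (h.clm_apply continuous_const)

/-- The Laplacian of a test function is bounded. -/
lemma IsTestFun.exists_bound_divergence (hφ : IsTestFun Ω φ) :
    ∃ K, 0 ≤ K ∧ ∀ x, |divergence (∇ φ) x| ≤ K := by
  have hc : HasCompactSupport (divergence (∇ φ)) := by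
    refine HasCompactSupport.intro hφ.compact fun x hx => ?_
    have h0 : fderiv ℝ (∇ φ) x = 0 := image_eq_zero_of_notMem_tsupport fun h =>
      hx (tsupport_gradient_subset φ (tsupport_fderiv_subset ℝ h))
    simp [divergence, h0]
  obtain ⟨K, hK⟩ := hc.exists_bound_of_continuous (continuous_divergence_gradient hφ.smooth)
  exact ⟨K, (norm_nonneg _).trans (hK 0), hK⟩

/-- Insertion of a product `φ w` into the weak formulation, for `w` close to one. -/
lemma abs_integral_inner_gradient_mul_sub_le (hφ : IsTestFun Ω φ) (hg : IsTestFun U g)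
    (hw : ContDiff ℝ ∞ w) (hwc : HasCompactSupport fun x => w x - 1) {K : ℝ} (hK : 0 ≤ K)
    (h1 : ∀ x, |φ x| ≤ K) (h2 : ∀ x, ‖∇ φ x‖ ≤ K) (h3 : ∀ x, |divergence (∇ φ) x| ≤ K)
    {I η : ℝ} (hη : 0 ≤ η)
    (hI : |(∫ x, inner ℝ (∇ (fun y => g y * φ y) x) (∇ w x)) - I|
      ≤ η * (normL2 (fun y => g y * φ y) + normL2 (∇ fun y => g y * φ y))) :
    |(∫ x, inner ℝ (∇ g x) (∇ (fun y => φ y * w y) x)) - (∫ x, inner ℝ (∇ g x) (∇ φ x)) - I|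
      ≤ 2 * K * (η + normL2 fun x => w x - 1) * (normL2 g + normL2 (∇ g)) := by
  have hwm : MemLp (fun x => w x - 1) 2 volume :=
    (hw.continuous.sub continuous_const).memLp_of_hasCompactSupport hwc
  have hdφ : Differentiable ℝ φ := hφ.smooth.differentiable (by simp)
  have hdg : Differentiable ℝ g := hg.smooth.differentiable (by simp)
  have hdw : Differentiable ℝ w := hw.differentiable (by simp)
  have hgφ : IsTestFun U fun y => g y * φ y := hg.mul_smooth hφ.smooth
  have hcg := continuous_gradient hg.contDiff_one
  have hcφ := continuous_gradient hφ.contDiff_one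
  have hcw := continuous_gradient (hw.of_le (by exact_mod_cast le_top) : ContDiff ℝ 1 w)
  have hcd := continuous_divergence_gradient hφ.smooth
  have hw1 : ∀ x, ∇ (fun x => w x - 1) x = ∇ w x := fun x => by
    simp [gradient, fderiv_sub_const]
  -- the remainder
  set Z : Eucl d → ℝ := fun x => 2 * inner ℝ (∇ g x) (∇ φ x) + g x * divergence (∇ φ) x with hZ
  have hZc : Continuous Z := by
    exact ((hcg.inner hcφ).const_mul 2).add (hg.continuous.mul hcd)
  have hZs : ∀ x, x ∉ tsupport g → Z x = 0 := fun x hx => by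
    simp only [hZ]
    rw [gradient_eq_zero_of_notMem_tsupport hx, image_eq_zero_of_notMem_tsupport hx]
    simp
  have hZm : MemLp Z 2 volume :=
    hZc.memLp_of_hasCompactSupport (HasCompactSupport.intro hg.compact hZs)
  have hZn : normL2 Z ≤ 2 * K * (normL2 g + normL2 (∇ g)) := by
    have e : Z = (fun x => 2 * inner ℝ (∇ g x) (∇ φ x)) + fun x => g x * divergence (∇ φ) x := rfl
    have m1 : MemLp (fun x => 2 * inner ℝ (∇ g x) (∇ φ x)) 2 volume :=
      ((hcg.inner hcφ).const_mul 2).memLp_of_hasCompactSupport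
        (HasCompactSupport.intro hg.compact fun x hx => by
          rw [gradient_eq_zero_of_notMem_tsupport hx]; simp)
    have m2 : MemLp (fun x => g x * divergence (∇ φ) x) 2 volume :=
      (hg.continuous.mul hcd).memLp_of_hasCompactSupport hg.compact.mul_right
    have b1 : normL2 (fun x => 2 * inner ℝ (∇ g x) (∇ φ x)) ≤ 2 * K * normL2 (∇ g) := by
      refine normL2_le_of_le hg.memLp_gradient (by positivity) fun x => ?_
      rw [norm_mul, Real.norm_ofNat, mul_assoc, mul_comm K]
      refine mul_le_mul_of_nonneg_left ?_ zero_le_two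
      exact (abs_real_inner_le_norm _ _).trans (mul_le_mul_of_nonneg_left (h2 x) (norm_nonneg _))
    have b2 : normL2 (fun x => g x * divergence (∇ φ) x) ≤ K * normL2 g := by
      refine normL2_le_of_le hg.memLp hK fun x => ?_
      rw [norm_mul, mul_comm]
      exact mul_le_mul_of_nonneg_right (h3 x) (norm_nonneg _)
    have := normL2_add_le m1 m2
    rw [← e] at this
    have := mul_nonneg hK (normL2_nonneg g)
    linarith
  have hn1 : normL2 (fun y => g y * φ y) ≤ K * normL2 g := by
    refine normL2_le_of_le hg.memLp hK fun x => ?_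
    rw [norm_mul, mul_comm]
    exact mul_le_mul_of_nonneg_right (h1 x) (norm_nonneg _)
  have hn2 : normL2 (∇ fun y => g y * φ y) ≤ K * normL2 g + K * normL2 (∇ g) := by
    have e : (∇ fun y => g y * φ y) = (fun x => g x • ∇ φ x) + fun x => φ x • ∇ g x := by
      funext x; exact gradient_mul (hdg x) (hdφ x)
    have m1 : MemLp (fun x => g x • ∇ φ x) 2 volume :=
      (hg.continuous.smul hcφ).memLp_of_hasCompactSupport hg.compact.smul_right
    have m2 : MemLp (fun x => φ x • ∇ g x) 2 volume :=
      (hφ.continuous.smul hcg).memLp_of_hasCompactSupport hφ.compact.smul_right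
    rw [e]
    refine (normL2_add_le m1 m2).trans (add_le_add ?_ ?_)
    · refine normL2_le_of_le hg.memLp hK fun x => ?_
      rw [norm_smul, mul_comm]
      exact mul_le_mul_of_nonneg_right (h2 x) (norm_nonneg _)
    · refine normL2_le_of_le hg.memLp_gradient hK fun x => ?_
      rw [norm_smul]
      exact mul_le_mul_of_nonneg_right (h1 x) (norm_nonneg _)
  -- integration by parts
  have hibp : ∫ x, inner ℝ (∇ w x) (g x • ∇ φ x)
      = -∫ x, (w x - 1) * (inner ℝ (∇ g x) (∇ φ x) + g x * divergence (∇ φ) x) := by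
    have h := integral_inner_gradient_eq_neg_integral_divergence
      (ψ := fun x => w x - 1) (X := fun x => g x • ∇ φ x)
      ((hw.sub contDiff_const).of_le (by exact_mod_cast le_top)) hwc fun x _ =>
        (hg.contDiff_one.smul (contDiff_gradient hφ.smooth (n := 1))).contDiffAt
    simp_rw [hw1] at h
    rw [h]
    congr 2 with x
    rw [divergence_smul (hdg x)
      (((contDiff_gradient hφ.smooth (n := 1)).differentiable (by simp)) x)]
  have i1 : Integrable fun x => inner ℝ (∇ (fun y => g y * φ y) x) (∇ w x) :=
    integrable_inner_gradient hgφ.contDiff_one hgφ.compact fun x _ => hcw.continuousAt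
  have i2 : Integrable fun x => inner ℝ (∇ w x) (g x • ∇ φ x) := by
    refine (hcw.inner (hg.continuous.smul hcφ)).integrable_of_hasCompactSupport
      (HasCompactSupport.intro hg.compact fun x hx => ?_)
    rw [image_eq_zero_of_notMem_tsupport hx]; simp
  have i3 : Integrable fun x => (w x - 1) * inner ℝ (∇ g x) (∇ φ x) := by
    refine ((hw.continuous.sub continuous_const).mul
      (hcg.inner hcφ)).integrable_of_hasCompactSupport
      (HasCompactSupport.intro hg.compact fun x hx => ?_)
    simp only [Pi.mul_apply]
    rw [gradient_eq_zero_of_notMem_tsupport hx]; simp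
  have i4 : Integrable fun x => (w x - 1) * (g x * divergence (∇ φ) x) := by
    refine ((hw.continuous.sub continuous_const).mul
      (hg.continuous.mul hcd)).integrable_of_hasCompactSupport
      (HasCompactSupport.intro hg.compact fun x hx => ?_)
    simp only [Pi.mul_apply]
    rw [image_eq_zero_of_notMem_tsupport hx]; simp
  have i5 : Integrable fun x => inner ℝ (∇ g x) (∇ φ x) :=
    integrable_inner_gradient hg.contDiff_one hg.compact fun x _ => hcφ.continuousAt
  -- Write `φ ∇g · ∇w = ∇(g φ) · ∇w - g ∇φ · ∇w` and move the derivative in the last term off `w`.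
  -- All that remains beside `∇(g φ) · ∇w` then carries the factor `w - 1`, small in `L²`.
  have hsplit : (∫ x, inner ℝ (∇ g x) (∇ (fun y => φ y * w y) x))
        - (∫ x, inner ℝ (∇ g x) (∇ φ x))
      = (∫ x, inner ℝ (∇ (fun y => g y * φ y) x) (∇ w x)) + ∫ x, (w x - 1) * Z x := by
    have e1 : ∀ x, inner ℝ (∇ g x) (∇ (fun y => φ y * w y) x)
        = inner ℝ (∇ g x) (∇ φ x) + (inner ℝ (∇ (fun y => g y * φ y) x) (∇ w x)
          - inner ℝ (∇ w x) (g x • ∇ φ x) + (w x - 1) * inner ℝ (∇ g x) (∇ φ x)) := by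
      intro x
      rw [gradient_mul (hdφ x) (hdw x), gradient_mul (hdg x) (hdφ x)]
      simp only [inner_add_left, inner_add_right, real_inner_smul_left, real_inner_smul_right,
        real_inner_comm (∇ φ x) (∇ w x)]
      ring
    have e2 : ∀ x, (w x - 1) * Z x = (w x - 1) * inner ℝ (∇ g x) (∇ φ x)
        + ((w x - 1) * inner ℝ (∇ g x) (∇ φ x) + (w x - 1) * (g x * divergence (∇ φ) x)) := by
      intro x; simp only [hZ]; ring
    simp_rw [e1, e2]
    have hibp' := hibp
    simp_rw [mul_add] at hibp'
    have i6 : Integrable fun x => inner ℝ (∇ (fun y => g y * φ y) x) (∇ w x)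
        - inner ℝ (∇ w x) (g x • ∇ φ x) := i1.sub i2
    have i7 : Integrable fun x => inner ℝ (∇ (fun y => g y * φ y) x) (∇ w x)
        - inner ℝ (∇ w x) (g x • ∇ φ x) + (w x - 1) * inner ℝ (∇ g x) (∇ φ x) := i6.add i3
    have i8 : Integrable fun x => (w x - 1) * inner ℝ (∇ g x) (∇ φ x)
        + (w x - 1) * (g x * divergence (∇ φ) x) := i3.add i4
    rw [integral_add i5 i7, integral_add i6 i3, integral_sub i1 i2, integral_add i3 i8, hibp']
    ring
  rw [hsplit]
  have hC := abs_integral_mul_le_normL2 hwm hZm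
  have hC2 := hC.trans (mul_le_mul_of_nonneg_left hZn (normL2_nonneg _))
  have h5 : η * (normL2 (fun y => g y * φ y) + normL2 (∇ fun y => g y * φ y))
      ≤ η * (2 * K * (normL2 g + normL2 (∇ g))) := by
    refine mul_le_mul_of_nonneg_left ?_ hη
    have := mul_nonneg hK (normL2_nonneg (∇ g))
    linarith
  rw [add_sub_right_comm]
  refine (abs_add_le _ _).trans ((add_le_add (hI.trans h5) hC2).trans (le_of_eq ?_))
  ring

/-- A family `w i` of oscillating test functions adapted to the perforated domains `U i`, with
limit potential `V`. -/
structure IsCorrectorFamily {d : ℕ} {ι : Type*} (l : Filter ι) (Ω : Set (Eucl d))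
    (U : ι → Set (Eucl d)) (V : Eucl d → ℝ) (w : ι → Eucl d → ℝ) : Prop where
  smooth : ∀ᶠ i in l, ContDiff ℝ ∞ (w i)
  compact : ∀ᶠ i in l, HasCompactSupport fun x => w i x - 1
  isTestFun : ∀ᶠ i in l, ∀ φ : Eucl d → ℝ, IsTestFun Ω φ → IsTestFun (U i) fun x => φ x * w i x
  tendsto : Tendsto (fun i => normL2 fun x => w i x - 1) l (𝓝 0)
  laplacian : ∀ η : ℝ, 0 < η → ∀ᶠ i in l, ∀ g : Eucl d → ℝ, IsTestFun (U i) g →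
    |(∫ x, inner ℝ (∇ g x) (∇ (w i) x)) - ∫ x, V x * g x| ≤ η * (normL2 g + normL2 (∇ g))

lemma isBddPotential_zero : IsBddPotential fun _ : Eucl d => (0 : ℝ) :=
  ⟨aestronglyMeasurable_const, 0, by simp⟩

lemma dirichletForm_pair_pair (hV : IsBddPotential V) (hg : IsTestFun U g) (hφ : IsTestFun Ω φ) :
    dirichletForm hV hg.pair hφ.pair
      = (∫ x, inner ℝ (∇ g x) (∇ φ x)) + ∫ x, V x * (g x * φ x) := by
  rw [dirichletForm_apply_integral]
  congr 1 <;> refine integral_congr_ae ?_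
  · filter_upwards [hφ.pair_snd, hg.pair_snd] with x h1 h2
    rw [h1, h2]
  · filter_upwards [hφ.pair_fst, hg.pair_fst] with x h1 h2
    rw [h1, h2, mul_assoc]

/-- The estimate for test functions is uniform relative to the `H¹` norm, so it passes to the
closure and can be applied to the solution in the perforated domain. -/
lemma abs_dirichletForm_sub_le (hV : IsBddPotential V) (hφ : IsTestFun Ω φ)
    (hφw : IsTestFun U fun x => φ x * w x)
    (hw : ContDiff ℝ ∞ w) (hwc : HasCompactSupport fun x => w x - 1) {K : ℝ} (hK : 0 ≤ K)
    (h1 : ∀ x, |φ x| ≤ K) (h2 : ∀ x, ‖∇ φ x‖ ≤ K) (h3 : ∀ x, |divergence (∇ φ) x| ≤ K)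
    {η : ℝ} (hη : 0 ≤ η)
    (hlap : ∀ g : Eucl d → ℝ, IsTestFun U g →
      |(∫ x, inner ℝ (∇ g x) (∇ w x)) - ∫ x, V x * g x| ≤ η * (normL2 g + normL2 (∇ g)))
    {p : L2Pair d} (hp : p ∈ H10 U) :
    |dirichletForm isBddPotential_zero p hφw.pair - dirichletForm hV p hφ.pair|
      ≤ 2 * K * (η + normL2 fun x => w x - 1) * (‖p.fst‖ + ‖p.snd‖) := by
  refine H10_induction (P := fun p =>
    |dirichletForm isBddPotential_zero p hφw.pair - dirichletForm hV p hφ.pair|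
      ≤ 2 * K * (η + normL2 fun x => w x - 1) * (‖p.fst‖ + ‖p.snd‖)) ?_ (fun g hg => ?_) hp
  · have c1 : Continuous fun p : L2Pair d => p.fst := (WithLp.fstL 2 ℝ _ _).continuous
    have c2 : Continuous fun p : L2Pair d => p.snd := (WithLp.sndL 2 ℝ _ _).continuous
    have c3 : Continuous fun p : L2Pair d => dirichletForm isBddPotential_zero p hφw.pair :=
      (dirichletForm isBddPotential_zero).continuous.clm_apply continuous_const
    have c4 : Continuous fun p : L2Pair d => dirichletForm hV p hφ.pair :=
      (dirichletForm hV).continuous.clm_apply continuous_const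
    exact isClosed_le (c3.sub c4).abs (continuous_const.mul (c1.norm.add c2.norm))
  · rw [dirichletForm_pair_pair, dirichletForm_pair_pair, hg.norm_pair_fst, hg.norm_pair_snd]
    have := abs_integral_inner_gradient_mul_sub_le hφ hg hw hwc hK h1 h2 h3 hη
      (hlap _ (hg.mul_smooth hφ.smooth))
    simpa [sub_sub] using this

/-- The convergence theorem for perforated domains which carry oscillating test functions. -/
theorem IsCorrectorFamily.tendsto_dirichletSolution {ι : Type*} {l : Filter ι}
    {U : ι → Set (Eucl d)} {w : ι → Eucl d → ℝ} (hw : IsCorrectorFamily l Ω U V w) (hd : 0 < d)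
    (hΩ : MeasurableSet Ω) (hΩb : Bornology.IsBounded Ω) (hf : MemLp f 2 (volume.restrict Ω))
    (hU : ∀ i, U i ⊆ Ω) (hV : IsBddPotential V) (h0 : ∀ x, 0 ≤ V x) {u₀ : H10 Ω}
    (hu₀ : IsDirichletSolution Ω V f u₀) {u : ι → H10 Ω}
    (hu : ∀ᶠ i in l, IsDirichletSolution (U i) (fun _ => 0) f (u i)) :
    Tendsto (fun i => toWeakSpace ℝ (H10 Ω) (u i)) l (𝓝 (toWeakSpace ℝ (H10 Ω) u₀)) := by
  obtain ⟨r, hr, hΩr⟩ := hΩb.subset_ball_lt 0 0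
  set B := (1 + (2 * r) ^ 2) * ‖sourceTerm hΩ hf‖ with hB
  have hB0 : 0 ≤ B := by positivity
  have hbound : ∀ᶠ i in l, ‖(u i : L2Pair d)‖ ≤ B := by
    filter_upwards [hu] with i hi
    exact norm_dirichletSolution_le hd hΩ hr hΩr hf (hU i) isBddPotential_zero
      (fun _ => le_rfl) hi
  refine tendsto_weak_of_dirichletForm hd hΩb hV h0 hbound fun φ hφ => ?_
  rw [((isDirichletSolution_iff hΩ hf subset_rfl hV _).1 hu₀).2 _ hφ.pair_mem]
  obtain ⟨K₁, hK₁, h1⟩ := hφ.exists_bound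
  obtain ⟨K₂, hK₂, h2⟩ := hφ.exists_bound_gradient
  obtain ⟨K₃, hK₃, h3⟩ := hφ.exists_bound_divergence
  set K := K₁ + K₂ + K₃ with hKdef
  have hK : 0 ≤ K := by positivity
  set S := ‖sourceTerm hΩ hf‖ with hS
  -- The limit form on `(u i, φ)` is close to the unperturbed form on `(u i, φ w)`, which equals `∫
  -- f φ w` by the equation, which is close to `∫ f φ`.
  have key : ∀ η : ℝ, 0 < η → ∀ᶠ i in l, |dirichletForm hV (u i) hφ.pair
      - inner ℝ (sourceTerm hΩ hf) hφ.pair.fst|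
      ≤ 2 * K * (η + η) * (2 * B) + S * (K * η) := by
    intro η hη
    filter_upwards [hw.smooth, hw.compact, hw.isTestFun, hw.laplacian η hη, hbound, hu,
      hw.tendsto.eventually_le_const hη] with i hs hc ht hl hb hui hn
    have hφw := ht φ hφ
    have hsol := ((isDirichletSolution_iff hΩ hf (hU i) isBddPotential_zero _).1 hui).2 _
      hφw.pair_mem
    have e1 := abs_dirichletForm_sub_le hV hφ hφw hs hc hK
      (fun x => (h1 x).trans (by linarith)) (fun x => (h2 x).trans (by linarith))
      (fun x => (h3 x).trans (by linarith)) hη.le hl hui.1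
    rw [hsol] at e1
    have e2 : ‖hφw.pair.fst - hφ.pair.fst‖ ≤ K * η := by
      have e3 : hφw.pair.fst - hφ.pair.fst
          = (hφw.memLp.sub hφ.memLp).toLp _ := (MemLp.toLp_sub hφw.memLp hφ.memLp).symm
      rw [e3, Lp.norm_toLp]
      have hm : MemLp (fun x => w i x - 1) 2 volume :=
        (hs.continuous.sub continuous_const).memLp_of_hasCompactSupport hc
      refine (normL2_le_of_le (f := (fun x => φ x * w i x) - φ) hm hK fun x => ?_).trans
        (mul_le_mul_of_nonneg_left hn hK)
      have : ((fun x => φ x * w i x) - φ) x = φ x * (w i x - 1) := by simp [mul_sub]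
      rw [this, norm_mul]
      exact mul_le_mul_of_nonneg_right ((h1 x).trans (by linarith)) (norm_nonneg _)
    have e4 : |inner ℝ (sourceTerm hΩ hf) hφw.pair.fst - inner ℝ (sourceTerm hΩ hf) hφ.pair.fst|
        ≤ S * (K * η) := by
      rw [← inner_sub_right]
      exact (abs_real_inner_le_norm _ _).trans (mul_le_mul_of_nonneg_left e2 (norm_nonneg _))
    have e5 : 2 * K * (η + normL2 fun x => w i x - 1)
        * (‖(u i : L2Pair d).fst‖ + ‖(u i : L2Pair d).snd‖) ≤ 2 * K * (η + η) * (2 * B) := by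
      have n1 := WithLp.norm_fst_le _ (u i : L2Pair d)
      have n2 := WithLp.norm_snd_le _ (u i : L2Pair d)
      gcongr
      linarith
    have e6 := e1.trans e5
    rw [abs_le] at e6 e4 ⊢
    constructor <;> linarith [e6.1, e6.2, e4.1, e4.2]
  rw [Metric.tendsto_nhds]
  intro δ hδ
  -- At `η = δ / L` the bound in `key` becomes `(L - 1) δ / L`, strictly below `δ`.
  set L := 2 * K * 2 * (2 * B) + S * K + 1 with hL
  have hLpos : 0 < L := by positivity
  filter_upwards [key (δ / L) (by positivity)] with i hi
  rw [Real.dist_eq]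
  refine hi.trans_lt ?_
  have : 2 * K * (δ / L + δ / L) * (2 * B) + S * (K * (δ / L)) = (L - 1) * (δ / L) := by
    rw [hL]; ring
  rw [this, sub_mul, mul_div_cancel₀ _ hLpos.ne']
  have : 0 < δ / L := by positivity
  linarith

end oscillating

/-! ### Correctors of a critical perforation -/

/-- A family of perforations of critical size, in the regions `F k` of a tiled space. -/
structure IsCriticalPerforation {d m : ℕ} (A Λ : Set (Eucl d)) (F : Fin m → Set (Eucl d))
    (N : Fin m → ℕ) (C ρ : ℝ) (x : ℝ → Eucl d → ℕ → Eucl d) (a : ℝ → Fin m → ℝ)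
    (μt : Fin m → ℝ) : Prop where
  two_le : 2 ≤ d
  frontier_null : ∀ k, volume (frontier (F k)) = 0
  disjoint_regions : Pairwise fun k l => Disjoint (F k) (F l)
  nullMeasurable : NullMeasurableSet A volume
  subset_ball : A ⊆ Metric.ball 0 ρ
  countable : Λ.Countable
  cover : (⋃ i ∈ Λ, (fun y => y + i) '' A) = univ
  disjoint_tiles : Λ.PairwiseDisjoint fun i => (fun y => y + i) '' A
  pos : 0 < C
  volume_ne_zero : ∀ _ : Fin m, volume A ≠ 0
  perforation : ∀ᶠ ε in 𝓝[>] (0 : ℝ), IsPerforation A Λ F N ε (C * ε) (x ε)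
  radius_pos : ∀ k, ∀ᶠ ε in 𝓝[>] (0 : ℝ), 0 < a ε k
  radius_lt_one : ∀ k, d = 2 → ∀ᶠ ε in 𝓝[>] (0 : ℝ), a ε k < 1
  critical : ∀ k, Tendsto (fun ε : ℝ => (ε ^ d)⁻¹ * capScale d (a ε k)) (𝓝[>] 0) (𝓝 (μt k))

/-- The conditions on the scale `ε` under which the corrector is defined. -/
structure IsFineScale {d m : ℕ} (A Λ : Set (Eucl d)) (F : Fin m → Set (Eucl d))
    (N : Fin m → ℕ) (C : ℝ) (x : ℝ → Eucl d → ℕ → Eucl d) (a : ℝ → Fin m → ℝ) (ε : ℝ) :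
    Prop where
  pos : 0 < ε
  le_one : ε ≤ 1
  perforation : IsPerforation A Λ F N ε (C * ε) (x ε)
  radius_pos : ∀ k, 0 < a ε k
  four_lt : ∀ k, 4 < fundSol d (a ε k / (C * ε))

open Classical in
/-- The indices of the holes in the tiles which meet the bounded set `D`. -/
noncomputable def holeFinset {d m : ℕ} (A Λ : Set (Eucl d)) (F : Fin m → Set (Eucl d))
    (N : Fin m → ℕ) (ε : ℝ) (D : Set (Eucl d)) : Finset (Fin m × Eucl d × ℕ) :=
  if h : (holeIndices A Λ F N ε D).Finite then h.toFinset else ∅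

/-- The corrector of the holes in the tiles which meet `D`. -/
noncomputable def holeCorrector {d m : ℕ} (A Λ : Set (Eucl d)) (F : Fin m → Set (Eucl d))
    (N : Fin m → ℕ) (C : ℝ) (x : ℝ → Eucl d → ℕ → Eucl d) (a : ℝ → Fin m → ℝ) (D : Set (Eucl d))
    (ε : ℝ) : Eucl d → ℝ :=
  corrector (holeFinset A Λ F N ε D) (fun p => x ε p.2.1 p.2.2)
    (fun p => fundSol d (a ε p.1 / (C * ε))) (C * ε)

/-- The density of the corrector of the holes in the tiles which meet `D`. -/
noncomputable def holeDensity {d m : ℕ} (A Λ : Set (Eucl d)) (F : Fin m → Set (Eucl d))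
    (N : Fin m → ℕ) (C : ℝ) (x : ℝ → Eucl d → ℕ → Eucl d) (a : ℝ → Fin m → ℝ) (D : Set (Eucl d))
    (ε : ℝ) : Eucl d → ℝ :=
  correctorDensity (holeFinset A Λ F N ε D) (fun p => x ε p.2.1 p.2.2)
    (fun p => fundSol d (a ε p.1 / (C * ε))) (C * ε)

section critical

variable {d m : ℕ} {A Λ : Set (Eucl d)} {F : Fin m → Set (Eucl d)} {N : Fin m → ℕ} {C ρ : ℝ}
  {x : ℝ → Eucl d → ℕ → Eucl d} {a : ℝ → Fin m → ℝ} {μt : Fin m → ℝ} {ε r : ℝ}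
  {D Ω : Set (Eucl d)}

namespace IsCriticalPerforation

lemma eventually_isFineScale (h : IsCriticalPerforation A Λ F N C ρ x a μt) :
    ∀ᶠ ε in 𝓝[>] (0 : ℝ), IsFineScale A Λ F N C x a ε := by
  have h1 : ∀ᶠ ε in 𝓝[>] (0 : ℝ), ε ≤ 1 :=
    nhdsWithin_le_nhds (eventually_le_nhds one_pos)
  have h2 : ∀ᶠ ε in 𝓝[>] (0 : ℝ), ∀ k, 4 < fundSol d (a ε k / (C * ε)) :=
    eventually_all.2 fun k => (tendsto_fundSol_radius h.two_le h.pos (h.radius_pos k)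
      (h.radius_lt_one k) (h.critical k)).eventually_gt_atTop 4
  filter_upwards [self_mem_nhdsWithin, h1, h.perforation, eventually_all.2 h.radius_pos, h2]
    with ε e1 e2 e3 e4 e5
  exact ⟨e1, e2, e3, e4, e5⟩

lemma mem_holeFinset (h : IsCriticalPerforation A Λ F N C ρ x a μt)
    (hε : IsFineScale A Λ F N C x a ε) (hD : D ⊆ Metric.ball 0 r) (p : Fin m × Eucl d × ℕ) :
    p ∈ holeFinset A Λ F N ε D ↔ p ∈ holeIndices A Λ F N ε D := by
  have hfin := finite_holeIndices h.disjoint_regions h.disjoint_tiles h.subset_ball hε.pos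
    hε.le_one (mul_pos h.pos hε.pos) hε.perforation hD
  rw [holeFinset, dif_pos hfin, Set.Finite.mem_toFinset]

lemma pairwiseDisjoint_holeFinset (h : IsCriticalPerforation A Λ F N C ρ x a μt)
    (hε : IsFineScale A Λ F N C x a ε) (hD : D ⊆ Metric.ball 0 r) :
    (holeFinset A Λ F N ε D : Set (Fin m × Eucl d × ℕ)).PairwiseDisjoint
      fun p => Metric.ball (x ε p.2.1 p.2.2) (C * ε) :=
  (pairwiseDisjoint_balls h.disjoint_regions h.disjoint_tiles hε.pos hε.perforation).subset
    fun p hp => (h.mem_holeFinset hε hD p).1 hp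

/-- Through the packing bound, sums over holes of `R^d G` are controlled by finitely many values of
`G`, one per region, uniformly in `ε`. -/
lemma sum_holeFinset_le (h : IsCriticalPerforation A Λ F N C ρ x a μt)
    (hε : IsFineScale A Λ F N C x a ε) (hD : D ⊆ Metric.ball 0 r) {G : Fin m → ℝ}
    (hG : ∀ k, 0 ≤ G k) :
    ∑ p ∈ holeFinset A Λ F N ε D, (C * ε) ^ d * G p.1
      ≤ (volume : Measure (Eucl d)).real (Metric.ball 0 (r + 2 * |ρ|)) /
        (volume : Measure (Eucl d)).real (Metric.ball 0 1) * ∑ k, G k := by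
  have hR : 0 < C * ε := mul_pos h.pos hε.pos
  have hpos : 0 < (volume : Measure (Eucl d)).real (Metric.ball 0 1) :=
    ENNReal.toReal_pos (Metric.measure_ball_pos _ _ one_pos).ne' measure_ball_lt_top.ne
  have hc := card_mul_le h.disjoint_regions h.disjoint_tiles h.subset_ball hε.pos hε.le_one hR
    hε.perforation hD (t := holeFinset A Λ F N ε D) fun p hp => (h.mem_holeFinset hε hD p).1 hp
  rw [← mul_assoc, ← le_div_iff₀ hpos] at hc
  have hS : 0 ≤ ∑ k, G k := Finset.sum_nonneg fun k _ => hG k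
  calc ∑ p ∈ holeFinset A Λ F N ε D, (C * ε) ^ d * G p.1
      ≤ ∑ p ∈ holeFinset A Λ F N ε D, (C * ε) ^ d * ∑ k, G k := by
        refine Finset.sum_le_sum fun p _ => mul_le_mul_of_nonneg_left ?_ (by positivity)
        exact Finset.single_le_sum (fun k _ => hG k) (Finset.mem_univ p.1)
    _ = (holeFinset A Λ F N ε D).card * (C * ε) ^ d * ∑ k, G k := by
        rw [Finset.sum_const, nsmul_eq_mul, mul_assoc]
    _ ≤ _ := mul_le_mul_of_nonneg_right hc hS

lemma closedBall_subset_ball (h : IsCriticalPerforation A Λ F N C ρ x a μt)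
    (hε : IsFineScale A Λ F N C x a ε) (k : Fin m) (z : Eucl d) :
    Metric.closedBall z (a ε k) ⊆ Metric.ball z (C * ε) := by
  refine Metric.closedBall_subset_ball ?_
  by_contra hcon
  have hR : 0 < C * ε := mul_pos h.pos hε.pos
  have h1 := fundSol_nonpos h.two_le ((one_le_div hR).2 (not_lt.1 hcon))
  linarith [hε.four_lt k]

/-- A hole meeting the support of `φ` lies in a tile meeting `D`, so it belongs to the finite family
whose corrector vanishes near it. Holes elsewhere do not matter. -/
lemma isTestFun_mul_holeCorrector (h : IsCriticalPerforation A Λ F N C ρ x a μt)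
    (hε : IsFineScale A Λ F N C x a ε) (hD : D ⊆ Metric.ball 0 r) (hΩD : Ω ⊆ D) {φ : Eucl d → ℝ}
    (hφ : IsTestFun Ω φ) :
    IsTestFun (Ω \ holes A Λ F N x a ε) fun y => φ y * holeCorrector A Λ F N C x a D ε y := by
  have ht := hφ.mul_smooth (ψ := holeCorrector A Λ F N C x a D ε) (contDiff_corrector h.two_le)
  refine ⟨ht.smooth, ht.compact, fun y hy => ⟨ht.support hy, fun hyh => ?_⟩⟩
  simp only [holes, mem_iUnion, Finset.mem_range] at hyh
  obtain ⟨k, i, hi, j, hj, hb⟩ := hyh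
  have hp : (k, i, j) ∈ holeFinset A Λ F N ε D := by
    rw [h.mem_holeFinset hε hD]
    exact ⟨hi, hj, y, hε.perforation.ball_subset k i hi j hj (h.closedBall_subset_ball hε k _ hb),
      hΩD (ht.support hy)⟩
  exact notMem_tsupport_corrector h.two_le (mul_pos h.pos hε.pos) (fun p _ => hε.four_lt p.1)
    (h.pairwiseDisjoint_holeFinset hε hD) hp (hε.radius_pos k) le_rfl hb
    (tsupport_mul_subset_right hy)

lemma tendsto_normL2_holeCorrector (h : IsCriticalPerforation A Λ F N C ρ x a μt)
    (hD : D ⊆ Metric.ball 0 r) :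
    Tendsto (fun ε => normL2 fun y => holeCorrector A Λ F N C x a D ε y - 1) (𝓝[>] 0) (𝓝 0) := by
  have h1 : Tendsto (fun ε : ℝ => (volume : Measure (Eucl d)).real (Metric.ball 0 (r + 2 * |ρ|)) /
      (volume : Measure (Eucl d)).real (Metric.ball 0 1) *
      ∑ k, ∫ y, (1 - unitCorrector d (fundSol d (a ε k / (C * ε))) y) ^ 2) (𝓝[>] 0) (𝓝 0) := by
    have h2 := tendsto_finsetSum Finset.univ fun k _ =>
      (tendsto_integral_one_sub_unitCorrector h.two_le).comp
        (tendsto_fundSol_radius h.two_le h.pos (h.radius_pos k) (h.radius_lt_one k) (h.critical k))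
    simpa using h2.const_mul ((volume : Measure (Eucl d)).real (Metric.ball 0 (r + 2 * |ρ|)) /
      (volume : Measure (Eucl d)).real (Metric.ball 0 1))
  have h3 := h1.sqrt
  rw [Real.sqrt_zero] at h3
  refine tendsto_of_tendsto_of_tendsto_of_le_of_le' tendsto_const_nhds h3
    (Eventually.of_forall fun ε => normL2_nonneg _) ?_
  filter_upwards [h.eventually_isFineScale] with ε hε
  refine Real.le_sqrt_of_sq_le ?_
  unfold holeCorrector
  rw [normL2_corrector_sub_one_sq h.two_le (mul_pos h.pos hε.pos) (fun p _ => hε.four_lt p.1)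
    (h.pairwiseDisjoint_holeFinset hε hD)]
  exact h.sum_holeFinset_le hε hD (G := fun k =>
    ∫ y, (1 - unitCorrector d (fundSol d (a ε k / (C * ε))) y) ^ 2)
    fun k => integral_nonneg fun y => sq_nonneg _

/-- The corrector satisfies `-Δ w = holeDensity` away from the holes, up to a small error. -/
lemma eventually_abs_integral_gradient_sub_le (h : IsCriticalPerforation A Λ F N C ρ x a μt)
    (hD : D ⊆ Metric.ball 0 r) {η : ℝ} (hη : 0 < η) :
    ∀ᶠ ε in 𝓝[>] (0 : ℝ), ∀ g, IsTestFun (Ω \ holes A Λ F N x a ε) g →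
      |(∫ y, inner ℝ (∇ g y) (∇ (holeCorrector A Λ F N C x a D ε) y))
        - ∫ y, holeDensity A Λ F N C x a D ε y * g y| ≤ η * normL2 (∇ g) := by
  -- The squared residual is a bounded packing constant times a sum over regions of `plateauConst *
  -- R^(-2)`, which converges, and `plateauConst`, which tends to zero.
  have h1 : Tendsto (fun ε : ℝ => (volume : Measure (Eucl d)).real (Metric.ball 0 (r + 2 * |ρ|)) /
      (volume : Measure (Eucl d)).real (Metric.ball 0 1) *
      ∑ k, plateauConst (fundSol d (a ε k / (C * ε))) * (C * ε)⁻¹ ^ 2 *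
        (plateauConst (fundSol d (a ε k / (C * ε))) * (4 * sphereArea d))) (𝓝[>] 0) (𝓝 0) := by
    have h2 := tendsto_finsetSum Finset.univ fun k _ =>
      (tendsto_plateauConst_div_sq h.two_le h.pos (h.radius_pos k) (h.radius_lt_one k)
        (h.critical k)).mul ((tendsto_plateauConst.comp
        (tendsto_fundSol_radius h.two_le h.pos (h.radius_pos k) (h.radius_lt_one k)
        (h.critical k))).mul_const (4 * sphereArea d))
    simpa using h2.const_mul ((volume : Measure (Eucl d)).real (Metric.ball 0 (r + 2 * |ρ|)) /
      (volume : Measure (Eucl d)).real (Metric.ball 0 1))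
  filter_upwards [h.eventually_isFineScale, h1.eventually_le_const (pow_pos hη 2)]
    with ε hε hsmall g hg
  have hR := mul_pos h.pos hε.pos
  have hdisj := h.pairwiseDisjoint_holeFinset hε hD
  refine (abs_integral_gradient_corrector_sub_le h.two_le hR (fun p _ => hε.four_lt p.1) hdisj
    (a := fun p => a ε p.1) (fun p _ => hε.radius_pos p.1) (fun p _ => le_rfl) hg.contDiff_one
    hg.compact fun p hp => ?_).trans ?_
  · refine Set.disjoint_left.2 fun y hy hyg => (hg.support hyg).2 ?_
    obtain ⟨hi, hj, -⟩ := (h.mem_holeFinset hε hD p).1 hp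
    exact mem_iUnion.2 ⟨p.1, mem_iUnion₂.2 ⟨p.2.1, hi, mem_iUnion₂.2
      ⟨p.2.2, Finset.mem_range.2 hj, hy⟩⟩⟩
  · rw [mul_comm]
    refine mul_le_mul_of_nonneg_right ?_ (normL2_nonneg _)
    refine abs_le_of_sq_le_sq' ?_ hη.le |>.2
    refine (integral_residualBound_sq h.two_le hR (fun p _ => hε.four_lt p.1) hdisj).2.trans ?_
    refine le_trans (le_of_eq ?_) ((h.sum_holeFinset_le hε hD (G := fun k =>
      plateauConst (fundSol d (a ε k / (C * ε))) * (C * ε)⁻¹ ^ 2 *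
        (plateauConst (fundSol d (a ε k / (C * ε))) * (4 * sphereArea d))) fun k => ?_).trans
        hsmall)
    · exact Finset.sum_congr rfl fun p _ => by ring
    · have := plateauConst_pos (hε.four_lt k)
      have := sphereArea_nonneg (d := d)
      positivity

lemma exists_bound_holeDensity (h : IsCriticalPerforation A Λ F N C ρ x a μt)
    (hD : D ⊆ Metric.ball 0 r) :
    ∃ M, 0 ≤ M ∧ ∀ᶠ ε in 𝓝[>] (0 : ℝ), ∀ y, |holeDensity A Λ F N C x a D ε y| ≤ M := by
  obtain ⟨K, hK0, hK⟩ := exists_fluxDensity_bound h.two_le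
  set L := ∑ k, (|dimFactor d * μt k * (C ^ d)⁻¹| + 1) with hL
  have hL0 : 0 ≤ L := by positivity
  refine ⟨L * K, by positivity, ?_⟩
  have h1 : ∀ᶠ ε in 𝓝[>] (0 : ℝ), ∀ k, plateauConst (fundSol d (a ε k / (C * ε))) *
      (C * ε)⁻¹ ^ 2 ≤ |dimFactor d * μt k * (C ^ d)⁻¹| + 1 :=
    eventually_all.2 fun k => (tendsto_plateauConst_div_sq h.two_le h.pos (h.radius_pos k)
      (h.radius_lt_one k) (h.critical k)).eventually_le_const
        (lt_of_le_of_lt (le_abs_self _) (lt_add_one _))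
  filter_upwards [h.eventually_isFineScale, h1] with ε hε hb y
  refine abs_correctorDensity_le h.two_le (mul_pos h.pos hε.pos)
    (h.pairwiseDisjoint_holeFinset hε hD) hL0 hK (fun p _ => ?_) y
  rw [abs_of_pos (plateauConst_pos (hε.four_lt p.1))]
  exact (hb p.1).trans (Finset.single_le_sum
    (f := fun k => |dimFactor d * μt k * (C ^ d)⁻¹| + 1) (fun k _ => by positivity)
    (Finset.mem_univ p.1))

end IsCriticalPerforation

end critical

/-! ### Convergence of the density to the potential -/

section potential

variable {d m : ℕ} {A Λ : Set (Eucl d)} {F : Fin m → Set (Eucl d)} {N : Fin m → ℕ} {C ρ : ℝ}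
  {x : ℝ → Eucl d → ℕ → Eucl d} {a : ℝ → Fin m → ℝ} {μt : Fin m → ℝ} {r : ℝ}
  {D Ω E : Set (Eucl d)}

lemma muConst_nonneg (hd : 2 ≤ d) : 0 ≤ muConst d A :=
  mul_nonneg (div_nonneg sphereArea_nonneg measureReal_nonneg) (dimFactor_pos hd).le

lemma holePotential_nonneg (hd : 2 ≤ d) (hμ : ∀ k, 0 ≤ μt k) (y : Eucl d) :
    0 ≤ holePotential A F N μt y := by
  refine mul_nonneg (muConst_nonneg hd) (Finset.sum_nonneg fun k _ => ?_)
  exact mul_nonneg (mul_nonneg (hμ k) (by positivity)) (indicator_nonneg (fun _ _ => zero_le_one) y)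

lemma abs_holePotential_le (y : Eucl d) :
    |holePotential A F N μt y| ≤ |muConst d A| * ∑ k, |μt k * N k| := by
  rw [holePotential, abs_mul]
  refine mul_le_mul_of_nonneg_left ((Finset.abs_sum_le_sum_abs _ _).trans
    (Finset.sum_le_sum fun k _ => ?_)) (abs_nonneg _)
  rw [abs_mul]
  refine mul_le_of_le_one_right (abs_nonneg _) ?_
  by_cases hy : y ∈ F k <;> simp [hy]

lemma measurable_holePotential (hF : ∀ k, MeasurableSet (F k)) :
    Measurable (holePotential A F N μt) :=
  (Finset.measurable_fun_sum _ fun k _ =>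
    (measurable_const.indicator (hF k)).const_mul _).const_mul _

/-- The sets `F k` need not be Borel. Replacing them by their interiors costs a null set and gives a
Borel measurable potential, as the averaging argument requires. -/
lemma holePotential_interior_ae_eq (hF : ∀ k, volume (frontier (F k)) = 0) :
    holePotential A (fun k => interior (F k)) N μt =ᵐ[volume] holePotential A F N μt := by
  have h1 : ∀ᵐ y, ∀ k, (y ∈ interior (F k)) = (y ∈ F k) :=
    ae_all_iff.2 fun k => interior_ae_eq_of_null_frontier (hF k)
  filter_upwards [h1] with y hy
  have h2 : ∀ k, (interior (F k)).indicator (fun _ => (1 : ℝ)) y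
      = (F k).indicator (fun _ => (1 : ℝ)) y := by
    intro k
    by_cases hk : y ∈ F k
    · rw [indicator_of_mem hk, indicator_of_mem ((hy k).mpr hk)]
    · rw [indicator_of_notMem hk, indicator_of_notMem fun h' => hk ((hy k).mp h')]
  simp only [holePotential, h2]

lemma isBddPotential_holePotential (hF : ∀ k, volume (frontier (F k)) = 0) :
    IsBddPotential (holePotential A F N μt) :=
  ⟨(measurable_holePotential fun _ => isOpen_interior.measurableSet).aestronglyMeasurable.congr
    (holePotential_interior_ae_eq hF), _, abs_holePotential_le⟩

/-- A function carried by `⋃ k, F k`, minus the potential, splits into its parts on the `F k`. -/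
lemma sub_holePotential_eq_sum (hFd : Pairwise fun k l => Disjoint (F k) (F l)) {b : Eucl d → ℝ}
    (hb : ∀ y, b y ≠ 0 → ∃ k, y ∈ F k) (y : Eucl d) :
    b y - holePotential A F N μt y
      = ∑ k, (F k).indicator (fun y => b y - muConst d A * (μt k * N k)) y := by
  by_cases hy : ∃ k, y ∈ F k
  · obtain ⟨k, hk⟩ := hy
    have hne : ∀ l, l ≠ k → y ∉ F l := fun l hl h =>
      Set.disjoint_left.1 (hFd hl) h hk
    rw [holePotential, Finset.sum_eq_single k (fun l _ hl => by simp [hne l hl]) (by simp),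
      Finset.sum_eq_single k (fun l _ hl => by simp [hne l hl]) (by simp)]
    simp [hk]
  · push Not at hy
    have h0 : b y = 0 := by
      by_contra h
      obtain ⟨k, hk⟩ := hb y h
      exact hy k hk
    simp [holePotential, h0, hy]

lemma volume_frontier_inter_eq_zero {s t : Set (Eucl d)} (hs : volume (frontier s) = 0)
    (ht : volume (frontier t) = 0) : volume (frontier (s ∩ t)) = 0 := by
  refine measure_mono_null (frontier_inter_subset s t) (measure_union_null ?_ ?_)
  · exact measure_mono_null inter_subset_left hs
  · exact measure_mono_null inter_subset_right ht

namespace IsCriticalPerforation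

/-- Two errors: tiles cut by the frontier of `E ∩ F k`, whose volume tends to zero while the density
stays bounded, and the gap between the mean over a tile and its limit. -/
lemma tendsto_setIntegral_region (h : IsCriticalPerforation A Λ F N C ρ x a μt)
    (hD : D ⊆ Metric.ball 0 r) (hED : E ⊆ D) (hE : volume (frontier E) = 0) (k : Fin m) :
    Tendsto (fun ε => ∫ y in E ∩ F k, (holeDensity A Λ F N C x a D ε y
      - muConst d A * (μt k * N k))) (𝓝[>] 0) (𝓝 0) := by
  obtain ⟨M, hM0, hM⟩ := h.exists_bound_holeDensity hD
  have hEb : Bornology.IsBounded E := Metric.isBounded_ball.subset (hED.trans hD)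
  have h0 := volume_frontier_inter_eq_zero hE (h.frontier_null k)
  have hmean := tendsto_meanDensity h.two_le h.pos (h.radius_pos k) (h.radius_lt_one k)
    (h.critical k) A (N k)
  set v := muConst d A * (μt k * N k) with hv
  have hfin : volume (E ∩ F k) ≠ ⊤ := (hEb.subset inter_subset_left).measure_lt_top.ne
  have hlim : Tendsto (fun ε : ℝ => (M + (|v| + 1)) * (volume : Measure (Eucl d)).real
      (Metric.cthickening (2 * ρ * ε) (frontier (E ∩ F k)))
      + |meanDensity d A (N k) ε (C * ε) (fundSol d (a ε k / (C * ε))) - v| *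
        (volume : Measure (Eucl d)).real (E ∩ F k)) (𝓝[>] 0) (𝓝 0) := by
    have h1 := (tendsto_volume_cthickening_frontier (hEb.subset inter_subset_left) h0
      ρ).const_mul (M + (|v| + 1))
    have h2 := ((hmean.sub_const v).abs).mul_const ((volume : Measure (Eucl d)).real (E ∩ F k))
    simpa using h1.add h2
  refine squeeze_zero_norm' ?_ hlim
  filter_upwards [h.eventually_isFineScale, hM,
    hmean.abs.eventually_le_const (lt_add_one |v|)] with ε hε hMε hmε
  have hR := mul_pos h.pos hε.pos
  have hmain := abs_setIntegral_correctorDensity_sub_le h.two_le h.disjoint_regions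
    h.nullMeasurable (h.volume_ne_zero k) h.countable h.cover h.disjoint_tiles h.subset_ball
    hε.pos hR hε.perforation (h.mem_holeFinset hε hD) hED hEb k
    (nullMeasurableSet_of_null_frontier h0)
    (T := fun k => fundSol d (a ε k / (C * ε))) hMε hmε
  have : IsFiniteMeasure (volume.restrict (E ∩ F k)) := ⟨by simpa using hfin.lt_top⟩
  have hint : Integrable (holeDensity A Λ F N C x a D ε) (volume.restrict (E ∩ F k)) :=
    Integrable.of_bound measurable_correctorDensity.aestronglyMeasurable M
      (Eventually.of_forall hMε)
  set q := meanDensity d A (N k) ε (C * ε) (fundSol d (a ε k / (C * ε))) with hq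
  have hsplit : ∫ y in E ∩ F k, (holeDensity A Λ F N C x a D ε y - v)
      = (∫ y in E ∩ F k, (holeDensity A Λ F N C x a D ε y - q))
        + (q - v) * (volume : Measure (Eucl d)).real (E ∩ F k) := by
    rw [integral_sub hint (integrable_const _), integral_sub hint (integrable_const _),
      setIntegral_const, setIntegral_const, smul_eq_mul, smul_eq_mul]
    ring
  rw [hsplit, Real.norm_eq_abs]
  refine (abs_add_le _ _).trans (add_le_add hmain (le_of_eq ?_))
  rw [abs_mul, abs_of_nonneg measureReal_nonneg]

lemma tendsto_setIntegral_sub_holePotential (h : IsCriticalPerforation A Λ F N C ρ x a μt)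
    (hD : D ⊆ Metric.ball 0 r) (hED : E ⊆ D) (hE : volume (frontier E) = 0) :
    Tendsto (fun ε => ∫ y in E, (holeDensity A Λ F N C x a D ε y
      - holePotential A F N μt y)) (𝓝[>] 0) (𝓝 0) := by
  obtain ⟨M, hM0, hM⟩ := h.exists_bound_holeDensity hD
  have hEb : Bornology.IsBounded E := Metric.isBounded_ball.subset (hED.trans hD)
  have : IsFiniteMeasure (volume.restrict E) := ⟨by simpa using hEb.measure_lt_top⟩
  have hsum := tendsto_finsetSum Finset.univ fun k _ =>
    h.tendsto_setIntegral_region hD hED hE k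
  rw [Finset.sum_const_zero] at hsum
  refine hsum.congr' ?_
  filter_upwards [h.eventually_isFineScale, hM] with ε hε hMε
  have hnull : ∀ k, NullMeasurableSet (F k) (volume.restrict E) := fun k =>
    (nullMeasurableSet_of_null_frontier (h.frontier_null k)).mono_ac
      Measure.absolutelyContinuous_restrict
  have hint : ∀ c : ℝ, Integrable (fun y => holeDensity A Λ F N C x a D ε y - c)
      (volume.restrict E) := fun c =>
    (Integrable.of_bound measurable_correctorDensity.aestronglyMeasurable M
      (Eventually.of_forall hMε)).sub (integrable_const c)
  have hsplit : ∀ y, holeDensity A Λ F N C x a D ε y - holePotential A F N μt y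
      = ∑ k, (F k).indicator (fun y => holeDensity A Λ F N C x a D ε y
        - muConst d A * (μt k * N k)) y :=
    sub_holePotential_eq_sum h.disjoint_regions fun y hy =>
      exists_mem_of_correctorDensity_ne_zero h.two_le (mul_pos h.pos hε.pos) hε.perforation
        (h.mem_holeFinset hε hD) (T := fun k => fundSol d (a ε k / (C * ε))) hy
  simp_rw [hsplit]
  rw [integral_finsetSum _ fun k _ => (hint _).indicator₀ (hnull k)]
  refine Finset.sum_congr rfl fun k _ => ?_
  rw [integral_indicator₀ (hnull k), Measure.restrict_restrict₀ (hnull k), inter_comm]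

/-- The correctors of a critical perforation are adapted to the perforated domains. -/
theorem isCorrectorFamily (h : IsCriticalPerforation A Λ F N C ρ x a μt)
    (hΩ : Ω ⊆ Metric.ball 0 r) :
    IsCorrectorFamily (𝓝[>] (0 : ℝ)) Ω (fun ε => Ω \ holes A Λ F N x a ε)
      (holePotential A F N μt) (holeCorrector A Λ F N C x a (Metric.ball 0 (r + 1))) := by
  -- The margin 1 keeps all balls of radius `δ < 1` around points of the ball of radius `r` inside
  -- the region whose holes are counted.
  set D := Metric.ball (0 : Eucl d) (r + 1) with hDdef
  have hΩD : Ω ⊆ D := hΩ.trans (Metric.ball_subset_ball (by linarith))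
  set V' := holePotential A (fun k => interior (F k)) N μt with hV'
  have hV'm : Measurable V' := measurable_holePotential fun _ => isOpen_interior.measurableSet
  have hae : V' =ᵐ[volume] holePotential A F N μt := holePotential_interior_ae_eq h.frontier_null
  obtain ⟨M, hM0, hM⟩ := h.exists_bound_holeDensity (D := D) (r := r + 1) subset_rfl
  set K := |muConst d A| * ∑ k, |μt k * N k| with hK
  have hK0 : 0 ≤ K := by positivity
  have hconv : ∀ y ∈ Metric.ball (0 : Eucl d) r, ∀ δ, 0 < δ → δ < 1 →
      Tendsto (fun ε => ∫ z in Metric.ball (0 : Eucl d) δ,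
        (holeDensity A Λ F N C x a D ε (y - z) - V' (y - z))) (𝓝[>] 0) (𝓝 0) := by
    intro y hy δ hδ hδ1
    have hsub : Metric.ball y δ ⊆ D := by
      refine Metric.ball_subset_ball' ?_
      rw [Metric.mem_ball] at hy
      linarith
    have hfr : volume (frontier (Metric.ball y δ)) = 0 := by
      rw [frontier_ball y hδ.ne']
      exact Measure.addHaar_sphere_of_ne_zero _ _ hδ.ne'
    refine (h.tendsto_setIntegral_sub_holePotential (D := D) subset_rfl hsub hfr).congr fun ε => ?_
    have e1 : ∫ z in Metric.ball y δ, (holeDensity A Λ F N C x a D ε z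
          - holePotential A F N μt z)
        = ∫ z in Metric.ball y δ, (holeDensity A Λ F N C x a D ε z - V' z) := by
      refine integral_congr_ae (ae_restrict_of_ae ?_)
      filter_upwards [hae] with z hz
      rw [hz]
    rw [e1, ← integral_indicator Metric.isOpen_ball.measurableSet,
      ← integral_indicator Metric.isOpen_ball.measurableSet,
      ← integral_sub_left_eq_self _ _ y]
    congr 1 with z
    have : y - z ∈ Metric.ball y δ ↔ z ∈ Metric.ball (0 : Eucl d) δ := by
      rw [mem_ball_iff_norm, mem_ball_zero_iff]; simp
    by_cases hz : z ∈ Metric.ball (0 : Eucl d) δ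
    · rw [indicator_of_mem (this.2 hz), indicator_of_mem hz]
    · rw [indicator_of_notMem fun hh => hz (this.1 hh), indicator_of_notMem hz]
  refine ⟨Eventually.of_forall fun ε => contDiff_corrector h.two_le, ?_, ?_,
    h.tendsto_normL2_holeCorrector subset_rfl, fun η hη => ?_⟩
  · filter_upwards [h.eventually_isFineScale] with ε hε
    exact hasCompactSupport_corrector_sub_one h.two_le (mul_pos h.pos hε.pos)
      fun p _ => hε.four_lt p.1
  · filter_upwards [h.eventually_isFineScale] with ε hε φ hφ
    exact h.isTestFun_mul_holeCorrector hε subset_rfl hΩD hφ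
  -- One half of `η` pays for replacing `-Δw` by the density, the other for replacing the density by
  -- the potential.
  · have hη2 : 0 < η / 2 := half_pos hη
    filter_upwards [h.eventually_abs_integral_gradient_sub_le (D := D) (Ω := Ω) subset_rfl hη2, hM,
      eventually_abs_integral_mul_le (l := 𝓝[>] (0 : ℝ)) (add_nonneg hM0 hK0)
        (σ := fun ε y => holeDensity A Λ F N C x a D ε y - V' y)
        (Eventually.of_forall fun ε => measurable_correctorDensity.sub hV'm)
        (hM.mono fun ε hε y => (abs_sub _ _).trans (add_le_add (hε y) (abs_holePotential_le y)))
        hconv hΩ hη2] with ε h1 hMε h2 g hg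
    have e1 := h1 g hg
    have e2 := h2 g (hg.mono sdiff_subset)
    have hgi : Integrable g := hg.continuous.integrable_of_hasCompactSupport hg.compact
    have i1 : Integrable fun y => holeDensity A Λ F N C x a D ε y * g y :=
      hgi.bdd_mul measurable_correctorDensity.aestronglyMeasurable (Eventually.of_forall hMε)
    have i2 : Integrable fun y => V' y * g y :=
      hgi.bdd_mul hV'm.aestronglyMeasurable (Eventually.of_forall abs_holePotential_le)
    have e3 : ∫ y, (holeDensity A Λ F N C x a D ε y - V' y) * g y
        = (∫ y, holeDensity A Λ F N C x a D ε y * g y)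
          - ∫ y, holePotential A F N μt y * g y := by
      simp_rw [sub_mul]
      rw [integral_sub i1 i2]
      congr 1
      refine integral_congr_ae ?_
      filter_upwards [hae] with y hy
      rw [hy]
    rw [e3] at e2
    have := normL2_nonneg g
    have := normL2_nonneg (∇ g)
    rw [abs_le] at e1 e2 ⊢
    constructor <;> nlinarith [e1.1, e1.2, e2.1, e2.2]

end IsCriticalPerforation

end potential

/-! ### The convergence theorem -/

theorem theorem2p1 {d : ℕ} (hd : 2 ≤ d)
    -- the domain, open and bounded with `C²` boundary
    (Ω : Set (Eucl d)) (hΩo : IsOpen Ω) (hΩb : Bornology.IsBounded Ω) (hΩc : HasC2Boundary Ω)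
    -- the right-hand side, in `L²(Ω)`
    (f : Eucl d → ℝ) (hf : MemLp f 2 (volume.restrict Ω))
    -- the regions of concentration and the numbers of holes per tile
    {m : ℕ} (F : Fin m → Set (Eucl d)) (hF : ∀ k, volume (frontier (F k)) = 0)
    (hFd : Pairwise fun k l => Disjoint (F k) (F l)) (N : Fin m → ℕ)
    -- the tiling of `ℝ^d` by the translates `A + i`, `i ∈ Λ`
    (A : Set (Eucl d)) (hA : NullMeasurableSet A volume) (hAb : Bornology.IsBounded A)
    (Λ : Set (Eucl d)) (hΛ : Λ.Countable)
    (hcover : (⋃ i ∈ Λ, (fun y => y + i) '' A) = univ)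
    (hdisj : Λ.PairwiseDisjoint fun i => (fun y => y + i) '' A)
    -- the centres of the holes
    (C : ℝ) (hC : 0 < C) (hCA : ∀ k, (N k : ENNReal) * volume (Metric.ball (0 : Eucl d) C) < volume A)
    (x : ℝ → Eucl d → ℕ → Eucl d)
    (hx : ∀ᶠ ε in 𝓝[>] (0 : ℝ), ∀ k, ∀ i ∈ innerIndices A Λ ε (F k),
      (∀ j < N k, Metric.ball (x ε i j) (C * ε) ⊆ tile A ε i) ∧
      (∀ j < N k, ∀ l < N k, j ≠ l →
        Disjoint (Metric.ball (x ε i j) (C * ε)) (Metric.ball (x ε i l) (C * ε))))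
    -- the critical radii of the holes
    (a : ℝ → Fin m → ℝ) (ha : ∀ᶠ ε in 𝓝[>] (0 : ℝ), ∀ k, 0 < a ε k)
    (ha2 : d = 2 → ∀ᶠ ε in 𝓝[>] (0 : ℝ), ∀ k, a ε k < 1)
    (μt : Fin m → ℝ) (hμ : ∀ k, 0 ≤ μt k)
    (hcrit : ∀ k, Tendsto (fun ε : ℝ => (ε ^ d)⁻¹ * capScale d (a ε k)) (𝓝[>] 0) (𝓝 (μt k))) :
    -- the problems in the perforated domains are uniquely solvable,
    (∀ᶠ ε in 𝓝[>] (0 : ℝ), ∃! v : L2Pair d,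
      IsDirichletSolution (Ω \ holes A Λ F N x a ε) (fun _ => 0) f v) ∧
    -- the limit problem has exactly one solution,
    ∃ u₀ : H10 Ω, IsDirichletSolution Ω (holePotential A F N μt) f u₀ ∧
      (∀ v : L2Pair d, IsDirichletSolution Ω (holePotential A F N μt) f v → v = u₀) ∧
      -- and the former solutions converge to it weakly in `H_0^1(Ω)`
      ∀ u : ℝ → H10 Ω,
        (∀ᶠ ε in 𝓝[>] (0 : ℝ),
          IsDirichletSolution (Ω \ holes A Λ F N x a ε) (fun _ => 0) f (u ε)) →
        Tendsto (fun ε => toWeakSpace ℝ (H10 Ω) (u ε)) (𝓝[>] 0) (𝓝 (toWeakSpace ℝ (H10 Ω) u₀)) := by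
  obtain ⟨ρ, hAρ⟩ := hAb.subset_ball 0
  obtain ⟨r, hΩr⟩ := hΩb.subset_ball 0
  have hd0 : 0 < d := by omega
  have hΩm : MeasurableSet Ω := hΩo.measurableSet
  have hperf : IsCriticalPerforation A Λ F N C ρ x a μt :=
    { two_le := hd
      frontier_null := hF
      disjoint_regions := hFd
      nullMeasurable := hA
      subset_ball := hAρ
      countable := hΛ
      cover := hcover
      disjoint_tiles := hdisj
      pos := hC
      -- Positivity of `|A|` is read off from the volume inequality of one region; without regions
      -- it is not called for.
      volume_ne_zero := fun k => (zero_le.trans_lt (hCA k)).ne'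
      perforation := hx.mono fun ε h => ⟨fun k i hi => (h k i hi).1, fun k i hi => (h k i hi).2⟩
      radius_pos := eventually_all.1 ha
      radius_lt_one := fun k h2 => eventually_all.1 (ha2 h2) k
      critical := hcrit }
  have hV : IsBddPotential (holePotential A F N μt) := isBddPotential_holePotential hF
  have hV0 : ∀ y, 0 ≤ holePotential A F N μt y := holePotential_nonneg hd hμ
  -- Solvability only uses that the perforated domain lies in the bounded set `Ω`, so it holds for
  -- every `ε`.
  refine ⟨Eventually.of_forall fun ε => existsUnique_dirichletSolution hd0 hΩm hΩb hf
    sdiff_subset isBddPotential_zero fun _ => le_rfl, ?_⟩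
  obtain ⟨u₀, hu₀, huniq⟩ :=
    existsUnique_dirichletSolution hd0 hΩm hΩb hf subset_rfl hV hV0
  exact ⟨⟨u₀, hu₀.1⟩, hu₀, huniq, fun u hu =>
    (hperf.isCorrectorFamily hΩr).tendsto_dirichletSolution hd0 hΩm hΩb hf
      (fun _ => sdiff_subset) hV hV0 hu₀ hu⟩
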